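/- **Setting.** Let $d>0$, $\mathrm k>0$, $h>0$, $\alpha\ge 0$, $0<\gamma<a<d$, $0<c<1$, let $j\ge 0$ be an integer, and let $f:\mathbb R\to\mathbb R$ be infinitely differentiable and $d$-periodic. Let $$G(X,Y)=\tfrac{\mathrm i}{4}H^{(1)}_0\!\big(\mathrm k\sqrt{X^2+Y^2}\big),\qquad G_j(X,Y)=\sum_{m=0}^{j}(-1)^m\binom jm\,G(X,Y+mh),$$ let $\nu(x')=(-f'(x'),1)/\sqrt{1+f'(x')^2}$ and $ds'=\sqrt{1+f'(x')^2}\,dx'$ be the unit normal and the element of length at the point $(x',f(x'))$ of the curve $y=f(x)$, and put $$\partial_{\nu'}G_j(x,x')=\Big[\nu(x')\cdot\nabla_{(x',y')}\,G_j(x-x',y-y')\Big]_{y=f(x),\,y'=f(x')}.$$ For $0\le\gamma_0<a_0$ let $S_{\gamma_0,a_0}(x)$ be the smooth window that equals $1$ for $|x|\le\gamma_0$, $0$ for $|x|\ge a_0$, and $\exp\!\big(\tfrac{2e^{-1/u}}{u-1}\big)$ with $u=\tfrac{|x|-\gamma_0}{a_0-\gamma_0}$ for $\gamma_0<|x|<a_0$;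 let $S^f_{\gamma,a}(x,x')=S_{\gamma,a}\big(\sqrt{(x-x')^2+(f(x)-f(x'))^2}\big)$. Call $\mathrm k$ a Wood frequency if $\mathrm k^2=(\alpha+2\pi n/d)^2$ for some $n\in\mathbb Z$. Let $\mu:\mathbb R\to\mathbb C$ be infinitely differentiable and $\alpha$-quasi-periodic, i.e. $\mu(x+d)=\mu(x)e^{\mathrm i\alpha d}$. The regular part of the shifted-Green-function double-layer operator is the (improper) integral $$\tilde D_{\rm reg}[\mu](x)=\int_{-\infty}^{\infty}\partial_{\nu'}G_j(x,x')\,\big(1-S^f_{\gamma,a}(x,x')\big)\,\mu(x')\,ds'.$$ For an integer $N\ge 1$ put $\Delta x=d/N$, $x_\ell=\ell\Delta x$ and $(\Delta s)_\ell=\Delta x\sqrt{1+f'(x_\ell)^2}$ for $\ell\in\mathbb Z$; let $\vec\mu=[\mu(x_1),\dots,\mu(x_N)]$, extended to all indices by $\mu_{\ell+pN}=\mu_\ell e^{\mathrm i\alpha pd}$. For $A>0$ put $$\tilde D^{A,\Delta x}_{\rm reg}[\vec\mu](x)=\sum_{\ell\in\mathbb Z}\partial_{\nu'}G_j(x,x_\ell)\,S_{cA,A}(x-x_\ell)\,\big(1-S^f_{\gamma,a}(x,x_\ell)\big)\,\mu_\ell\,(\Delta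 s)_\ell,$$ $$\tilde D^{\Delta x}_{\rm reg}[\vec\mu](x)=\sum_{\ell=-\infty}^{\infty}\partial_{\nu'}G_j(x,x_\ell)\,\big(1-S^f_{\gamma,a}(x,x_\ell)\big)\,\mu_\ell\,(\Delta s)_\ell .$$ **Lemma.** Assume that $j\ge1$ or that $\mathrm k$ is not a Wood frequency. Then, for all $x\in[0,d]$ and $N\ge1$, the improper integral $\tilde D_{\rm reg}[\mu](x)$ and the two-sided series $\tilde D^{\Delta x}_{\rm reg}[\vec\mu](x)$ converge (both ends of the integration interval, or summation range, tending to infinity independently), and $\tilde D^{A,\Delta x}_{\rm reg}[\vec\mu](x)\to\tilde D_{\rm reg}[\mu](x)$ uniformly for $x\in[0,d]$ as $A\to\infty$ and $\Delta x\to0$. More precisely, there are constants $E_p$ and $C_q$, independent of $A$, of $\Delta x$ and of $x\in[0,d]$ ($E_p$ is also independent of $q$, and $C_q$ of $p$), such that $$\big|\tilde D_{\rm reg}[\mu](x)-\tilde D^{A,\Delta x}_{\rm reg}[\vec\mu](x)\big|\le E_p(\Delta x)^p+C_qA^{-q}\qquad(x\in[0,d],\ A>0,\ N\ge1)$$ for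 all positive integers $p$, where: * if $j\ge1$, the estimate holds with $q=\lfloor\frac{j+1}2\rfloor-\frac12$ at every frequency $\mathrm k>0$, in particular near and at Wood frequencies; * if $\mathrm k$ is not a Wood frequency, the estimate holds for every positive integer $q$ (and every $j\ge0$). Moreover $$\big|\tilde D_{\rm reg}[\mu](x)-\tilde D^{\Delta x}_{\rm reg}[\vec\mu](x)\big|\le E_p(\Delta x)^p\qquad(x\in[0,d],\ N\ge1)\quad\text{for all }p\in\mathbb N.$$ -/

import Mathlib

open Filter Topology MeasureTheory
open scoped ContDiff

noncomputable section

namespace WoodNystrom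

/-! ### The Hankel function `H₀⁽¹⁾` on the positive real axis -/

/-- The amplitude in Hankel's integral,
`∫_0^∞ e^{-x t} t^{-1/2} (1 + i t / 2)^{-1/2} dt` (principal branch), for `x > 0`. -/
def hankelAmplitude (x : ℝ) : ℂ :=
  ∫ t in Set.Ioi (0 : ℝ),
    (Real.exp (-(x * t)) : ℂ) *
      (((t ^ (-(1 / 2) : ℝ) : ℝ) : ℂ) * (1 + Complex.I * t / 2) ^ (-(1 / 2) : ℂ))

/-- The Hankel function of the first kind of order zero, `H₀⁽¹⁾(x) = J₀(x) + i Y₀(x)` for `x > 0`,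
built from Hankel's integral
`H₀⁽¹⁾(x) = (√2 / π) e^{i(x - π/4)} ∫_0^∞ e^{-x t} t^{-1/2} (1 + i t / 2)^{-1/2} dt`.
The theorems `hankelH10_bessel` and `hankelH10_asymptotic` below prove that this is the solution
of Bessel's equation of order zero which is asymptotic to `√(2 / (π x)) e^{i(x - π/4)}`
as `x → ∞`; these two properties determine `H₀⁽¹⁾` on `(0, ∞)`. -/
def hankelH10 (x : ℝ) : ℂ :=
  ((Real.sqrt 2 / Real.pi : ℝ) : ℂ) * Complex.exp (Complex.I * (x - Real.pi / 4)) *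
    hankelAmplitude x

/-! ### Consistency of the definition of `H₀⁽¹⁾` -/

/-- The weight `t^{-1/2} (1 + i t / 2)^{-1/2}` in Hankel's integral. -/
def hankelWeight (t : ℝ) : ℂ :=
  ((t ^ (-(1 / 2) : ℝ) : ℝ) : ℂ) * (1 + Complex.I * t / 2) ^ (-(1 / 2) : ℂ)

theorem one_add_I_mul_mem_slitPlane (t : ℝ) : 1 + Complex.I * t / 2 ∈ Complex.slitPlane := by
  left
  simp

theorem norm_one_add_I_mul_cpow_le (t : ℝ) :
    ‖(1 + Complex.I * t / 2) ^ (-(1 / 2) : ℂ)‖ ≤ 1 := by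
  have h1 : (1 : ℝ) ≤ ‖(1 + Complex.I * t / 2 : ℂ)‖ := by
    refine le_trans ?_ (Complex.abs_re_le_norm _)
    simp
  have he : (-(1 / 2) : ℂ) = ((-(1 / 2) : ℝ) : ℂ) := by push_cast; rfl
  rw [he, Complex.norm_cpow_real]
  exact Real.rpow_le_one_of_one_le_of_nonpos h1 (by norm_num)

theorem norm_hankelWeight_le {t : ℝ} (ht : 0 < t) : ‖hankelWeight t‖ ≤ t ^ (-(1 / 2) : ℝ) := by
  have h0 : 0 < t ^ (-(1 / 2) : ℝ) := Real.rpow_pos_of_pos ht _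
  rw [hankelWeight, norm_mul, Complex.norm_real, Real.norm_of_nonneg h0.le]
  exact mul_le_of_le_one_right h0.le (norm_one_add_I_mul_cpow_le t)

theorem measurable_hankelWeight : Measurable hankelWeight := by
  unfold hankelWeight
  fun_prop

theorem integrable_bound (n : ℕ) {x : ℝ} (hx : 0 < x) :
    IntegrableOn (fun t : ℝ => t ^ n * t ^ (-(1 / 2) : ℝ) * Real.exp (-(x * t)))
      (Set.Ioi 0) := by
  have h := integrableOn_rpow_mul_exp_neg_mul_rpow (p := 1) (s := (n : ℝ) + -(1 / 2)) (b := x)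
    (by have : (0 : ℝ) ≤ n := n.cast_nonneg
        linarith) one_pos hx
  refine h.congr_fun (fun t ht => ?_) measurableSet_Ioi
  have ht' : (0 : ℝ) < t := ht
  simp only [Real.rpow_add ht', Real.rpow_natCast, Real.rpow_one, neg_mul]

theorem norm_moment_le (n : ℕ) (x : ℝ) {t : ℝ} (ht : 0 < t) :
    ‖(Real.exp (-(x * t)) : ℂ) * ((t : ℂ) ^ n * hankelWeight t)‖ ≤
      t ^ n * t ^ (-(1 / 2) : ℝ) * Real.exp (-(x * t)) := by
  rw [norm_mul, norm_mul, Complex.norm_real, norm_pow, Complex.norm_real,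
    Real.norm_of_nonneg ht.le, Real.norm_of_nonneg (Real.exp_pos _).le, mul_comm]
  have := norm_hankelWeight_le ht
  gcongr

theorem integrable_moment (n : ℕ) {x : ℝ} (hx : 0 < x) :
    IntegrableOn (fun t : ℝ => (Real.exp (-(x * t)) : ℂ) * ((t : ℂ) ^ n * hankelWeight t))
      (Set.Ioi 0) := by
  refine Integrable.mono' (integrable_bound n hx) ?_ ?_
  · have := measurable_hankelWeight
    exact Measurable.aestronglyMeasurable (by fun_prop)
  · filter_upwards [ae_restrict_mem measurableSet_Ioi] with t ht
    exact norm_moment_le n x ht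

/-- The moments `∫_0^∞ e^{-x t} t^n w(t) dt` of the weight in Hankel's integral. -/
def hankelMoment (n : ℕ) (x : ℝ) : ℂ :=
  ∫ t in Set.Ioi (0 : ℝ), (Real.exp (-(x * t)) : ℂ) * ((t : ℂ) ^ n * hankelWeight t)

theorem hankelAmplitude_eq_moment (x : ℝ) : hankelAmplitude x = hankelMoment 0 x := by
  simp [hankelAmplitude, hankelMoment, hankelWeight]

theorem hasDerivAt_hankelMoment (n : ℕ) {x : ℝ} (hx : 0 < x) :
    HasDerivAt (hankelMoment n) (-hankelMoment (n + 1) x) x := by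
  have hm := measurable_hankelWeight
  have key := hasDerivAt_integral_of_dominated_loc_of_deriv_le
    (μ := volume.restrict (Set.Ioi (0 : ℝ))) (x₀ := x) (s := Set.Ioi (x / 2))
    (F := fun (y : ℝ) (t : ℝ) => (Real.exp (-(y * t)) : ℂ) * ((t : ℂ) ^ n * hankelWeight t))
    (F' := fun (y : ℝ) (t : ℝ) =>
      -((Real.exp (-(y * t)) : ℂ) * ((t : ℂ) ^ (n + 1) * hankelWeight t)))
    (bound := fun t => t ^ (n + 1) * t ^ (-(1 / 2) : ℝ) * Real.exp (-(x / 2 * t)))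
    (Ioi_mem_nhds (by linarith))
    (Filter.Eventually.of_forall fun y => Measurable.aestronglyMeasurable (by fun_prop))
    (integrable_moment n hx) (Measurable.aestronglyMeasurable (by fun_prop))
    (by
      filter_upwards [ae_restrict_mem measurableSet_Ioi] with t ht y hy
      have ht' : (0 : ℝ) < t := ht
      have hy' : x / 2 < y := hy
      rw [norm_neg]
      refine (norm_moment_le (n + 1) y ht').trans ?_
      gcongr)
    (integrable_bound (n + 1) (by linarith))
    (by
      filter_upwards with t y hy
      have h1 : HasDerivAt (fun y : ℝ => Real.exp (-(y * t))) (Real.exp (-(y * t)) * -(1 * t)) y :=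
        ((hasDerivAt_id y).mul_const t).neg.exp
      refine (h1.ofReal_comp.mul_const ((t : ℂ) ^ n * hankelWeight t)).congr_deriv ?_
      push_cast
      ring)
  have h2 := key.2
  rw [integral_neg] at h2
  exact h2

/-- Integration by parts in Hankel's integral. -/
theorem hankelMoment_relation {x : ℝ} (hx : 0 < x) :
    (x : ℂ) * hankelMoment 2 x - (2 * Complex.I * x + 1) * hankelMoment 1 x
      + Complex.I * hankelMoment 0 x = 0 := by
  set W : ℝ → ℂ := fun t => -2 * Complex.I *
    (((t ^ (1 / 2 : ℝ) : ℝ) : ℂ) * (1 + Complex.I * t / 2) ^ (1 / 2 : ℂ)) with hW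
  have hWw : ∀ t : ℝ, 0 < t → W t = ((t : ℂ) ^ 2 - 2 * Complex.I * t) * hankelWeight t := by
    intro t ht
    have hz : (1 + Complex.I * t / 2 : ℂ) ≠ 0 :=
      Complex.slitPlane_ne_zero (one_add_I_mul_mem_slitPlane t)
    have e1 : (1 + Complex.I * t / 2 : ℂ) ^ (1 / 2 : ℂ) =
        (1 + Complex.I * t / 2) * (1 + Complex.I * t / 2 : ℂ) ^ (-(1 / 2) : ℂ) := by
      rw [show (1 / 2 : ℂ) = 1 + -(1 / 2) by norm_num, Complex.cpow_add _ _ hz, Complex.cpow_one]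
      norm_num
    have e2 : t ^ (1 / 2 : ℝ) = t * t ^ (-(1 / 2) : ℝ) := by
      conv_rhs => rw [← Real.rpow_one_add' ht.le (by norm_num)]
      norm_num
    simp only [hW, hankelWeight]
    rw [e1, e2]
    push_cast
    linear_combination (- (t:ℂ)^2 * ((t ^ (-(1 / 2) : ℝ) : ℝ) : ℂ) *
      (1 + Complex.I * t / 2 : ℂ) ^ (-(1 / 2) : ℂ)) * Complex.I_sq
  have hWd : ∀ t : ℝ, 0 < t → HasDerivAt W (((t : ℂ) - Complex.I) * hankelWeight t) t := by
    intro t ht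
    have hz := one_add_I_mul_mem_slitPlane t
    have d1 : HasDerivAt (fun t : ℝ => ((t ^ (1 / 2 : ℝ) : ℝ) : ℂ))
        (((1 / 2 * t ^ ((1 / 2 : ℝ) - 1) : ℝ)) : ℂ) t :=
      (Real.hasDerivAt_rpow_const (Or.inl ht.ne')).ofReal_comp
    have d2 : HasDerivAt (fun z : ℂ => 1 + Complex.I * z / 2) (Complex.I / 2) (t : ℂ) := by
      have := (((hasDerivAt_id (t : ℂ)).const_mul Complex.I).div_const 2).const_add (1 : ℂ)
      simpa using this
    have d3 := (d2.cpow_const (c := (1 / 2 : ℂ)) hz).comp_ofReal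
    have d4 := (d1.mul d3).const_mul (-2 * Complex.I)
    refine d4.congr_deriv ?_
    have hz0 := Complex.slitPlane_ne_zero hz
    have e1 : (1 + Complex.I * t / 2 : ℂ) ^ (1 / 2 : ℂ) =
        (1 + Complex.I * t / 2) * (1 + Complex.I * t / 2 : ℂ) ^ (-(1 / 2) : ℂ) := by
      rw [show (1 / 2 : ℂ) = 1 + -(1 / 2) by norm_num, Complex.cpow_add _ _ hz0, Complex.cpow_one]
      norm_num
    have e2 : t ^ (1 / 2 : ℝ) = t * t ^ (-(1 / 2) : ℝ) := by
      conv_rhs => rw [← Real.rpow_one_add' ht.le (by norm_num)]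
      norm_num
    have e3 : (1 / 2 : ℂ) - 1 = -(1 / 2) := by norm_num
    have e4 : (1 / 2 : ℝ) - 1 = -(1 / 2) := by norm_num
    rw [e1, e2, e3, e4]
    simp only [hankelWeight]
    push_cast
    linear_combination (- (t:ℂ) * ((t ^ (-(1 / 2) : ℝ) : ℝ) : ℂ) *
      (1 + Complex.I * t / 2 : ℂ) ^ (-(1 / 2) : ℂ)) * Complex.I_sq
  have hW0 : W 0 = 0 := by simp [hW]
  have hWc : Continuous W := by
    have c1 : Continuous fun t : ℝ => t ^ (1 / 2 : ℝ) :=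
      Real.continuous_rpow_const (by norm_num)
    have c2 : Continuous fun t : ℝ => (1 + Complex.I * t / 2 : ℂ) ^ (1 / 2 : ℂ) :=
      Continuous.cpow (by fun_prop) continuous_const one_add_I_mul_mem_slitPlane
    exact continuous_const.mul ((Complex.continuous_ofReal.comp c1).mul c2)
  set F : ℝ → ℂ := fun t => (Real.exp (-(x * t)) : ℂ) * W t with hF
  set F' : ℝ → ℂ := fun t => -(x : ℂ) *
      ((Real.exp (-(x * t)) : ℂ) * ((t : ℂ) ^ 2 * hankelWeight t)) +
    (2 * Complex.I * x + 1) * ((Real.exp (-(x * t)) : ℂ) * ((t : ℂ) ^ 1 * hankelWeight t)) +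
    (-Complex.I) * ((Real.exp (-(x * t)) : ℂ) * ((t : ℂ) ^ 0 * hankelWeight t)) with hF'
  have i0 := (integrable_moment 0 hx).const_mul (-Complex.I)
  have i1 := (integrable_moment 1 hx).const_mul (2 * Complex.I * x + 1)
  have i2 := (integrable_moment 2 hx).const_mul (-(x : ℂ))
  have hint : IntegrableOn F' (Set.Ioi 0) := (i2.add i1).add i0
  have hder : ∀ t ∈ Set.Ioi (0 : ℝ), HasDerivAt F (F' t) t := by
    intro t ht
    have ht' : (0 : ℝ) < t := ht
    have h1 : HasDerivAt (fun t : ℝ => Real.exp (-(x * t))) (Real.exp (-(x * t)) * -(x * 1)) t :=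
      ((hasDerivAt_id t).const_mul x).neg.exp
    refine (h1.ofReal_comp.mul (hWd t ht')).congr_deriv ?_
    rw [hWw t ht']
    simp only [hF']
    push_cast
    ring
  have hlim : Tendsto F atTop (𝓝 0) := by
    have b1 : Tendsto (fun t : ℝ => (t + 2) * t ^ (1 / 2 : ℝ) * Real.exp (-(x * t))) atTop
        (𝓝 0) := by
      have l1 := tendsto_rpow_mul_exp_neg_mul_atTop_nhds_zero (3 / 2) x hx
      have l2 := (tendsto_rpow_mul_exp_neg_mul_atTop_nhds_zero (1 / 2) x hx).const_mul 2
      have l3 := l1.add l2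
      simp only [mul_zero, add_zero] at l3
      refine l3.congr' ?_
      filter_upwards [eventually_gt_atTop 0] with t ht
      have : t ^ (3 / 2 : ℝ) = t * t ^ (1 / 2 : ℝ) := by
        conv_rhs => rw [← Real.rpow_one_add' ht.le (by norm_num)]
        norm_num
      rw [this, neg_mul]
      ring
    refine squeeze_zero_norm' ?_ b1
    filter_upwards [eventually_gt_atTop 0] with t ht
    have hw := norm_hankelWeight_le ht
    have e2 : t ^ (1 / 2 : ℝ) = t * t ^ (-(1 / 2) : ℝ) := by
      conv_rhs => rw [← Real.rpow_one_add' ht.le (by norm_num)]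
      norm_num
    have hn : ‖(t : ℂ) ^ 2 - 2 * Complex.I * t‖ ≤ (t + 2) * t := by
      refine (norm_sub_le _ _).trans (le_of_eq ?_)
      simp [abs_of_pos ht]
      ring
    simp only [hF]
    rw [hWw t ht, norm_mul, norm_mul, Complex.norm_real, Real.norm_of_nonneg (Real.exp_pos _).le,
      e2, mul_comm, ← mul_assoc (t + 2) t]
    gcongr
  have hI := integral_Ioi_of_hasDerivAt_of_tendsto (a := 0) (f := F) (f' := F') (m := 0)
    (Continuous.continuousWithinAt (by fun_prop)) hder hint hlim
  have hF0 : F 0 = 0 := by simp [hF, hW0]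
  rw [hF0, sub_zero] at hI
  have hsplit : ∫ t in Set.Ioi (0 : ℝ), F' t = -(x : ℂ) * hankelMoment 2 x +
      (2 * Complex.I * x + 1) * hankelMoment 1 x + (-Complex.I) * hankelMoment 0 x := by
    simp only [hF', hankelMoment]
    rw [← integral_const_mul, ← integral_const_mul, ← integral_const_mul, ← integral_add i2 i1]
    exact integral_add (i2.add i1) i0
  rw [hsplit] at hI
  linear_combination -hI

/-- `H₀⁽¹⁾` solves Bessel's equation `x² H'' + x H' + x² H = 0` of order zero on `(0, ∞)`. -/
theorem hankelH10_bessel : ∃ H1 H2 : ℝ → ℂ, ∀ x : ℝ, 0 < x →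
    HasDerivAt hankelH10 (H1 x) x ∧ HasDerivAt H1 (H2 x) x ∧
      (x : ℂ) ^ 2 * H2 x + x * H1 x + (x : ℂ) ^ 2 * hankelH10 x = 0 := by
  set K : ℝ → ℂ := fun x =>
    ((Real.sqrt 2 / Real.pi : ℝ) : ℂ) * Complex.exp (Complex.I * (x - Real.pi / 4)) with hK
  have hKd : ∀ x : ℝ, HasDerivAt K (Complex.I * K x) x := by
    intro x
    have h1 : HasDerivAt (fun x : ℝ => Complex.I * ((x : ℂ) - Real.pi / 4)) Complex.I x := by
      have := ((hasDerivAt_id x).ofReal_comp.sub_const ((Real.pi : ℂ) / 4)).const_mul Complex.I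
      simpa using this
    refine (h1.cexp.const_mul ((Real.sqrt 2 / Real.pi : ℝ) : ℂ)).congr_deriv ?_
    simp only [hK]
    ring
  have hH : hankelH10 = fun x => K x * hankelMoment 0 x := by
    funext x
    rw [hankelH10, hankelAmplitude_eq_moment]
  refine ⟨fun x => Complex.I * (K x * hankelMoment 0 x) - K x * hankelMoment 1 x,
    fun x => -(K x * hankelMoment 0 x) - 2 * Complex.I * (K x * hankelMoment 1 x) +
      K x * hankelMoment 2 x, fun x hx => ⟨?_, ?_, ?_⟩⟩
  · rw [hH]
    refine ((hKd x).mul (hasDerivAt_hankelMoment 0 hx)).congr_deriv ?_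
    simp only [zero_add]
    ring
  · have h0 := ((hKd x).mul (hasDerivAt_hankelMoment 0 hx)).const_mul Complex.I
    have h1 := (hKd x).mul (hasDerivAt_hankelMoment 1 hx)
    refine (h0.sub h1).congr_deriv ?_
    simp only [zero_add, Nat.reduceAdd]
    linear_combination (K x * hankelMoment 0 x) * Complex.I_sq
  · rw [hH]
    linear_combination (x : ℂ) * K x * hankelMoment_relation hx

/-- `H₀⁽¹⁾(x) ~ √(2 / (π x)) e^{i (x - π/4)}` as `x → ∞`. -/
theorem hankelH10_asymptotic :
    Tendsto (fun x : ℝ => hankelH10 x /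
      (((Real.sqrt (2 / (Real.pi * x)) : ℝ) : ℂ) * Complex.exp (Complex.I * (x - Real.pi / 4))))
      atTop (𝓝 1) := by
  have hmw := measurable_hankelWeight
  set Φ : ℝ → ℝ → ℂ := fun x u => ((Real.exp (-u) * u ^ (-(1 / 2) : ℝ) : ℝ) : ℂ) *
    (1 + Complex.I * ((x⁻¹ * u : ℝ) : ℂ) / 2) ^ (-(1 / 2) : ℂ) with hΦ
  have hgam : IntegrableOn (fun u : ℝ => Real.exp (-u) * u ^ (-(1 / 2) : ℝ)) (Set.Ioi 0) := by
    have := Real.GammaIntegral_convergent (s := 1 / 2) (by norm_num)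
    norm_num at this ⊢
    exact this
  have hgamv : ∫ u in Set.Ioi (0 : ℝ), ((Real.exp (-u) * u ^ (-(1 / 2) : ℝ) : ℝ) : ℂ) =
      ((Real.sqrt Real.pi : ℝ) : ℂ) := by
    rw [integral_complex_ofReal, ← Real.Gamma_one_half_eq, Real.Gamma_eq_integral (by norm_num)]
    norm_num
  have hlim : Tendsto (fun x : ℝ => ∫ u in Set.Ioi (0 : ℝ), Φ x u) atTop
      (𝓝 ((Real.sqrt Real.pi : ℝ) : ℂ)) := by
    rw [← hgamv]
    refine tendsto_integral_filter_of_dominated_convergence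
      (fun u : ℝ => Real.exp (-u) * u ^ (-(1 / 2) : ℝ)) ?_ ?_ hgam ?_
    · exact Filter.Eventually.of_forall fun x => Measurable.aestronglyMeasurable (by fun_prop)
    · refine Filter.Eventually.of_forall fun x => ?_
      filter_upwards [ae_restrict_mem measurableSet_Ioi] with u hu
      have hu' : (0 : ℝ) < u := hu
      have h0 : 0 ≤ Real.exp (-u) * u ^ (-(1 / 2) : ℝ) := by positivity
      simp only [hΦ]
      rw [norm_mul, Complex.norm_real, Real.norm_of_nonneg h0]
      exact mul_le_of_le_one_right h0 (norm_one_add_I_mul_cpow_le _)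
    · filter_upwards with u
      have c : ContinuousAt (fun y : ℝ => (1 + Complex.I * (y : ℂ) / 2) ^ (-(1 / 2) : ℂ)) 0 :=
        (Continuous.cpow (by fun_prop) continuous_const one_add_I_mul_mem_slitPlane).continuousAt
      have l : Tendsto (fun x : ℝ => x⁻¹ * u) atTop (𝓝 0) := by
        simpa using tendsto_inv_atTop_zero.mul_const u
      have := (c.tendsto.comp l).const_mul ((Real.exp (-u) * u ^ (-(1 / 2) : ℝ) : ℝ) : ℂ)
      simpa [hΦ] using this
  have hscale : ∀ x : ℝ, 0 < x → ((Real.sqrt x : ℝ) : ℂ) * hankelAmplitude x =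
      ∫ u in Set.Ioi (0 : ℝ), Φ x u := by
    intro x hx
    have h := integral_comp_mul_left_Ioi (Φ x) 0 hx
    rw [mul_zero] at h
    have h2 : ∫ u in Set.Ioi (0 : ℝ), Φ x u = (x : ℂ) * ∫ t in Set.Ioi (0 : ℝ), Φ x (x * t) := by
      rw [h, Complex.real_smul, ← mul_assoc]
      push_cast
      rw [mul_inv_cancel₀ (by exact_mod_cast hx.ne'), one_mul]
    rw [h2, hankelAmplitude, ← integral_const_mul, ← integral_const_mul]
    refine setIntegral_congr_fun measurableSet_Ioi fun t ht => ?_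
    have ht' : (0 : ℝ) < t := ht
    have e : Real.sqrt x = x * x ^ (-(1 / 2) : ℝ) := by
      conv_rhs => rw [← Real.rpow_one_add' hx.le (by norm_num)]
      rw [Real.sqrt_eq_rpow]
      norm_num
    simp only [hΦ]
    rw [inv_mul_cancel_left₀ hx.ne', Real.mul_rpow hx.le ht'.le, e]
    push_cast
    ring
  have hsp : ((Real.sqrt Real.pi : ℝ) : ℂ) ≠ 0 := by
    exact_mod_cast (Real.sqrt_pos.2 Real.pi_pos).ne'
  have hfin := hlim.div_const ((Real.sqrt Real.pi : ℝ) : ℂ)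
  rw [div_self hsp] at hfin
  refine hfin.congr' ?_
  filter_upwards [eventually_gt_atTop 0] with x hx
  rw [← hscale x hx, hankelH10]
  have hs2 : ((Real.sqrt 2 : ℝ) : ℂ) ≠ 0 := by
    exact_mod_cast (Real.sqrt_pos.2 two_pos).ne'
  have hsx : ((Real.sqrt x : ℝ) : ℂ) ≠ 0 := by
    exact_mod_cast (Real.sqrt_pos.2 hx).ne'
  have hpi : (Real.pi : ℂ) = ((Real.sqrt Real.pi : ℝ) : ℂ) ^ 2 := by
    exact_mod_cast (Real.sq_sqrt Real.pi_pos.le).symm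
  have hexp := Complex.exp_ne_zero (Complex.I * ((x : ℂ) - Real.pi / 4))
  have hsq : ((Real.sqrt (2 / (Real.pi * x)) : ℝ) : ℂ) =
      ((Real.sqrt 2 : ℝ) : ℂ) / (((Real.sqrt Real.pi : ℝ) : ℂ) * ((Real.sqrt x : ℝ) : ℂ)) := by
    rw [Real.sqrt_div two_pos.le, Real.sqrt_mul Real.pi_pos.le]
    push_cast
    rfl
  have hc : ((Real.sqrt 2 / Real.pi : ℝ) : ℂ) =
      ((Real.sqrt 2 : ℝ) : ℂ) / ((Real.sqrt Real.pi : ℝ) : ℂ) ^ 2 := by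
    rw [← hpi]
    push_cast
    rfl
  rw [hsq, hc]
  generalize Complex.exp (Complex.I * ((x : ℂ) - Real.pi / 4)) = e at hexp
  field_simp

/-! ### Green functions -/

/-- The free-space Green function `G(X, Y) = (i/4) H₀⁽¹⁾(k √(X² + Y²))` of the Helmholtz operator
`Δ + k²` in the plane. -/
def freeGreen (k X Y : ℝ) : ℂ :=
  Complex.I / 4 * hankelH10 (k * Real.sqrt (X ^ 2 + Y ^ 2))

/-- The shifted (multipolar) Green function of order `j` with shift `h`,
`G_j(X, Y) = ∑_{m=0}^{j} (-1)^m (j choose m) G(X, Y + m h)`. -/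
def shiftedGreen (k h : ℝ) (j : ℕ) (X Y : ℝ) : ℂ :=
  ∑ m ∈ Finset.range (j + 1), (-1) ^ m * (j.choose m : ℂ) * freeGreen k X (Y + m * h)

/-- `k` is a Wood frequency (for the period `d` and the parameter `α`) if `k² = α_n²` for some
integer `n`, where `α_n = α + 2 π n / d`. -/
def IsWoodFrequency (d α k : ℝ) : Prop :=
  ∃ n : ℤ, k ^ 2 = (α + n * (2 * Real.pi / d)) ^ 2

/-! ### Geometry of the curve `Γ = {(x, f x)}` -/

/-- The density of arc length on `Γ`: `ds' = √(1 + f'(x')²) dx'`. -/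
def arcDensity (f : ℝ → ℝ) (t : ℝ) : ℝ := Real.sqrt (1 + deriv f t ^ 2)

/-- The normal derivative
`∂_{ν'} K (x, x') = ν(x') · ∇_{(x', y')} K(x - x', y - y')` at `y = f x`, `y' = f x'`, where
`ν(x') = (-f'(x'), 1) / √(1 + f'(x')²)` is the unit normal to `Γ` at `(x', f x')` which points
into `{y > f x}`. -/
def normalDeriv (f : ℝ → ℝ) (K : ℝ → ℝ → ℂ) (x x' : ℝ) : ℂ :=
  ((-deriv f x' / arcDensity f x' : ℝ) : ℂ) * deriv (fun s : ℝ => K (x - s) (f x - f x')) x' +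
    ((1 / arcDensity f x' : ℝ) : ℂ) * deriv (fun s : ℝ => K (x - x') (f x - s)) (f x')

/-! ### Windows -/

/-- The smooth window `S_{γ,a}`: equal to `1` for `|x| ≤ γ`, to `0` for `|x| ≥ a`, and to
`exp (2 e^{-1/u} / (u - 1))` with `u = (|x| - γ) / (a - γ)` in between. -/
def smoothWindow (γ a x : ℝ) : ℝ :=
  if |x| ≤ γ then 1
  else if |x| < a then
    Real.exp (2 * Real.exp (-1 / ((|x| - γ) / (a - γ))) / ((|x| - γ) / (a - γ) - 1))
  else 0

/-- The window along the curve: `S_{γ,a}^f (x, x') = S_{γ,a}(√((x - x')² + (f x - f x')²))`. -/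
def curveWindow (f : ℝ → ℝ) (γ a x x' : ℝ) : ℝ :=
  smoothWindow γ a (Real.sqrt ((x - x') ^ 2 + (f x - f x') ^ 2))

/-- The kernel `∂_{ν'} G_j (x, x') (1 - S_{γ,a}^f (x, x'))` of the regular part of the
double-layer operator. -/
def regKernel (f : ℝ → ℝ) (k h : ℝ) (j : ℕ) (γ a x x' : ℝ) : ℂ :=
  normalDeriv f (shiftedGreen k h j) x x' * ((1 - curveWindow f γ a x x' : ℝ) : ℂ)

/-! ### The exact operator -/

/-- The improper integral `∫_{-∞}^{∞} F` converges to `L`: `F` is locally integrable and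
`∫_R^S F → L` as `R → -∞` and `S → ∞` independently. -/
def HasImproperIntegral (F : ℝ → ℂ) (L : ℂ) : Prop :=
  LocallyIntegrable F ∧
    Tendsto (fun P : ℝ × ℝ => ∫ t in P.1..P.2, F t) (atBot ×ˢ atTop) (𝓝 L)

/-- The value of the improper integral `∫_{-∞}^{∞} F` (meaningful if it converges). -/
def improperIntegral (F : ℝ → ℂ) : ℂ :=
  limUnder (atBot ×ˢ atTop) (fun P : ℝ × ℝ => ∫ t in P.1..P.2, F t)

/-- The integrand, with respect to `dx'`, of the regular part of the double-layer operator. -/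
def regIntegrand (f : ℝ → ℝ) (k h : ℝ) (j : ℕ) (γ a : ℝ) (μ : ℝ → ℂ) (x x' : ℝ) : ℂ :=
  regKernel f k h j γ a x x' * μ x' * (arcDensity f x' : ℂ)

/-- The regular part of the double-layer operator,
`D_reg[μ](x) = ∫_{-∞}^{∞} ∂_{ν'} G_j (x, x') (1 - S_{γ,a}^f (x, x')) μ(x') ds'`. -/
def Dreg (f : ℝ → ℝ) (k h : ℝ) (j : ℕ) (γ a : ℝ) (μ : ℝ → ℂ) (x : ℝ) : ℂ :=
  improperIntegral (regIntegrand f k h j γ a μ x)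

/-! ### The discrete operators -/

/-- The mesh size `Δx = d / N`. -/
def meshSize (d : ℝ) (N : ℕ+) : ℝ := d / (N : ℕ)

/-- The mesh points `x_ℓ = ℓ Δx`, `ℓ ∈ ℤ`, so that `x_0 = 0` and `x_N = d`. -/
def meshPoint (d : ℝ) (N : ℕ+) (l : ℤ) : ℝ := l * meshSize d N

/-- The vector `[μ(x_1), …, μ(x_N)]` (the entry `μ(x_ℓ)` has the index `ℓ - 1` in `Fin N`). -/
def sampleVec (d : ℝ) (N : ℕ+) (μ : ℝ → ℂ) : Fin N → ℂ :=
  fun i => μ (meshPoint d N ((i : ℕ) + 1))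

/-- The extension of a vector `[μ_1, …, μ_N]` to all integer indices by quasi-periodicity:
`μ_{ℓ + p N} = μ_ℓ e^{i α p d}` for `1 ≤ ℓ ≤ N` and `p ∈ ℤ`. -/
def quasiExtend (d α : ℝ) (N : ℕ+) (v : Fin N → ℂ) (l : ℤ) : ℂ :=
  v ⟨((l - 1) % (N : ℕ)).toNat, by
      have hN : (0 : ℤ) < (N : ℕ) := by exact_mod_cast N.pos
      have h1 := Int.emod_nonneg (l - 1) hN.ne'
      have h2 := Int.emod_lt_of_pos (l - 1) hN
      omega⟩ *
    Complex.exp (Complex.I * α * (((l - 1) / (N : ℕ) : ℤ) : ℂ) * d)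

/-- The windowed discrete operator, with window size `A` and mesh size `Δx = d / N`,
`∑_ℓ ∂_{ν'} G_j (x, x_ℓ) S_{cA,A}(x - x_ℓ) (1 - S_{γ,a}^f (x, x_ℓ)) μ_ℓ (Δs)_ℓ`, where
`(Δs)_ℓ = Δx √(1 + f'(x_ℓ)²)`. Only finitely many terms are nonzero. -/
def DregWindowed (d α : ℝ) (f : ℝ → ℝ) (k h : ℝ) (j : ℕ) (γ a c A : ℝ) (N : ℕ+)
    (v : Fin N → ℂ) (x : ℝ) : ℂ :=
  ∑' l : ℤ, regKernel f k h j γ a x (meshPoint d N l) *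
    (smoothWindow (c * A) A (x - meshPoint d N l) : ℂ) * quasiExtend d α N v l *
      ((meshSize d N * arcDensity f (meshPoint d N l) : ℝ) : ℂ)

/-- The term of index `ℓ` of the limiting (`A = ∞`) discrete operator. -/
def regTerm (d α : ℝ) (f : ℝ → ℝ) (k h : ℝ) (j : ℕ) (γ a : ℝ) (N : ℕ+)
    (v : Fin N → ℂ) (x : ℝ) (l : ℤ) : ℂ :=
  quasiExtend d α N v l * regKernel f k h j γ a x (meshPoint d N l) *
    ((meshSize d N * arcDensity f (meshPoint d N l) : ℝ) : ℂ)

/-- The limiting (`A = ∞`) discrete operator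
`∑_{ℓ = -∞}^{∞} μ_ℓ (1 - S_{γ,a}^f (x, x_ℓ)) ∂_{ν'} G_j (x, x_ℓ) (Δs)_ℓ`; the sum is the limit of
`∑_{ℓ = m}^{n}` as `m → -∞` and `n → ∞` independently. -/
def DregDiscrete (d α : ℝ) (f : ℝ → ℝ) (k h : ℝ) (j : ℕ) (γ a : ℝ) (N : ℕ+)
    (v : Fin N → ℂ) (x : ℝ) : ℂ :=
  ∑'[SummationFilter.conditional ℤ] l, regTerm d α f k h j γ a N v x l

end WoodNystrom

end

noncomputable section

namespace WoodNystrom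

/-! ### Sums and integrals over the real line -/

/-! Away from the diagonal put `X = |t - x|` and `Y = f x - f t`. There the integrand is a sum of
two products `e^{ikX} p(t) Φ(Y, X)`, where `p` is smooth and quasi-periodic and `Φ` is a partial
derivative of the shifted Green function stripped of its oscillation (`regIntegrand_eq_oscTerm`).
With `r = √(X² + Y²)` one has `r - X = Y² / (r + X)`, so what is left of the phase varies slowly: a
derivative of `Φ` in `X` gains a full power of `X`, a derivative in `Y` half a power, rounded up in
total (`HankelSymbol.hasPartials`, `HankelSymbol.symbolFamily`).

Shifted case. The alternating binomial sum is a `j`-fold difference in `Y`, so `Φ = O(X^{-1/2 -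
⌈j/2⌉})` (`SymbolFamily.shiftSum_gain`), and all `t`-derivatives of the integrand obey the same
bound. For `j ≥ 1` everything converges absolutely, and the part beyond `cA` is `O(A^{1/2 -
⌈j/2⌉})`, which is the asserted rate because `⌈j/2⌉ = ⌊(j+1)/2⌋`.

Non-Wood case. Translation by one period leaves `Y` unchanged and multiplies `e^{ikX} p(t)` by a
constant phase. The twisted difference `V(t) - z V(t - εd)`, with `z = e^{i(k + εα)d}` on the side
`ε = ±1`, therefore acts on `Φ` alone, as a backward difference in `X`, and gains a power of `X`. On
sums it acts as multiplication by `1 - z`, and `z = 1` forces a Wood frequency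
(`twistFactor_ne_one`). Iterating gives arbitrary decay of the window error
(`hasSum_of_hasSum_twist`, `norm_sub_windowedSum_le_of_twist`); the constants do not depend on `A`
because the cutoff is itself a symbol uniformly in `A`.

Discretization error. In both cases the integrand equals `H(t) + U(t) - U(t - d)`, where `H` and its
derivatives decay faster than `1/|t|` and `U → 0` (`exists_hasRegularPart`). The difference
contributes nothing to the improper integral, nor to the mesh sum, since a period is a whole number
of mesh steps. For `H` the trapezoidal rule on the line converges faster than any power of the step
(`trapezoid_error`). The two errors are added through the unwindowed discrete operator. -/

/-- The weight `(1 + |s|)^{-w}`, restricted to `R ≤ |s|`. -/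
def tailWeight (w R s : ℝ) : ℝ := if R ≤ |s| then (1 + |s|) ^ (-w) else 0

theorem tailWeight_nonneg (w R s : ℝ) : 0 ≤ tailWeight w R s := by
  unfold tailWeight
  split_ifs
  · positivity
  · exact le_rfl

theorem integrable_tailWeight {w : ℝ} (hw : 1 < w) (R : ℝ) : Integrable (tailWeight w R) := by
  have h : Integrable (fun s : ℝ => (1 + ‖s‖) ^ (-w)) :=
    integrable_one_add_norm (by simpa using hw)
  have hs : MeasurableSet {s : ℝ | R ≤ |s|} := measurableSet_le measurable_const measurable_id.abs
  refine (h.indicator hs).congr (Eventually.of_forall fun s => ?_)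
  simp [Set.indicator, tailWeight]

theorem integral_tailWeight_le {w : ℝ} (hw : 1 < w) {R : ℝ} (hR : 0 ≤ R) :
    ∫ s, tailWeight w R s ≤ 2 / (w - 1) * (1 + R) ^ (1 - w) := by
  have h1 : ∫ s, tailWeight w R s =
      2 * ∫ s in Set.Ioi (0 : ℝ), if R ≤ s then (1 + s) ^ (-w) else 0 := by
    rw [← integral_comp_abs]
    rfl
  have h2 : ∫ s in Set.Ioi (0 : ℝ), (if R ≤ s then (1 + s) ^ (-w) else 0) =
      ∫ s in Set.Ioi R, (1 + s) ^ (-w) := by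
    have : (fun s : ℝ => if R ≤ s then (1 + s) ^ (-w) else 0) =
        (Set.Ici R).indicator fun s => (1 + s) ^ (-w) := by
      ext s
      simp [Set.indicator]
    rw [← integral_Ici_eq_integral_Ioi, this, setIntegral_indicator measurableSet_Ici,
      ← integral_Ici_eq_integral_Ioi, Set.inter_eq_right.2]
    exact Set.Ici_subset_Ici.2 hR
  have hder : ∀ s ∈ Set.Ioi R,
      HasDerivAt (fun s : ℝ => (1 + s) ^ (1 - w) / (1 - w)) ((1 + s) ^ (-w)) s := by
    intro s hs
    have hs' : R < s := hs
    have := (((hasDerivAt_id s).const_add 1).rpow_const (p := 1 - w)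
      (Or.inl (by simp only [id]; linarith))).div_const (1 - w)
    refine this.congr_deriv ?_
    have : 1 - w ≠ 0 := by linarith
    simp only [id]
    rw [show (1 - w - 1) = -w by ring]
    field_simp
  have hcont : ContinuousWithinAt (fun s : ℝ => (1 + s) ^ (1 - w) / (1 - w)) (Set.Ici R) R := by
    refine ContinuousAt.continuousWithinAt (ContinuousAt.div_const ?_ _)
    exact ContinuousAt.rpow_const (by fun_prop) (Or.inl (by linarith))
  have hlim : Tendsto (fun s : ℝ => (1 + s) ^ (1 - w) / (1 - w)) atTop (𝓝 0) := by
    have := ((tendsto_rpow_neg_atTop (y := w - 1) (by linarith)).comp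
      (tendsto_atTop_add_const_left atTop (1 : ℝ) tendsto_id)).div_const (1 - w)
    simpa [Function.comp_def] using this
  have h3 := integral_Ioi_of_hasDerivAt_of_nonneg hcont hder
    (fun s hs => by
      have : R < s := hs
      have : 0 < 1 + s := by linarith
      positivity) hlim
  rw [h1, h2, h3]
  apply le_of_eq
  have : 1 - w ≠ 0 := by linarith
  have : w - 1 ≠ 0 := by linarith
  field_simp
  ring

/-- A Peetre-type inequality, from `1 + |u| ≤ (1 + d)(1 + |s|)`; moving by `d` also costs `d` in the
cut radius. It allows a value at a mesh point to be compared with values in the adjacent cell. -/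
theorem tailWeight_le_of_abs_sub_le {w d R s u : ℝ} (hw : 0 ≤ w) (hd : 0 ≤ d)
    (h : |u - s| ≤ d) : tailWeight w R s ≤ (1 + d) ^ w * tailWeight w (R - d) u := by
  have h1 : |u| ≤ |s| + d := by
    have := abs_add_le s (u - s)
    rw [add_sub_cancel] at this
    linarith
  have h2 : |s| ≤ |u| + d := by
    have := abs_add_le u (s - u)
    rw [add_sub_cancel, abs_sub_comm] at this
    linarith
  unfold tailWeight
  have hs := abs_nonneg s
  have hu := abs_nonneg u
  split_ifs with ha hb hb
  · rw [Real.rpow_neg (by positivity), Real.rpow_neg (by positivity), ← div_eq_mul_inv,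
      inv_eq_one_div, div_le_div_iff₀ (by positivity) (by positivity), one_mul,
      ← Real.mul_rpow (by positivity) (by positivity)]
    refine Real.rpow_le_rpow (by positivity) ?_ hw
    nlinarith
  · linarith
  · positivity
  · simp

/-- Each term is at most a multiple of the integral of the weight over its own mesh cell, and the
multiple depends on the step only through `δ ≤ d`. This is the source of all uniformity in the mesh
and in the offset. -/
theorem tailWeight_sum_le {w d : ℝ} (hw : 1 < w) (hd : 0 < d) :
    ∃ K, 0 ≤ K ∧ ∀ δ, 0 < δ → δ ≤ d → ∀ R, 0 ≤ R → ∀ y : ℝ,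
      Summable (fun l : ℤ => δ * tailWeight w R (y + l * δ)) ∧
        ∑' l : ℤ, δ * tailWeight w R (y + l * δ) ≤ K * (1 + R) ^ (1 - w) := by
  refine ⟨(1 + d) ^ w * (2 / (w - 1) * (1 + d) ^ (w - 1)), ?_, ?_⟩
  · have : 0 < w - 1 := by linarith
    positivity
  intro δ hδ hδd R hR y
  -- For `R < d` the reduced radius is negative; replacing it by `0` does not change the weight but
  -- meets the hypothesis of `integral_tailWeight_le`.
  set R' := max (R - d) 0 with hR'
  set g : ℝ → ℝ := fun v => δ * ((1 + d) ^ w * tailWeight w (R - d) (y + v * δ)) with hg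
  have htw : tailWeight w (R - d) = tailWeight w R' := by
    ext s
    simp only [tailWeight, hR', max_le_iff, abs_nonneg, and_true]
  have hgi : Integrable g := by
    have h := (integrable_tailWeight hw (R - d)).comp_add_left y
    exact ((h.comp_mul_right' hδ.ne').const_mul ((1 + d) ^ w)).const_mul δ
  have hgI : ∫ v, g v = (1 + d) ^ w * ∫ s, tailWeight w (R - d) s := by
    simp only [hg]
    rw [integral_const_mul, integral_const_mul,
      Measure.integral_comp_mul_right (fun v => tailWeight w (R - d) (y + v)) δ,
      integral_add_left_eq_self, abs_of_pos (inv_pos.2 hδ), smul_eq_mul]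
    field_simp
  have hsum := hgi.hasSum_intervalIntegral 0
  have hle : ∀ l : ℤ, δ * tailWeight w R (y + l * δ) ≤ ∫ v in (0 + (l : ℝ))..(0 + l + 1), g v := by
    intro l
    have h0 : ∫ v in (0 + (l : ℝ))..(0 + l + 1), δ * tailWeight w R (y + l * δ) =
        δ * tailWeight w R (y + l * δ) := by simp
    rw [← h0]
    refine intervalIntegral.integral_mono_on (by linarith) (by simp) hgi.intervalIntegrable ?_
    intro v hv
    simp only [hg]
    refine mul_le_mul_of_nonneg_left (tailWeight_le_of_abs_sub_le (by linarith) hd.le ?_) hδ.le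
    have hv1 : 0 ≤ v - l := by linarith [hv.1]
    have hv2 : v - l ≤ 1 := by linarith [hv.2]
    rw [show y + v * δ - (y + l * δ) = (v - l) * δ by ring, abs_of_nonneg (by positivity)]
    nlinarith
  have hnn : ∀ l : ℤ, 0 ≤ δ * tailWeight w R (y + l * δ) := fun l =>
    mul_nonneg hδ.le (tailWeight_nonneg _ _ _)
  have hs := Summable.of_nonneg_of_le hnn hle hsum.summable
  refine ⟨hs, (hs.tsum_le_tsum hle hsum.summable).trans ?_⟩
  rw [hsum.tsum_eq, hgI, htw, mul_assoc]
  have hR0 : 0 ≤ R' := le_max_right _ _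
  refine mul_le_mul_of_nonneg_left ((integral_tailWeight_le hw hR0).trans ?_) (by positivity)
  rw [mul_assoc]
  have hw1 : 0 < w - 1 := by linarith
  refine mul_le_mul_of_nonneg_left ?_ (by positivity)
  have hle : 1 + R ≤ (1 + d) * (1 + R') := by
    have : R - d ≤ R' := le_max_left _ _
    nlinarith
  have e1 : ∀ z : ℝ, 0 < z → z ^ (1 - w) = (z ^ (w - 1))⁻¹ := fun z hz => by
    rw [← Real.rpow_neg hz.le]
    congr 1
    ring
  rw [e1 _ (by positivity), e1 _ (by positivity), ← div_eq_mul_inv, inv_eq_one_div,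
    div_le_div_iff₀ (by positivity) (by positivity), one_mul,
    ← Real.mul_rpow (by positivity) (by positivity)]
  exact Real.rpow_le_rpow (by positivity) hle hw1.le

/-! ### Conditionally convergent sums and integrals of differences -/

/-- For a shift by one the partial sums telescope to two boundary values; a general shift is a sum
of unit ones. No summability of `U` is involved, which is why the two-sided limit over intervals is
needed. -/
theorem hasSum_conditional_sub_shift {U : ℤ → ℂ} (ht : Tendsto U atTop (𝓝 0))
    (hb : Tendsto U atBot (𝓝 0)) (p : ℤ) :
    HasSum (fun l => U l - U (l - p)) 0 (SummationFilter.conditional ℤ) := by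
  have step : ∀ V : ℤ → ℂ, Tendsto V atTop (𝓝 0) → Tendsto V atBot (𝓝 0) →
      HasSum (fun l => V l - V (l - 1)) 0 (SummationFilter.conditional ℤ) := by
    intro V h1 h2
    have hfin : ∀ (m : ℤ) (n : ℕ),
        ∑ l ∈ Finset.Icc m (m + n), (V l - V (l - 1)) = V (m + n) - V (m - 1) := by
      intro m n
      induction n with
      | zero => simp
      | succ n ih =>
        have : Finset.Icc m (m + (n + 1 : ℕ)) = insert (m + (n + 1 : ℕ)) (Finset.Icc m (m + n)) := by
          ext z
          simp only [Finset.mem_insert, Finset.mem_Icc]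
          push_cast
          omega
        rw [this, Finset.sum_insert (by simp), ih]
        push_cast
        rw [show m + ((n : ℤ) + 1) - 1 = m + n by ring]
        ring
    unfold HasSum
    rw [SummationFilter.conditional_filter, tendsto_map'_iff]
    have hl : Tendsto (fun P : ℤ × ℤ => V P.2 - V (P.1 - 1)) (atBot ×ˢ atTop) (𝓝 (0 - 0)) :=
      (h1.comp tendsto_snd).sub
        ((h2.comp (tendsto_atBot_add_const_right atBot (-1 : ℤ) tendsto_id)).comp tendsto_fst)
    rw [sub_zero] at hl
    refine hl.congr' ?_
    filter_upwards [prod_mem_prod (Iic_mem_atBot (0 : ℤ)) (Ici_mem_atTop (0 : ℤ))] with P hP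
    obtain ⟨n, hn⟩ : ∃ n : ℕ, P.2 = P.1 + n := by
      have h3 : P.1 ≤ 0 := hP.1
      have h4 : 0 ≤ P.2 := hP.2
      exact ⟨(P.2 - P.1).toNat, by omega⟩
    simp only [Function.comp_apply]
    rw [hn, hfin]
  have shiftT : ∀ q : ℤ, Tendsto (fun l => U (l - q)) atTop (𝓝 0) := fun q =>
    ht.comp (tendsto_atTop_add_const_right atTop (-q) tendsto_id)
  have shiftB : ∀ q : ℤ, Tendsto (fun l => U (l - q)) atBot (𝓝 0) := fun q =>
    hb.comp (tendsto_atBot_add_const_right atBot (-q) tendsto_id)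
  induction p using Int.induction_on with
  | zero => simp
  | succ p ih =>
    have h := ih.add (step _ (shiftT p) (shiftB p))
    rw [add_zero] at h
    refine (congrArg (fun F => HasSum F 0 (SummationFilter.conditional ℤ))
      (funext fun l => ?_)).mp h
    rw [show l - 1 - (p : ℤ) = l - (p + 1) by ring]
    ring
  | pred p ih =>
    have h := ih.sub (step _ (shiftT (-p - 1)) (shiftB (-p - 1)))
    rw [sub_zero] at h
    refine (congrArg (fun F => HasSum F 0 (SummationFilter.conditional ℤ))
      (funext fun l => ?_)).mp h
    rw [show l - 1 - (-(p : ℤ) - 1) = l - -p by ring]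
    ring

/-- The integral telescopes to integrals of `U` over two end intervals of fixed length `|p|`, on
which `U` becomes small. -/
theorem tendsto_integral_sub_shift {U : ℝ → ℂ} (hc : Continuous U) (ht : Tendsto U atTop (𝓝 0))
    (hb : Tendsto U atBot (𝓝 0)) (p : ℝ) :
    Tendsto (fun P : ℝ × ℝ => ∫ t in P.1..P.2, (U t - U (t - p))) (atBot ×ˢ atTop) (𝓝 0) := by
  have key : ∀ l : Filter ℝ, Tendsto (fun t => |t|) l atTop →
      Tendsto (fun b => ∫ t in (b - p)..b, U t) l (𝓝 0) := by
    intro l hl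
    rw [Metric.tendsto_nhds]
    intro ε hε
    -- The `+ 1` covers `p = 0` and makes the final inequality strict.
    have hev : ∀ᶠ t in cocompact ℝ, ‖U t‖ < ε / (|p| + 1) := by
      rw [cocompact_eq_atBot_atTop]
      have hp : 0 < ε / (|p| + 1) := by positivity
      exact eventually_sup.2 ⟨by simpa using (Metric.tendsto_nhds.1 hb _ hp),
        by simpa using (Metric.tendsto_nhds.1 ht _ hp)⟩
    obtain ⟨r, hr⟩ : ∃ r : ℝ, ∀ t, r < |t| → ‖U t‖ < ε / (|p| + 1) := by
      obtain ⟨r, -, hr⟩ := (hasBasis_cobounded_norm (E := ℝ)).eventually_iff.1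
        (Metric.cobounded_eq_cocompact (α := ℝ) ▸ hev)
      exact ⟨r, fun t ht => hr (by simpa using ht.le)⟩
    filter_upwards [hl.eventually_gt_atTop (r + |p|)] with b hb'
    rw [dist_zero_right]
    have hbd : ‖∫ t in (b - p)..b, U t‖ ≤ ε / (|p| + 1) * |b - (b - p)| := by
      refine intervalIntegral.norm_integral_le_of_norm_le_const fun t ht => ?_
      refine (hr t ?_).le
      have h2 : |b - t| ≤ |p| := by
        have := Set.uIoc_subset_uIcc ht
        have := Set.abs_sub_right_of_mem_uIcc this
        simpa using this
      have := abs_add_le t (b - t)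
      rw [add_sub_cancel] at this
      linarith
    refine hbd.trans_lt ?_
    rw [sub_sub_cancel, div_mul_eq_mul_div, div_lt_iff₀ (by positivity)]
    nlinarith
  have hT : Tendsto (fun P : ℝ × ℝ => ∫ t in (P.2 - p)..P.2, U t) (atBot ×ˢ atTop) (𝓝 0) :=
    (key atTop tendsto_abs_atTop_atTop).comp tendsto_snd
  have hB : Tendsto (fun P : ℝ × ℝ => ∫ t in (P.1 - p)..P.1, U t) (atBot ×ˢ atTop) (𝓝 0) :=
    (key atBot tendsto_abs_atBot_atTop).comp tendsto_fst
  have h1 := hT.sub hB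
  rw [sub_zero] at h1
  refine h1.congr fun P => ?_
  have hi : ∀ a b, IntervalIntegrable U volume a b := fun a b => hc.intervalIntegrable a b
  have hs : IntervalIntegrable (fun t => U (t - p)) volume P.1 P.2 :=
    (hc.comp (continuous_id.sub continuous_const)).intervalIntegrable _ _
  rw [intervalIntegral.integral_sub (hi _ _) hs, intervalIntegral.integral_comp_sub_right]
  have e1 := intervalIntegral.integral_add_adjacent_intervals (hi (P.1 - p) (P.2 - p)) (hi _ P.2)
  have e2 := intervalIntegral.integral_add_adjacent_intervals (hi (P.1 - p) P.1) (hi _ P.2)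
  linear_combination e1 - e2

/-! ### The trapezoidal rule for rapidly convergent integrals -/

/-- A family `H x`, `x ∈ I`, of functions which have `n` derivatives that are continuous and
bounded by multiples of `(1 + |t - x|)^{-w}`, uniformly in `x`. -/
def DecayFamily (I : Set ℝ) (w : ℝ) : ℕ → (ℝ → ℝ → ℂ) → Prop
  | 0, H => (∃ C, ∀ x ∈ I, ∀ t, ‖H x t‖ ≤ C * (1 + |t - x|) ^ (-w)) ∧ ∀ x ∈ I, Continuous (H x)
  | n + 1, H =>
    ((∃ C, ∀ x ∈ I, ∀ t, ‖H x t‖ ≤ C * (1 + |t - x|) ^ (-w)) ∧ ∀ x ∈ I, Continuous (H x)) ∧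
      ∃ H' : ℝ → ℝ → ℂ, (∀ x ∈ I, ∀ t, HasDerivAt (H x) (H' x t) t) ∧ DecayFamily I w n H'

theorem DecayFamily.zero {I : Set ℝ} {w : ℝ} {n : ℕ} {H : ℝ → ℝ → ℂ} (h : DecayFamily I w n H) :
    DecayFamily I w 0 H := by
  cases n with
  | zero => exact h
  | succ n => exact h.1

theorem tailWeight_zero (w s : ℝ) : tailWeight w 0 s = (1 + |s|) ^ (-w) := by
  simp [tailWeight]

theorem integrable_of_decay {w C x : ℝ} (hw : 1 < w) {H : ℝ → ℂ} (hc : Continuous H)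
    (hC : ∀ t, ‖H t‖ ≤ C * (1 + |t - x|) ^ (-w)) : Integrable H := by
  refine Integrable.mono' (((integrable_tailWeight hw 0).comp_sub_right x).const_mul C)
    hc.aestronglyMeasurable (Eventually.of_forall fun t => ?_)
  rw [tailWeight_zero]
  exact hC t

/-- Sums with step `δ ≤ d` of functions with the bound `C (1 + |t - x|)^{-w}` for `R ≤ |t - x|`
that vanish elsewhere. -/
theorem norm_tsum_le_of_tailWeight {w d : ℝ} (hw : 1 < w) (hd : 0 < d) :
    ∃ K, 0 ≤ K ∧ ∀ C δ R x y, 0 ≤ C → 0 < δ → δ ≤ d → 0 ≤ R → ∀ H : ℝ → ℂ,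
      (∀ t, ‖H t‖ ≤ C * tailWeight w R (t - x)) →
      Summable (fun l : ℤ => (δ : ℂ) * H (y + l * δ)) ∧
        ‖∑' l : ℤ, (δ : ℂ) * H (y + l * δ)‖ ≤ K * C * (1 + R) ^ (1 - w) := by
  obtain ⟨K, hK, h⟩ := tailWeight_sum_le hw hd
  refine ⟨K, hK, fun C δ R x y hC hδ hδd hR H hH => ?_⟩
  obtain ⟨hs, ht⟩ := h δ hδ hδd R hR (y - x)
  have hb : ∀ l : ℤ, ‖(δ : ℂ) * H (y + l * δ)‖ ≤ C * (δ * tailWeight w R (y - x + l * δ)) := by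
    intro l
    rw [norm_mul, Complex.norm_real, Real.norm_of_nonneg hδ.le]
    have := hH (y + l * δ)
    rw [show y + l * δ - x = y - x + l * δ by ring] at this
    nlinarith
  refine ⟨Summable.of_norm_bounded (hs.mul_left C) hb, ?_⟩
  refine (tsum_of_norm_bounded (hs.mul_left C).hasSum hb).trans ?_
  rw [tsum_mul_left]
  nlinarith

/-- Regard the sum as a function `a(y)` of the offset. Its derivative is the corresponding sum for
`H'`, so `a` is `M`-Lipschitz, and its mean over offsets in one cell is exactly `∫ H`. A function
differs from its mean over an interval of length `δ` by at most `δ M`. -/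
theorem trapezoid_step {w C C' x δ M : ℝ} (hw : 1 < w) (hδ : 0 < δ) {H H' : ℝ → ℂ}
    (hC : ∀ t, ‖H t‖ ≤ C * (1 + |t - x|) ^ (-w)) (hC' : ∀ t, ‖H' t‖ ≤ C' * (1 + |t - x|) ^ (-w))
    (hder : ∀ t, HasDerivAt H (H' t) t) (hM : ∀ y, ‖∑' l : ℤ, (δ : ℂ) * H' (y + l * δ)‖ ≤ M)
    (y : ℝ) :
    ‖(∑' l : ℤ, (δ : ℂ) * H (y + l * δ)) - ∫ t, H t‖ ≤ δ * M := by
  obtain ⟨K, hK, hsum⟩ := tailWeight_sum_le hw hδ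
  -- A summable majorant valid for all offsets within `ρ` of `y`: `ρ = 1` serves differentiation
  -- under the sum, `ρ = δ` the exchange of the sum with the integral over a cell.
  have hnear : ∀ B : ℝ, ∀ F : ℝ → ℂ, (∀ t, ‖F t‖ ≤ B * (1 + |t - x|) ^ (-w)) → ∀ ρ, 0 ≤ ρ → ∀ y,
      ∃ u : ℤ → ℝ, Summable u ∧ ∀ l : ℤ, ∀ z, |y - z| ≤ ρ → ‖(δ : ℂ) * F (z + l * δ)‖ ≤ u l := by
    intro B F hF ρ hρ y
    have hB : 0 ≤ B := by
      have := (norm_nonneg _).trans (hF x)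
      simpa using this
    refine ⟨fun l => B * (1 + ρ) ^ w * (δ * tailWeight w 0 (y - x + l * δ)),
      ((hsum δ hδ le_rfl 0 le_rfl (y - x)).1).mul_left _, fun l z hz => ?_⟩
    rw [norm_mul, Complex.norm_real, Real.norm_of_nonneg hδ.le]
    have h1 := hF (z + l * δ)
    rw [← tailWeight_zero] at h1
    have h2 := tailWeight_le_of_abs_sub_le (w := w) (R := 0) (s := z + l * δ - x)
      (u := y - x + l * δ) (by linarith) hρ (by
        rw [show y - x + l * δ - (z + l * δ - x) = y - z by ring]
        exact hz)
    rw [show tailWeight w (0 - ρ) = tailWeight w 0 by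
      ext s
      simp only [tailWeight, abs_nonneg, if_true]
      rw [if_pos]
      linarith [abs_nonneg s]] at h2
    calc δ * ‖F (z + l * δ)‖ ≤ δ * (B * ((1 + ρ) ^ w * tailWeight w 0 (y - x + l * δ))) := by
          gcongr
          exact h1.trans (mul_le_mul_of_nonneg_left h2 hB)
      _ = _ := by ring
  set a : ℝ → ℂ := fun y => ∑' l : ℤ, (δ : ℂ) * H (y + l * δ) with ha
  have hda : ∀ y, HasDerivAt a (∑' l : ℤ, (δ : ℂ) * H' (y + l * δ)) y := by
    intro y
    obtain ⟨u, hu, hub⟩ := hnear C' H' hC' 1 zero_le_one y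
    obtain ⟨u0, hu0, hub0⟩ := hnear C H hC 1 zero_le_one y
    refine hasDerivAt_tsum_of_isPreconnected (t := Metric.ball y 1) (y₀ := y) hu Metric.isOpen_ball
      (convex_ball y 1).isPreconnected (fun l z _ => ?_) (fun l z hz => hub l z ?_)
      (Metric.mem_ball_self one_pos)
      (Summable.of_norm_bounded hu0 fun l => hub0 l y (by simp)) (Metric.mem_ball_self one_pos)
    · exact ((hder (z + l * δ)).comp_add_const z _).const_mul (δ : ℂ)
    · rw [abs_sub_comm]
      exact (Metric.mem_ball.1 hz).le
  have hM0 : 0 ≤ M := (norm_nonneg _).trans (hM 0)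
  have hlip : ∀ z, ‖a y - a z‖ ≤ M * ‖y - z‖ := fun z =>
    convex_univ.norm_image_sub_le_of_norm_hasDerivWithin_le
      (fun s _ => (hda s).hasDerivWithinAt) (fun s _ => hM s) (Set.mem_univ z) (Set.mem_univ y)
  have hHc : Continuous H := continuous_iff_continuousAt.2 fun t => (hder t).continuousAt
  have hac : Continuous a := continuous_iff_continuousAt.2 fun t => (hda t).continuousAt
  have hHi : Integrable H := integrable_of_decay hw hHc hC
  set g : ℝ → ℂ := fun v => (δ : ℂ) * H (y + v * δ) with hg
  have hgi : Integrable g := ((hHi.comp_add_left y).comp_mul_right' hδ.ne').const_mul _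
  have hgI : ∫ v, g v = ∫ t, H t := by
    simp only [hg]
    rw [integral_const_mul, Measure.integral_comp_mul_right (fun v => H (y + v)) δ,
      integral_add_left_eq_self, abs_of_pos (inv_pos.2 hδ), Complex.real_smul, ← mul_assoc,
      ← Complex.ofReal_mul, mul_inv_cancel₀ hδ.ne', Complex.ofReal_one, one_mul]
  have h1 := hgi.hasSum_intervalIntegral_comp_add_int
  have h2 : HasSum (fun n : ℤ => ∫ v in (0 : ℝ)..1, g (v + n))
      (∫ v in (0 : ℝ)..1, a (y + v * δ)) := by
    obtain ⟨u, hu, hub⟩ := hnear C H hC δ hδ.le y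
    have hb : ∀ n : ℤ, ∀ v : ℝ, v ∈ Set.uIoc (0 : ℝ) 1 → ‖g (v + n)‖ ≤ u n := by
      intro n v hv
      rw [Set.uIoc_of_le zero_le_one] at hv
      have := hub n (y + v * δ) (by
        rw [show y - (y + v * δ) = -(v * δ) by ring, abs_neg,
          abs_of_nonneg (mul_nonneg hv.1.le hδ.le)]
        nlinarith [hv.2])
      rw [show y + v * δ + n * δ = y + (v + n) * δ by ring] at this
      exact this
    refine intervalIntegral.hasSum_integral_of_dominated_convergence (fun n _ => u n) ?_ ?_ ?_ ?_ ?_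
    · intro n
      exact Continuous.aestronglyMeasurable (by fun_prop)
    · exact fun n => Eventually.of_forall fun v hv => hb n v hv
    · exact Eventually.of_forall fun v _ => hu
    · simp
    · refine Eventually.of_forall fun v hv => ?_
      have : (fun n : ℤ => g (v + n)) = fun n : ℤ => (δ : ℂ) * H (y + v * δ + n * δ) := by
        funext n
        simp only [hg]
        rw [show y + v * δ + n * δ = y + (v + n) * δ by ring]
      rw [this]
      exact (Summable.of_norm_bounded hu fun n => by
        have := hb n v hv
        rwa [show g (v + n) = (δ : ℂ) * H (y + v * δ + n * δ) from congrFun ‹_› n] at this).hasSum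
  have h3 : ∫ t, H t = ∫ v in (0 : ℝ)..1, a (y + v * δ) := by
    rw [← hgI]
    exact h1.unique h2
  have h4 : a y - ∫ t, H t = ∫ v in (0 : ℝ)..1, (a y - a (y + v * δ)) := by
    rw [intervalIntegral.integral_sub (by simp) (Continuous.intervalIntegrable (by fun_prop) _ _),
      ← h3]
    simp
  rw [h4]
  have h5 := intervalIntegral.norm_integral_le_of_norm_le_const (a := (0 : ℝ)) (b := 1)
    (f := fun v => a y - a (y + v * δ)) (C := δ * M) fun v hv => by
      rw [Set.uIoc_of_le zero_le_one] at hv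
      refine (hlip _).trans ?_
      rw [show y - (y + v * δ) = -(v * δ) by ring, norm_neg, Real.norm_of_nonneg
        (mul_nonneg hv.1.le hδ.le), mul_comm]
      exact mul_le_mul_of_nonneg_right (by nlinarith [hv.2]) hM0
  simpa using h5

/-- The trapezoidal rule converges faster than any power of the step size. -/
theorem trapezoid_error {I : Set ℝ} {w d : ℝ} (hw : 1 < w) (hd : 0 < d) (n : ℕ)
    {H : ℝ → ℝ → ℂ} (h : DecayFamily I w n H) :
    ∃ C, 0 ≤ C ∧ ∀ δ, 0 < δ → δ ≤ d → ∀ x ∈ I, ∀ y,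
      ‖(∑' l : ℤ, (δ : ℂ) * H x (y + l * δ)) - ∫ t, H x t‖ ≤ C * δ ^ n := by
  induction n generalizing H with
  | zero =>
    obtain ⟨⟨C, hC⟩, hc⟩ := h
    obtain ⟨K, hK, hsum⟩ := norm_tsum_le_of_tailWeight hw hd
    have hI : 0 ≤ ∫ s, tailWeight w 0 s := integral_nonneg (tailWeight_nonneg w 0)
    refine ⟨K * |C| + |C| * ∫ s, tailWeight w 0 s, by positivity, fun δ hδ hδd x hx y => ?_⟩
    have hC' : ∀ t, ‖H x t‖ ≤ |C| * tailWeight w 0 (t - x) := fun t => by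
      rw [tailWeight_zero]
      exact (hC x hx t).trans (mul_le_mul_of_nonneg_right (le_abs_self C) (by positivity))
    have h1 := (hsum |C| δ 0 x y (abs_nonneg C) hδ hδd le_rfl (H x) hC').2
    have h2 : ‖∫ t, H x t‖ ≤ |C| * ∫ s, tailWeight w 0 s := by
      refine (norm_integral_le_of_norm_le
        (((integrable_tailWeight hw 0).comp_sub_right x).const_mul |C|)
        (Eventually.of_forall hC')).trans ?_
      rw [integral_const_mul, integral_sub_right_eq_self]
    rw [add_zero, Real.one_rpow, mul_one] at h1
    rw [pow_zero, mul_one]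
    exact (norm_sub_le _ _).trans (add_le_add h1 h2)
  | succ n ih =>
    obtain ⟨⟨⟨C, hC⟩, hc⟩, H', hH', hn⟩ := h
    obtain ⟨C', hC'⟩ := hn.zero.1
    obtain ⟨E, hE, hEn⟩ := ih hn
    refine ⟨E, hE, fun δ hδ hδd x hx y => ?_⟩
    have hc' := hn.zero.2 x hx
    -- Since `∫ H' = 0`, the mesh sum of `H'` is its own trapezoidal error, of order `δ ^ n` by
    -- induction; `trapezoid_step` supplies the additional factor `δ`.
    have hI : ∫ t, H' x t = 0 := integral_eq_zero_of_hasDerivAt_of_integrable (hH' x hx)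
      (integrable_of_decay hw hc' (hC' x hx)) (integrable_of_decay hw (hc x hx) (hC x hx))
    rw [pow_succ', mul_left_comm]
    refine trapezoid_step hw hδ (hC x hx) (hC' x hx) (hH' x hx) (fun z => ?_) y
    have := hEn δ hδ hδd x hx z
    rwa [hI, sub_zero] at this

/-! ### Smoothness of the windows -/

/-- The profile of the smooth window, as a function of `u = (|x| - γ) / (a - γ)`. -/
def windowProfile (u : ℝ) : ℝ :=
  if u ≤ 0 then 1 else if u < 1 then Real.exp (2 * Real.exp (-1 / u) / (u - 1)) else 0

theorem windowProfile_of_nonpos {u : ℝ} (hu : u ≤ 0) : windowProfile u = 1 := if_pos hu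

theorem windowProfile_of_one_le {u : ℝ} (hu : 1 ≤ u) : windowProfile u = 0 := by
  rw [windowProfile, if_neg (by linarith), if_neg (by linarith)]

theorem windowProfile_eq_of_lt_one {u : ℝ} (hu : u < 1) :
    windowProfile u = Real.exp (-2 * expNegInvGlue u / (1 - u)) := by
  unfold windowProfile expNegInvGlue
  split_ifs with h
  · simp
  · congr 1
    have h1 : u - 1 ≠ 0 := by linarith
    have h2 : 1 - u ≠ 0 := by linarith
    rw [show -1 / u = -u⁻¹ by rw [neg_div, one_div], div_eq_div_iff h1 h2]
    ring

/-- Taking `expNegInvGlue` as the outer function absorbs the cut at `u = 1`: for `u > 0` its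
argument is nonpositive exactly when `u ≥ 1`. -/
theorem windowProfile_eq_of_pos {u : ℝ} (hu : 0 < u) :
    windowProfile u = expNegInvGlue ((1 - u) / (2 * expNegInvGlue u)) := by
  have hp := expNegInvGlue.pos_of_pos hu
  by_cases h1 : u < 1
  · rw [windowProfile_eq_of_lt_one h1]
    have h2 : 0 < 1 - u := by linarith
    have h3 : ¬ (1 - u) / (2 * expNegInvGlue u) ≤ 0 := by
      rw [not_le]
      positivity
    conv_rhs => rw [expNegInvGlue, if_neg h3]
    rw [inv_div, neg_mul, neg_div]
  · rw [not_lt] at h1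
    rw [windowProfile_of_one_le h1, expNegInvGlue.zero_of_nonpos]
    exact div_nonpos_of_nonpos_of_nonneg (by linarith) (by positivity)

/-- Two formulas with overlapping domains: the one for `u < 1` is smooth across the junction at `0`,
the one for `u > 0` across the junction at `1`. -/
theorem contDiff_windowProfile : ContDiff ℝ ∞ windowProfile := by
  have hg : ContDiff ℝ ∞ expNegInvGlue := expNegInvGlue.contDiff
  refine contDiff_iff_contDiffAt.2 fun u => ?_
  rcases lt_or_ge u 1 with hu | hu
  · have h : ContDiffAt ℝ ∞ (fun u : ℝ => Real.exp (-2 * expNegInvGlue u / (1 - u))) u := by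
      refine ContDiffAt.exp (ContDiffAt.div ?_ ?_ (by linarith))
      · exact contDiffAt_const.mul hg.contDiffAt
      · fun_prop
    refine h.congr_of_eventuallyEq ?_
    filter_upwards [Iio_mem_nhds hu] with v hv
    exact windowProfile_eq_of_lt_one hv
  · have hu0 : 0 < u := by linarith
    have h : ContDiffAt ℝ ∞ (fun u : ℝ => expNegInvGlue ((1 - u) / (2 * expNegInvGlue u))) u := by
      refine hg.contDiffAt.comp u (ContDiffAt.div (by fun_prop)
        (contDiffAt_const.mul hg.contDiffAt) ?_)
      have := expNegInvGlue.pos_of_pos hu0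
      positivity
    refine h.congr_of_eventuallyEq ?_
    filter_upwards [Ioi_mem_nhds hu0] with v hv
    exact windowProfile_eq_of_pos hv

theorem smoothWindow_eq {γ a : ℝ} (h : γ < a) (x : ℝ) :
    smoothWindow γ a x = windowProfile ((|x| - γ) / (a - γ)) := by
  have h1 : 0 < a - γ := by linarith
  unfold smoothWindow windowProfile
  have e1 : (|x| - γ) / (a - γ) ≤ 0 ↔ |x| ≤ γ := by
    rw [div_le_iff₀ h1, zero_mul, sub_nonpos]
  have e2 : (|x| - γ) / (a - γ) < 1 ↔ |x| < a := by
    rw [div_lt_one h1]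
    constructor <;> intro <;> linarith
  simp only [e1, e2]

theorem norm_windowProfile_le (u : ℝ) : |windowProfile u| ≤ 1 := by
  unfold windowProfile
  split_ifs with h1 h2
  · simp
  · rw [abs_of_pos (Real.exp_pos _), Real.exp_le_one_iff]
    exact div_nonpos_of_nonneg_of_nonpos (by positivity) (by linarith)
  · simp

/-- The part of the cutoff `1 - S_{cA,A}` that lives on the positive half line. -/
def outerCutoff (c A X : ℝ) : ℝ := 1 - windowProfile ((X / A - c) / (1 - c))

theorem contDiff_outerCutoff (c A : ℝ) : ContDiff ℝ ∞ (outerCutoff c A) :=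
  contDiff_const.sub (contDiff_windowProfile.comp
    (((contDiff_id.div_const A).sub contDiff_const).div_const _))

theorem outerCutoff_of_le {c A X : ℝ} (hc : c < 1) (hA : 0 < A) (h : X ≤ c * A) :
    outerCutoff c A X = 0 := by
  rw [outerCutoff, windowProfile_of_nonpos, sub_self]
  refine div_nonpos_of_nonpos_of_nonneg ?_ (by linarith)
  rw [sub_nonpos, div_le_iff₀ hA]
  exact h

theorem outerCutoff_of_ge {c A X : ℝ} (hc : c < 1) (hA : 0 < A) (h : A ≤ X) :
    outerCutoff c A X = 1 := by
  rw [outerCutoff, windowProfile_of_one_le, sub_zero]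
  have : 1 ≤ X / A := by rwa [le_div_iff₀ hA, one_mul]
  rw [le_div_iff₀ (by linarith)]
  linarith

theorem abs_outerCutoff_le (c A X : ℝ) : |outerCutoff c A X| ≤ 2 := by
  have := norm_windowProfile_le ((X / A - c) / (1 - c))
  rw [abs_le] at *
  unfold outerCutoff
  constructor <;> linarith

/-- At most one of the two terms is nonzero. Splitting by sides removes the absolute value and
allows each side its own oscillation factor. -/
theorem one_sub_smoothWindow {c A : ℝ} (hc0 : 0 < c) (hc : c < 1) (hA : 0 < A) (x : ℝ) :
    1 - smoothWindow (c * A) A x = outerCutoff c A x + outerCutoff c A (-x) := by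
  have hcA : c * A < A := by nlinarith
  have hcA0 : 0 < c * A := by positivity
  have e : ∀ s, (s - c * A) / (A - c * A) = (s / A - c) / (1 - c) := by
    intro s
    have h1 : A - c * A ≠ 0 := by linarith
    have h2 : 1 - c ≠ 0 := by linarith
    field_simp
  rw [smoothWindow_eq hcA, e]
  rcases le_total 0 x with hx | hx
  · rw [outerCutoff_of_le hc hA (X := -x) (by linarith), abs_of_nonneg hx, add_zero, outerCutoff]
  · rw [outerCutoff_of_le hc hA (X := x) (by linarith), abs_of_nonpos hx, zero_add, outerCutoff]

theorem contDiff_smoothWindow {c A : ℝ} (hc0 : 0 < c) (hc : c < 1) (hA : 0 < A) :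
    ContDiff ℝ ∞ (smoothWindow (c * A) A) := by
  have h : smoothWindow (c * A) A = fun x => 1 - (outerCutoff c A x + outerCutoff c A (-x)) := by
    funext x
    rw [← one_sub_smoothWindow hc0 hc hA]
    ring
  rw [h]
  have := contDiff_outerCutoff c A
  exact contDiff_const.sub (this.add (this.comp contDiff_neg))

/-! ### The Hankel function and its derivative -/

theorem contDiffOn_hankelMoment (n : ℕ) : ContDiffOn ℝ ∞ (hankelMoment n) (Set.Ioi 0) := by
  rw [contDiffOn_infty]
  intro m
  induction m generalizing n with
  | zero =>
    refine contDiffOn_zero.2 fun x hx => ?_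
    exact (hasDerivAt_hankelMoment n hx).continuousAt.continuousWithinAt
  | succ m ih =>
    push_cast
    rw [contDiffOn_succ_iff_deriv_of_isOpen isOpen_Ioi]
    refine ⟨fun x hx => (hasDerivAt_hankelMoment n hx).differentiableAt.differentiableWithinAt,
      by simp, ((ih (n + 1)).neg).congr fun x hx => ?_⟩
    exact (hasDerivAt_hankelMoment n hx).deriv

/-- The weight is dominated by `t^{-1/2}`, which leaves a Gamma integral. As differentiation
replaces the `n`-th moment by minus the next one, every derivative gains a power of `x`. -/
theorem norm_hankelMoment_le (n : ℕ) {x : ℝ} (hx : 0 < x) :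
    ‖hankelMoment n x‖ ≤ Real.Gamma (n + 1 / 2) * x ^ (-((n : ℝ) + 1 / 2)) := by
  have h1 : ‖hankelMoment n x‖ ≤
      ∫ t in Set.Ioi (0 : ℝ), t ^ n * t ^ (-(1 / 2) : ℝ) * Real.exp (-(x * t)) :=
    norm_integral_le_of_norm_le (integrable_bound n hx) (by
      filter_upwards [ae_restrict_mem measurableSet_Ioi] with t ht
      exact norm_moment_le n x ht)
  refine h1.trans (le_of_eq ?_)
  have hn : (0 : ℝ) < n + 1 / 2 := by positivity
  rw [mul_comm, Real.rpow_neg hx.le, ← Real.inv_rpow hx.le, inv_eq_one_div,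
    ← Real.integral_rpow_mul_exp_neg_mul_Ioi hn hx]
  refine setIntegral_congr_fun measurableSet_Ioi fun t ht => ?_
  have ht' : (0 : ℝ) < t := ht
  rw [← Real.rpow_natCast, ← Real.rpow_add ht']
  congr 2
  ring

/-- The constant `√2 / π e^{-i π / 4}`. -/
def hankelConst : ℂ :=
  ((Real.sqrt 2 / Real.pi : ℝ) : ℂ) * Complex.exp (-(Complex.I * (Real.pi / 4)))

/-- The derivative of `H₀⁽¹⁾`. -/
def hankelDeriv (x : ℝ) : ℂ :=
  hankelConst * Complex.exp (Complex.I * x) *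
    (Complex.I * hankelMoment 0 x - hankelMoment 1 x)

theorem hankelH10_eq (x : ℝ) :
    hankelH10 x = hankelConst * Complex.exp (Complex.I * x) * hankelMoment 0 x := by
  rw [hankelH10, hankelAmplitude_eq_moment, hankelConst, mul_assoc _ _ (Complex.exp _),
    ← Complex.exp_add]
  congr 3
  ring

theorem hasDerivAt_cexp_I_mul (x : ℝ) : HasDerivAt (fun x : ℝ => Complex.exp (Complex.I * x))
    (Complex.I * Complex.exp (Complex.I * x)) x := by
  have h1 : HasDerivAt (fun x : ℝ => Complex.I * (x : ℂ)) Complex.I x := by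
    simpa using (hasDerivAt_id x).ofReal_comp.const_mul Complex.I
  exact h1.cexp.congr_deriv (mul_comm _ _)

theorem hasDerivAt_hankelH10 {x : ℝ} (hx : 0 < x) : HasDerivAt hankelH10 (hankelDeriv x) x := by
  rw [show hankelH10 = fun x : ℝ => hankelConst * Complex.exp (Complex.I * x) * hankelMoment 0 x from
    funext hankelH10_eq]
  refine (((hasDerivAt_cexp_I_mul x).const_mul hankelConst).mul
    (hasDerivAt_hankelMoment 0 hx)).congr_deriv ?_
  rw [hankelDeriv, zero_add]
  ring

theorem contDiffAt_hankelDeriv {x : ℝ} (hx : 0 < x) : ContDiffAt ℝ ∞ hankelDeriv x := by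
  have h (n : ℕ) : ContDiffAt ℝ ∞ (hankelMoment n) x :=
    (contDiffOn_hankelMoment n).contDiffAt (Ioi_mem_nhds hx)
  have he : ContDiffAt ℝ ∞ (fun x : ℝ => Complex.exp (Complex.I * x)) x :=
    (contDiffAt_const.mul Complex.ofRealCLM.contDiff.contDiffAt).cexp
  exact (contDiffAt_const.mul he).mul ((contDiffAt_const.mul (h 0)).sub (h 1))

/-! ### Derivatives of the Green function -/

/-- The factor `(i/4) k H₀⁽¹⁾'(k r) / r` of both partial derivatives of the Green function. -/
def greenRadial (k X Y : ℝ) : ℂ :=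
  Complex.I / 4 * k * hankelDeriv (k * Real.sqrt (X ^ 2 + Y ^ 2)) /
    (Real.sqrt (X ^ 2 + Y ^ 2) : ℂ)

theorem hasDerivAt_freeGreen_left {k X Y : ℝ} (hk : 0 < k) (h : 0 < X ^ 2 + Y ^ 2) :
    HasDerivAt (fun s => freeGreen k s Y) (greenRadial k X Y * X) X := by
  have hr := Real.sqrt_pos.2 h
  have h1 : HasDerivAt (fun s => k * Real.sqrt (s ^ 2 + Y ^ 2))
      (k * (X / Real.sqrt (X ^ 2 + Y ^ 2))) X := by
    have := ((((hasDerivAt_id X).pow 2).add_const (Y ^ 2)).sqrt h.ne').const_mul k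
    refine this.congr_deriv ?_
    simp only [id, Pi.pow_apply]
    field_simp
    simp
  have h2 := ((hasDerivAt_hankelH10 (mul_pos hk hr)).scomp X h1).const_mul (Complex.I / 4)
  refine h2.congr_deriv ?_
  rw [greenRadial, Complex.real_smul]
  push_cast
  ring

theorem freeGreen_comm (k X Y : ℝ) : freeGreen k X Y = freeGreen k Y X := by
  rw [freeGreen, freeGreen, add_comm]

theorem greenRadial_comm (k X Y : ℝ) : greenRadial k X Y = greenRadial k Y X := by
  rw [greenRadial, greenRadial, add_comm]

theorem hasDerivAt_freeGreen_right {k X Y : ℝ} (hk : 0 < k) (h : 0 < X ^ 2 + Y ^ 2) :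
    HasDerivAt (fun s => freeGreen k X s) (greenRadial k X Y * Y) Y := by
  simp_rw [freeGreen_comm k X, greenRadial_comm k X]
  exact hasDerivAt_freeGreen_left hk (by linarith)

/-- The integrand of the regular part of the double-layer operator, with the derivatives carried
out. -/
theorem regIntegrand_eq {f : ℝ → ℝ} {k h γ a : ℝ} (hk : 0 < k) (hγ : 0 < γ)
    (j : ℕ) (μ : ℝ → ℂ) (x t : ℝ) :
    regIntegrand f k h j γ a μ x t =
      (∑ m ∈ Finset.range (j + 1), (-1) ^ m * (j.choose m : ℂ) *
        (greenRadial k (x - t) (f x - f t + m * h) *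
          (deriv f t * (x - t) - (f x - f t + m * h)))) *
        ((1 - curveWindow f γ a x t : ℝ) : ℂ) * μ t := by
  -- On the diagonal the derivative formulas may fail, but the window equals `1` and both sides
  -- vanish. Off it the horizontal separation keeps every shifted source at positive distance.
  by_cases hxt : x = t
  · subst hxt
    have : curveWindow f γ a x x = 1 := by
      simp [curveWindow, smoothWindow, hγ.le]
    simp [regIntegrand, regKernel, this]
  have hpos : ∀ Y : ℝ, 0 < (x - t) ^ 2 + Y ^ 2 := fun Y => by
    have := sq_pos_of_ne_zero (sub_ne_zero.2 hxt)
    positivity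
  have hX : HasDerivAt (fun s : ℝ => shiftedGreen k h j (x - s) (f x - f t))
      (∑ m ∈ Finset.range (j + 1), (-1) ^ m * (j.choose m : ℂ) *
        (-(greenRadial k (x - t) (f x - f t + m * h) * (x - t : ℝ)))) t := by
    refine HasDerivAt.fun_sum fun m _ => HasDerivAt.const_mul _ ?_
    have := (hasDerivAt_freeGreen_left hk (hpos (f x - f t + m * h))).scomp t
      ((hasDerivAt_id t).const_sub x)
    exact this.congr_deriv (by simp)
  have hY : HasDerivAt (fun s : ℝ => shiftedGreen k h j (x - t) (f x - s))
      (∑ m ∈ Finset.range (j + 1), (-1) ^ m * (j.choose m : ℂ) *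
        (-(greenRadial k (x - t) (f x - f t + m * h) * (f x - f t + m * h : ℝ)))) (f t) := by
    refine HasDerivAt.fun_sum fun m _ => HasDerivAt.const_mul _ ?_
    have := (hasDerivAt_freeGreen_right hk (hpos (f x - f t + m * h))).scomp (f t)
      (((hasDerivAt_id (f t)).const_sub (f x)).add_const (m * h))
    exact this.congr_deriv (by simp)
  have hρ : (arcDensity f t : ℂ) ≠ 0 := by
    have : 0 < arcDensity f t := Real.sqrt_pos.2 (by positivity)
    exact_mod_cast this.ne'
  have key : normalDeriv f (shiftedGreen k h j) x t * arcDensity f t =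
      ∑ m ∈ Finset.range (j + 1), (-1) ^ m * (j.choose m : ℂ) *
        (greenRadial k (x - t) (f x - f t + m * h) *
          (deriv f t * (x - t) - (f x - f t + m * h))) := by
    rw [normalDeriv, hX.deriv, hY.deriv, add_mul, mul_right_comm, mul_right_comm _ _
      (arcDensity f t : ℂ)]
    push_cast
    rw [div_mul_cancel₀ _ hρ, div_mul_cancel₀ _ hρ, one_mul, Finset.mul_sum,
      ← Finset.sum_add_distrib]
    refine Finset.sum_congr rfl fun m _ => ?_
    ring
  rw [← key, regIntegrand, regKernel]
  ring

theorem contDiff_deriv_of_contDiff {f : ℝ → ℝ} (hf : ContDiff ℝ ∞ f) :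
    ContDiff ℝ ∞ (deriv f) := (contDiff_infty_iff_deriv.1 hf).2

/-- The integrand is smooth jointly in both variables. -/
theorem contDiff_regIntegrand {f : ℝ → ℝ} {k h γ a : ℝ} {μ : ℝ → ℂ} (hk : 0 < k)
    (hγ : 0 < γ) (hγa : γ < a) (j : ℕ) (hf : ContDiff ℝ ∞ f) (hμ : ContDiff ℝ ∞ μ) :
    ContDiff ℝ ∞ (fun p : ℝ × ℝ => regIntegrand f k h j γ a μ p.1 p.2) := by
  have hfd := contDiff_deriv_of_contDiff hf
  have h1 : ContDiff ℝ ∞ (fun p : ℝ × ℝ => f p.1) := hf.comp contDiff_fst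
  have h2 : ContDiff ℝ ∞ (fun p : ℝ × ℝ => f p.2) := hf.comp contDiff_snd
  have h3 : ContDiff ℝ ∞ (fun p : ℝ × ℝ => deriv f p.2) := hfd.comp contDiff_snd
  have h4 : ContDiff ℝ ∞ (fun p : ℝ × ℝ => μ p.2) := hμ.comp contDiff_snd
  have hof : ∀ {g : ℝ × ℝ → ℝ} {q : ℝ × ℝ}, ContDiffAt ℝ ∞ g q →
      ContDiffAt ℝ ∞ (fun p => (g p : ℂ)) q := fun hg =>
    Complex.ofRealCLM.contDiff.contDiffAt.comp _ hg
  refine contDiff_iff_contDiffAt.2 fun q => ?_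
  -- All singularities, those of the shifted sources included, lie over `x = t`, and a whole
  -- neighbourhood of such a point is annihilated by `1 - curveWindow`.
  by_cases hq : q.1 = q.2
  · refine (contDiffAt_const (c := (0 : ℂ))).congr_of_eventuallyEq ?_
    have hc : ContinuousAt (fun p : ℝ × ℝ =>
        Real.sqrt ((p.1 - p.2) ^ 2 + (f p.1 - f p.2) ^ 2)) q := by
      have := h1.continuous
      have := h2.continuous
      exact Continuous.continuousAt (by fun_prop)
    have h0 : Real.sqrt ((q.1 - q.2) ^ 2 + (f q.1 - f q.2) ^ 2) < γ := by
      simpa [hq] using hγ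
    filter_upwards [hc.eventually (gt_mem_nhds h0)] with p hp
    have : curveWindow f γ a p.1 p.2 = 1 := by
      rw [curveWindow, smoothWindow, if_pos]
      rw [abs_of_nonneg (Real.sqrt_nonneg _)]
      exact hp.le
    rw [regIntegrand, regKernel, this]
    simp
  · simp_rw [regIntegrand_eq hk hγ]
    have hpos : ∀ Y : ℝ, 0 < (q.1 - q.2) ^ 2 + Y ^ 2 := fun Y => by
      have := sq_pos_of_ne_zero (sub_ne_zero.2 hq)
      positivity
    have hsq : ∀ {Y : ℝ × ℝ → ℝ}, ContDiff ℝ ∞ Y →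
        ContDiffAt ℝ ∞ (fun p : ℝ × ℝ => Real.sqrt ((p.1 - p.2) ^ 2 + Y p ^ 2)) q := by
      intro Y hY
      refine ContDiffAt.sqrt ?_ (hpos _).ne'
      exact (((contDiff_fst.sub contDiff_snd).pow 2).add (hY.pow 2)).contDiffAt
    refine (ContDiffAt.mul (ContDiffAt.sum fun m _ => contDiffAt_const.mul (ContDiffAt.mul ?_ ?_))
      (hof (contDiffAt_const.sub ?_))).mul h4.contDiffAt
    · have hY : ContDiff ℝ ∞ (fun p : ℝ × ℝ => f p.1 - f p.2 + m * h) :=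
        (h1.sub h2).add contDiff_const
      have hs := hsq hY
      have hr := Real.sqrt_pos.2 (hpos (f q.1 - f q.2 + m * h))
      have hH : ContDiffAt ℝ ∞ (fun p : ℝ × ℝ => hankelDeriv
          (k * Real.sqrt ((p.1 - p.2) ^ 2 + (f p.1 - f p.2 + m * h) ^ 2))) q :=
        ContDiffAt.comp (g := hankelDeriv) q (contDiffAt_hankelDeriv (mul_pos hk hr))
          (contDiffAt_const.mul hs)
      have hN := (contDiffAt_const (c := Complex.I / 4 * (k : ℂ))).mul hH
      have hI := (hof hs).inv (by exact_mod_cast hr.ne')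
      simpa only [greenRadial, div_eq_mul_inv, Pi.inv_apply, Complex.ofReal_add,
        Complex.ofReal_sub,
        Complex.ofReal_mul, Complex.ofReal_natCast] using hN.mul hI
    · have e : (fun p : ℝ × ℝ => ((deriv f p.2 : ℝ) : ℂ) * (p.1 - p.2) - (f p.1 - f p.2 + m * h)) =
          fun p => ((deriv f p.2 * (p.1 - p.2) - (f p.1 - f p.2 + m * h) : ℝ) : ℂ) := by
        funext p
        push_cast
        ring
      rw [e]
      exact hof (((h3.mul (contDiff_fst.sub contDiff_snd)).sub
        ((h1.sub h2).add contDiff_const)).contDiffAt)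
    · have e : (fun p : ℝ × ℝ => curveWindow f γ a p.1 p.2) = fun p => windowProfile
          ((Real.sqrt ((p.1 - p.2) ^ 2 + (f p.1 - f p.2) ^ 2) - γ) / (a - γ)) := by
        funext p
        rw [curveWindow, smoothWindow_eq hγa, abs_of_nonneg (Real.sqrt_nonneg _)]
      rw [e]
      exact contDiff_windowProfile.contDiffAt.comp q
        (((hsq (h1.sub h2)).sub contDiffAt_const).div_const _)

/-! ### Symbols -/

/-- The bound `|Φ(Y, X)| ≤ C X^{-σ - ⌈J/2⌉}` for `X ≥ X₀` and bounded `Y`, uniform over a family. -/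
def SymbolBound {ι : Type} (σ X₀ : ℝ) (J : ℕ) (Φ : ι → ℝ → ℝ → ℂ) : Prop :=
  ∀ B : ℝ, ∃ C, 0 ≤ C ∧ ∀ i Y X, |Y| ≤ B → X₀ ≤ X →
    ‖Φ i Y X‖ ≤ C * X ^ (-(σ + ((J + 1) / 2 : ℕ)))

/-- The chain rule for `Φ` with partial derivatives `ΦY` and `ΦX` on `X ≥ X₀`. -/
def HasPartials {ι : Type} (X₀ : ℝ) (Φ ΦY ΦX : ι → ℝ → ℝ → ℂ) : Prop :=
  ∀ i (Y X : ℝ → ℝ) (Y' X' t : ℝ), HasDerivAt Y Y' t → HasDerivAt X X' t → X₀ ≤ X t →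
    HasDerivAt (fun s => Φ i (Y s) (X s))
      ((Y' : ℂ) * ΦY i (Y t) (X t) + (X' : ℂ) * ΦX i (Y t) (X t)) t

/-- Families of functions of `(Y, X)` whose derivatives up to the order `n` satisfy symbol
estimates: a derivative in `X` increases the weight `J` by `2` and a derivative in `Y` by `1`. -/
def SymbolFamily {ι : Type} (σ X₀ : ℝ) : ℕ → ℕ → (ι → ℝ → ℝ → ℂ) → Prop
  | 0, J, Φ => SymbolBound σ X₀ J Φ
  | n + 1, J, Φ => SymbolBound σ X₀ J Φ ∧ ∃ ΦY ΦX : ι → ℝ → ℝ → ℂ, HasPartials X₀ Φ ΦY ΦX ∧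
      SymbolFamily σ X₀ n (J + 1) ΦY ∧ SymbolFamily σ X₀ n (J + 2) ΦX

variable {ι : Type} {σ X₀ : ℝ}

theorem SymbolFamily.bound {n J : ℕ} {Φ : ι → ℝ → ℝ → ℂ} (h : SymbolFamily σ X₀ n J Φ) :
    SymbolBound σ X₀ J Φ := by
  cases n with
  | zero => exact h
  | succ n => exact h.1

theorem SymbolFamily.pred {n J : ℕ} {Φ : ι → ℝ → ℝ → ℂ} (h : SymbolFamily σ X₀ (n + 1) J Φ) :
    SymbolFamily σ X₀ n J Φ := by
  induction n generalizing J Φ with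
  | zero => exact h.1
  | succ n ih =>
    obtain ⟨hb, ΦY, ΦX, hp, hY, hX⟩ := h
    exact ⟨hb, ΦY, ΦX, hp, ih hY, ih hX⟩

theorem SymbolFamily.congr_fst {n J J' : ℕ} {Φ : ι → ℝ → ℝ → ℂ} (h : SymbolFamily σ X₀ n J Φ)
    (e : J = J') : SymbolFamily σ X₀ n J' Φ := e ▸ h

theorem SymbolFamily.comap {κ : Type} (g : κ → ι) {n J : ℕ} {Φ : ι → ℝ → ℝ → ℂ}
    (h : SymbolFamily σ X₀ n J Φ) : SymbolFamily σ X₀ n J fun i => Φ (g i) := by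
  induction n generalizing J Φ with
  | zero =>
    intro B
    obtain ⟨C, hC, hb⟩ := h B
    exact ⟨C, hC, fun i => hb (g i)⟩
  | succ n ih =>
    obtain ⟨hb, ΦY, ΦX, hp, hY, hX⟩ := h
    refine ⟨fun B => ?_, _, _, fun i => hp (g i), ih hY, ih hX⟩
    obtain ⟨C, hC, hb⟩ := hb B
    exact ⟨C, hC, fun i => hb (g i)⟩

theorem SymbolBound.add {J : ℕ} {Φ Ψ : ι → ℝ → ℝ → ℂ} (h : SymbolBound σ X₀ J Φ)
    (h' : SymbolBound σ X₀ J Ψ) : SymbolBound σ X₀ J fun i Y X => Φ i Y X + Ψ i Y X := by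
  intro B
  obtain ⟨C, hC, hb⟩ := h B
  obtain ⟨C', hC', hb'⟩ := h' B
  refine ⟨C + C', by positivity, fun i Y X hY hX => ?_⟩
  rw [add_mul]
  exact (norm_add_le _ _).trans (add_le_add (hb i Y X hY hX) (hb' i Y X hY hX))

theorem SymbolFamily.add {n J : ℕ} {Φ Ψ : ι → ℝ → ℝ → ℂ} (h : SymbolFamily σ X₀ n J Φ)
    (h' : SymbolFamily σ X₀ n J Ψ) : SymbolFamily σ X₀ n J fun i Y X => Φ i Y X + Ψ i Y X := by
  induction n generalizing J Φ Ψ with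
  | zero => exact SymbolBound.add h h'
  | succ n ih =>
    obtain ⟨hb, ΦY, ΦX, hp, hY, hX⟩ := h
    obtain ⟨hb', ΨY, ΨX, hp', hY', hX'⟩ := h'
    refine ⟨hb.add hb', _, _, fun i Y X Y' X' t h1 h2 h3 => ?_, ih hY hY', ih hX hX'⟩
    refine ((hp i Y X Y' X' t h1 h2 h3).add (hp' i Y X Y' X' t h1 h2 h3)).congr_deriv ?_
    ring

theorem SymbolFamily.const_mul (c : ℂ) {n J : ℕ} {Φ : ι → ℝ → ℝ → ℂ}
    (h : SymbolFamily σ X₀ n J Φ) : SymbolFamily σ X₀ n J fun i Y X => c * Φ i Y X := by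
  have hbd : ∀ {J : ℕ} {Φ : ι → ℝ → ℝ → ℂ}, SymbolBound σ X₀ J Φ →
      SymbolBound σ X₀ J fun i Y X => c * Φ i Y X := by
    intro J Φ h B
    obtain ⟨C, hC, hb⟩ := h B
    refine ⟨‖c‖ * C, by positivity, fun i Y X hY hX => ?_⟩
    rw [norm_mul, mul_assoc]
    exact mul_le_mul_of_nonneg_left (hb i Y X hY hX) (norm_nonneg c)
  induction n generalizing J Φ with
  | zero => exact hbd h
  | succ n ih =>
    obtain ⟨hb, ΦY, ΦX, hp, hY, hX⟩ := h
    refine ⟨hbd hb, _, _, fun i Y X Y' X' t h1 h2 h3 => ?_, ih hY, ih hX⟩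
    refine ((hp i Y X Y' X' t h1 h2 h3).const_mul c).congr_deriv ?_
    ring

theorem SymbolFamily.sub {n J : ℕ} {Φ Ψ : ι → ℝ → ℝ → ℂ} (h : SymbolFamily σ X₀ n J Φ)
    (h' : SymbolFamily σ X₀ n J Ψ) : SymbolFamily σ X₀ n J fun i Y X => Φ i Y X - Ψ i Y X := by
  simpa [sub_eq_add_neg] using h.add (h'.const_mul (-1))

/-- The Leibniz rule, with additive weights. The rounding is harmless because `⌈(J + J')/2⌉ ≤ ⌈J/2⌉
+ ⌈J'/2⌉` and `X ≥ 1`. -/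
theorem SymbolFamily.mul {τ : ℝ} (hX₀ : 1 ≤ X₀) {n J J' : ℕ} {Φ Ψ : ι → ℝ → ℝ → ℂ}
    (h : SymbolFamily σ X₀ n J Φ) (h' : SymbolFamily τ X₀ n J' Ψ) :
    SymbolFamily (σ + τ) X₀ n (J + J') fun i Y X => Φ i Y X * Ψ i Y X := by
  have hbd : ∀ {J J' : ℕ} {Φ Ψ : ι → ℝ → ℝ → ℂ}, SymbolBound σ X₀ J Φ → SymbolBound τ X₀ J' Ψ →
      SymbolBound (σ + τ) X₀ (J + J') fun i Y X => Φ i Y X * Ψ i Y X := by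
    intro J J' Φ Ψ h h' B
    obtain ⟨C, hC, hb⟩ := h B
    obtain ⟨C', hC', hb'⟩ := h' B
    refine ⟨C * C', by positivity, fun i Y X hY hX => ?_⟩
    have hX1 : 1 ≤ X := hX₀.trans hX
    have hX0 : 0 < X := by linarith
    rw [norm_mul]
    calc ‖Φ i Y X‖ * ‖Ψ i Y X‖
        ≤ (C * X ^ (-(σ + ((J + 1) / 2 : ℕ)))) * (C' * X ^ (-(τ + ((J' + 1) / 2 : ℕ)))) := by
          gcongr
          · exact hb i Y X hY hX
          · exact hb' i Y X hY hX
      _ = C * C' * X ^ (-(σ + ((J + 1) / 2 : ℕ)) + -(τ + ((J' + 1) / 2 : ℕ))) := by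
          rw [Real.rpow_add hX0]
          ring
      _ ≤ _ := by
          refine mul_le_mul_of_nonneg_left (Real.rpow_le_rpow_of_exponent_le hX1 ?_) (by positivity)
          have : (((J + J' + 1) / 2 : ℕ) : ℝ) ≤ ((J + 1) / 2 : ℕ) + ((J' + 1) / 2 : ℕ) := by
            exact_mod_cast (by omega : (J + J' + 1) / 2 ≤ (J + 1) / 2 + (J' + 1) / 2)
          linarith
  induction n generalizing J J' Φ Ψ with
  | zero => exact hbd h h'
  | succ n ih =>
    have hp0 := h.pred
    have hp0' := h'.pred
    obtain ⟨hb, ΦY, ΦX, hp, hY, hX⟩ := h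
    obtain ⟨hb', ΨY, ΨX, hp', hY', hX'⟩ := h'
    refine ⟨hbd hb hb', _, _, fun i Y X Y' X' t h1 h2 h3 => ?_,
      ((ih hY hp0').congr_fst (by ring)).add ((ih hp0 hY').congr_fst (by ring)),
      ((ih hX hp0').congr_fst (by ring)).add ((ih hp0 hX').congr_fst (by ring))⟩
    refine ((hp i Y X Y' X' t h1 h2 h3).mul (hp' i Y X Y' X' t h1 h2 h3)).congr_deriv ?_
    ring

/-- By the mean value inequality in `Y`, a difference is as good as a `Y`-derivative: one order of
differentiability is spent and weight `1` is gained. -/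
theorem SymbolFamily.sub_shift (c : ℝ) {n J : ℕ} {Φ : ι → ℝ → ℝ → ℂ}
    (h : SymbolFamily σ X₀ (n + 1) J Φ) :
    SymbolFamily σ X₀ n (J + 1) fun i Y X => Φ i Y X - Φ i (Y + c) X := by
  have hbd : ∀ {J : ℕ} {Φ : ι → ℝ → ℝ → ℂ}, SymbolFamily σ X₀ 1 J Φ →
      SymbolBound σ X₀ (J + 1) fun i Y X => Φ i Y X - Φ i (Y + c) X := by
    intro J Φ h B
    obtain ⟨-, ΦY, ΦX, hp, hY, -⟩ := h
    -- The segment from `Y` to `Y + c` leaves `|Y| ≤ B` by at most `|c|`.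
    obtain ⟨C, hC, hb⟩ := hY (B + |c|)
    refine ⟨C * |c|, by positivity, fun i Y X hYB hX => ?_⟩
    have hd : ∀ s, HasDerivAt (fun s => Φ i s X) (ΦY i s X) s := fun s => by
      simpa using hp i id (fun _ => X) 1 0 s (hasDerivAt_id s) (hasDerivAt_const s X) hX
    have := (convex_uIcc Y (Y + c)).norm_image_sub_le_of_norm_hasDerivWithin_le
      (f := fun s => Φ i s X) (fun s _ => (hd s).hasDerivWithinAt)
      (C := C * X ^ (-(σ + ((J + 1 + 1) / 2 : ℕ)))) (fun s hs => hb i s X (by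
        have h1 := Set.abs_sub_left_of_mem_uIcc hs
        rw [add_sub_cancel_left] at h1
        have h2 := abs_add_le Y (s - Y)
        rw [add_sub_cancel] at h2
        linarith) hX) Set.right_mem_uIcc Set.left_mem_uIcc
    rw [sub_add_cancel_left, norm_neg, Real.norm_eq_abs] at this
    linarith
  induction n generalizing J Φ with
  | zero => exact hbd h
  | succ n ih =>
    obtain ⟨hb, ΦY, ΦX, hp, hY, hX⟩ := h
    refine ⟨hbd ⟨hb, ΦY, ΦX, hp, hY.bound, hX.bound⟩, _, _, fun i Y X Y' X' t h1 h2 h3 => ?_,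
      ih hY, (ih hX).congr_fst (by ring)⟩
    refine ((hp i Y X Y' X' t h1 h2 h3).sub (hp i (fun s => Y s + c) X Y' X' t
      (h1.add_const c) h2 h3)).congr_deriv ?_
    ring

/-- The backward difference in `X` with step `d`. -/
def backDiff (d : ℝ) (Φ : ι → ℝ → ℝ → ℂ) : ι → ℝ → ℝ → ℂ :=
  fun i Y X => Φ i Y X - Φ i Y (X - d)

/-- The mean value inequality in `X`, which gains weight `2`, that is, a full power of `X`. The
domain shrinks to `X₀ + d` so that `X - d` stays admissible. -/
theorem SymbolFamily.backDiff {d : ℝ} (hσ : 0 ≤ σ) (hX₀ : 0 < X₀) (hd : 0 < d) {n J : ℕ}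
    {Φ : ι → ℝ → ℝ → ℂ} (h : SymbolFamily σ X₀ (n + 1) J Φ) :
    SymbolFamily σ (X₀ + d) n (J + 2) (backDiff d Φ) := by
  have hbd : ∀ {J : ℕ} {Φ : ι → ℝ → ℝ → ℂ}, SymbolFamily σ X₀ 1 J Φ →
      SymbolBound σ (X₀ + d) (J + 2) (WoodNystrom.backDiff d Φ) := by
    intro J Φ h B
    obtain ⟨-, ΦY, ΦX, hp, -, hX⟩ := h
    obtain ⟨C, hC, hb⟩ := hX B
    set q : ℝ := σ + ((J + 2 + 1) / 2 : ℕ) with hq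
    have hq0 : 0 ≤ q := by positivity
    refine ⟨C * (X₀ / (X₀ + d)) ^ (-q) * d, by positivity, fun i Y X hYB hX => ?_⟩
    have hdr : ∀ s, X₀ ≤ s → HasDerivAt (fun s => Φ i Y s) (ΦX i Y s) s := fun s hs => by
      simpa using hp i (fun _ => Y) id 0 1 s (hasDerivAt_const s Y) (hasDerivAt_id s) hs
    -- `X - d` is comparable with `X`; the ratio is worst at the endpoint `X = X₀ + d`, where
    -- equality holds.
    have hXd : X * (X₀ / (X₀ + d)) ≤ X - d := by
      rw [mul_div_assoc', div_le_iff₀ (by positivity)]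
      nlinarith
    have hX0 : 0 < X := by linarith
    have := (convex_Icc (X - d) X).norm_image_sub_le_of_norm_hasDerivWithin_le
      (f := fun s => Φ i Y s) (fun s hs => (hdr s (by linarith [hs.1])).hasDerivWithinAt)
      (C := C * (X₀ / (X₀ + d)) ^ (-q) * X ^ (-q)) (fun s hs => (hb i Y s hYB (by
        linarith [hs.1])).trans (by
        rw [mul_assoc, ← Real.mul_rpow (by positivity) hX0.le]
        refine mul_le_mul_of_nonneg_left (Real.rpow_le_rpow_of_nonpos (by positivity) ?_
          (by linarith)) hC
        linarith [hs.1]))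
      (Set.left_mem_Icc.2 (by linarith)) (Set.right_mem_Icc.2 (by linarith))
    rw [sub_sub_cancel, Real.norm_of_nonneg hd.le] at this
    calc _ ≤ _ := this
      _ = _ := by ring
  induction n generalizing J Φ with
  | zero => exact hbd h
  | succ n ih =>
    obtain ⟨hb, ΦY, ΦX, hp, hY, hX⟩ := h
    refine ⟨hbd ⟨hb, ΦY, ΦX, hp, hY.bound, hX.bound⟩, _, _, fun i Y X Y' X' t h1 h2 h3 => ?_,
      (ih hY).congr_fst (by ring), ih hX⟩
    refine ((hp i Y X Y' X' t h1 h2 (by linarith)).sub (hp i Y (fun s => X s - d) Y' X' t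
      h1 (h2.sub_const d) (by linarith))).congr_deriv ?_
    simp only [WoodNystrom.backDiff]
    ring

/-- The alternating binomial sum of order `j` over shifts of `Y` by multiples of `h`. -/
def shiftSum (h : ℝ) (j : ℕ) (Φ : ι → ℝ → ℝ → ℂ) : ι → ℝ → ℝ → ℂ :=
  fun i Y X => ∑ m ∈ Finset.range (j + 1), (-1) ^ m * (j.choose m : ℂ) * Φ i (Y + m * h) X

theorem shiftSum_succ (h : ℝ) (j : ℕ) (Φ : ι → ℝ → ℝ → ℂ) (i : ι) (Y X : ℝ) :
    shiftSum h (j + 1) Φ i Y X = shiftSum h j Φ i Y X - shiftSum h j Φ i (Y + h) X := by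
  unfold shiftSum
  have e : ∑ m ∈ Finset.range (j + 1), (-1) ^ m * (j.choose m : ℂ) * Φ i (Y + h + m * h) X =
      ∑ m ∈ Finset.range (j + 1), (-1) ^ m * (j.choose m : ℂ) * Φ i (Y + (m + 1 : ℕ) * h) X :=
    Finset.sum_congr rfl fun m _ => by
      rw [show Y + h + m * h = Y + (m + 1 : ℕ) * h by push_cast; ring]
  have e2 : ∑ m ∈ Finset.range j, (-1) ^ (m + 1) * (j.choose (m + 1) : ℂ) *
        Φ i (Y + (m + 1 : ℕ) * h) X =
      ∑ m ∈ Finset.range (j + 1), (-1) ^ (m + 1) * (j.choose (m + 1) : ℂ) *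
        Φ i (Y + (m + 1 : ℕ) * h) X := by
    rw [Finset.sum_range_succ _ j]
    simp
  have e3 := Finset.sum_range_succ'
    (fun m => (-1) ^ m * (j.choose m : ℂ) * Φ i (Y + m * h) X) j
  rw [e, e3, e2, Finset.sum_range_succ' _ (j + 1), add_sub_right_comm, ← Finset.sum_sub_distrib]
  simp only [Nat.choose_zero_right]
  congr 1
  refine Finset.sum_congr rfl fun m _ => ?_
  rw [Nat.choose_succ_succ]
  push_cast
  ring

/-- By Pascal's rule (`shiftSum_succ`) the binomial sum is a `j`-fold difference in `Y`. Every
difference spends a derivative, hence the hypothesis for all orders. -/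
theorem SymbolFamily.shiftSum_gain (h : ℝ) (j : ℕ) {J : ℕ}
    {Φ : ι → ℝ → ℝ → ℂ} (hΦ : ∀ n, SymbolFamily σ X₀ n J Φ) (n : ℕ) :
    SymbolFamily σ X₀ n (J + j) (shiftSum h j Φ) := by
  induction j generalizing n with
  | zero =>
    have : shiftSum h 0 Φ = Φ := by
      ext i Y X
      simp [shiftSum]
    rw [this]
    exact hΦ n
  | succ j ih =>
    have := (ih (n + 1)).sub_shift h
    rw [show shiftSum h (j + 1) Φ = fun i Y X => shiftSum h j Φ i Y X -
      shiftSum h j Φ i (Y + h) X by ext i Y X; exact shiftSum_succ h j Φ i Y X]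
    exact this

theorem SymbolFamily.backDiff_iterate {d : ℝ} (hσ : 0 ≤ σ) (hX₀ : 0 < X₀) (hd : 0 < d)
    {J : ℕ} {Φ : ι → ℝ → ℝ → ℂ} (hΦ : ∀ n, SymbolFamily σ X₀ n J Φ) (Q n : ℕ) :
    SymbolFamily σ (X₀ + Q * d) n (J + 2 * Q) ((WoodNystrom.backDiff d)^[Q] Φ) := by
  induction Q generalizing n with
  | zero => simpa using hΦ n
  | succ Q ih =>
    rw [Function.iterate_succ_apply']
    have h0 : 0 < X₀ + Q * d := by positivity
    have := ((ih (n + 1)).backDiff hσ h0 hd).congr_fst (J' := J + 2 * (Q + 1)) (by ring)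
    rwa [show X₀ + (Q + 1 : ℕ) * d = X₀ + Q * d + d by push_cast; ring]

/-! ### Symbols of windows -/

section

variable {ι : Type} {σ X₀ : ℝ}

theorem symbolFamily_zero (n J : ℕ) : SymbolFamily σ X₀ n J fun (_ : ι) _ _ => (0 : ℂ) := by
  have hb : ∀ J, SymbolBound σ X₀ J fun (_ : ι) _ _ => (0 : ℂ) := by
    refine fun J B => ⟨0, le_rfl, fun i Y X _ _ => ?_⟩
    simp
  induction n generalizing J with
  | zero => exact hb J
  | succ n ih =>
    refine ⟨hb J, _, _, fun i Y X Y' X' t _ _ _ => ?_, ih _, ih _⟩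
    simpa using hasDerivAt_const t (0 : ℂ)

theorem symbolFamily_one (n : ℕ) : SymbolFamily 0 X₀ n 0 fun (_ : ι) _ _ => (1 : ℂ) := by
  have hb : SymbolBound 0 X₀ 0 fun (_ : ι) _ _ => (1 : ℂ) :=
    fun B => ⟨1, zero_le_one, fun i Y X _ _ => by simp⟩
  cases n with
  | zero => exact hb
  | succ n =>
    refine ⟨hb, _, _, fun i Y X Y' X' t _ _ _ => ?_, symbolFamily_zero _ _, symbolFamily_zero _ _⟩
    simpa using hasDerivAt_const t (1 : ℂ)

end

/-- On the support `X < A`, so `A^{-m} ≤ X^{-m}` with no dependence on `A`; a derivative in `X`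
replaces `m` by `m + 1` and `g` by `g'`. Using `A` as the index of the family records this
uniformity. -/
theorem symbolFamily_scale {X₀ : ℝ} (hX₀ : 0 < X₀) (n m : ℕ) {g : ℝ → ℂ}
    (hg : ContDiff ℝ ∞ g) (hg1 : ∀ u, 1 ≤ u → g u = 0) :
    SymbolFamily 0 X₀ n (2 * m) fun (A : Set.Ioi (0 : ℝ)) _ X =>
      (((A : ℝ) ^ m)⁻¹ : ℂ) * g (X / A) := by
  have hbd : ∀ (m : ℕ) {g : ℝ → ℂ}, Continuous g → (∀ u, 1 ≤ u → g u = 0) →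
      SymbolBound 0 X₀ (2 * m) fun (A : Set.Ioi (0 : ℝ)) _ X =>
        (((A : ℝ) ^ m)⁻¹ : ℂ) * g (X / A) := by
    intro m g hg hg1 B
    obtain ⟨C, hC⟩ := (isCompact_Icc (a := (0 : ℝ)) (b := 1)).exists_bound_of_continuousOn
      hg.continuousOn
    have hC0 : 0 ≤ C := (norm_nonneg _).trans (hC 0 (by simp))
    refine ⟨C, hC0, fun A Y X _ hX => ?_⟩
    have hX0 : 0 < X := hX₀.trans_le hX
    have hA : 0 < (A : ℝ) := A.2
    rcases le_or_gt 1 (X / A) with h1 | h1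
    · simp only [hg1 _ h1, mul_zero, norm_zero]
      positivity
    · have h2 : X < A := by rwa [div_lt_one hA] at h1
      rw [norm_mul, norm_inv, norm_pow, Complex.norm_real, Real.norm_of_nonneg hA.le, mul_comm,
        show (2 * m + 1) / 2 = m by omega, zero_add, Real.rpow_neg hX0.le, Real.rpow_natCast]
      refine mul_le_mul (hC _ ⟨by positivity, h1.le⟩) ?_ (by positivity) hC0
      gcongr
  induction n generalizing m g with
  | zero => exact hbd m hg.continuous hg1
  | succ n ih =>
    have hgd := contDiff_infty_iff_deriv.1 hg
    refine ⟨hbd m hg.continuous hg1, fun _ _ _ => 0, _, fun A Y X Y' X' t _ hX' _ => ?_,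
      symbolFamily_zero _ _, ih (m + 1) hgd.2 fun u hu => ?_⟩
    · have hA : (A : ℝ) ≠ 0 := A.2.ne'
      have h1 := ((hgd.1 (X t / A)).hasDerivAt.scomp t (hX'.div_const (A : ℝ))).const_mul
        (((A : ℝ) ^ m)⁻¹ : ℂ)
      refine h1.congr_deriv ?_
      rw [Complex.real_smul]
      have hA' : ((A : ℝ) : ℂ) ≠ 0 := by exact_mod_cast hA
      push_cast
      field_simp
      ring
    -- At `u = 1` the vanishing of `g` is known only to the right, so the derivative is determined
    -- from that side.
    · have hd : HasDerivWithinAt g 0 (Set.Ici u) u :=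
        (hasDerivWithinAt_const u (Set.Ici u) (0 : ℂ)).congr
          (fun v hv => hg1 v (hu.trans hv)) (hg1 u hu)
      exact (uniqueDiffWithinAt_Ici u).eq_deriv _ (hgd.1 u).hasDerivAt.hasDerivWithinAt hd

/-- The cutoff does not vanish at infinity, but `1` minus it does; it is the constant symbol minus
an instance of `symbolFamily_scale` with `m = 0`. -/
theorem symbolFamily_outerCutoff {X₀ c : ℝ} (hX₀ : 0 < X₀) (hc : c < 1) (n : ℕ) :
    SymbolFamily 0 X₀ n 0 fun (A : Set.Ioi (0 : ℝ)) _ X => (outerCutoff c A X : ℂ) := by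
  have hg : ContDiff ℝ ∞ (fun u : ℝ => ((windowProfile ((u - c) / (1 - c)) : ℝ) : ℂ)) :=
    Complex.ofRealCLM.contDiff.comp
      (contDiff_windowProfile.comp ((contDiff_id.sub contDiff_const).div_const _))
  have h := symbolFamily_scale hX₀ n 0 hg fun u hu => by
    rw [windowProfile_of_one_le, Complex.ofReal_zero]
    rw [le_div_iff₀ (by linarith)]
    linarith
  have h2 := (symbolFamily_one n).sub h
  simpa [outerCutoff] using h2

/-! ### Symbols of the Green function -/

/-- The functions `e^{i k (r - X)} M_n(k r) r^a v^e Y^c` with `r = √(X² + Y²)` and `v = r + X`. -/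
def hankelTerm (k : ℝ) (n : ℕ) (a e : ℤ) (c : ℕ) (Y X : ℝ) : ℂ :=
  Complex.exp (Complex.I * (k * (Real.sqrt (X ^ 2 + Y ^ 2) - X) : ℝ)) *
    hankelMoment n (k * Real.sqrt (X ^ 2 + Y ^ 2)) *
    ((Real.sqrt (X ^ 2 + Y ^ 2) ^ a * (Real.sqrt (X ^ 2 + Y ^ 2) + X) ^ e * Y ^ c : ℝ) : ℂ)

/-- Finite linear combinations of the functions `hankelTerm` of weight at least `J`. -/
inductive HankelSymbol (k : ℝ) : ℤ → (ℝ → ℝ → ℂ) → Prop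
  | term (n : ℕ) (a e : ℤ) (c : ℕ) (J : ℤ) (h : J ≤ 2 * (n - a - e) - c) :
    HankelSymbol k J (hankelTerm k n a e c)
  | zero (J : ℤ) : HankelSymbol k J fun _ _ => 0
  | add (J : ℤ) (Φ Ψ : ℝ → ℝ → ℂ) (hΦ : HankelSymbol k J Φ) (hΨ : HankelSymbol k J Ψ) :
    HankelSymbol k J fun Y X => Φ Y X + Ψ Y X
  | smul (J : ℤ) (z : ℂ) (Φ : ℝ → ℝ → ℂ) (hΦ : HankelSymbol k J Φ) :
    HankelSymbol k J fun Y X => z * Φ Y X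

theorem zpow_le_of_comparable {X u D : ℝ} (hX : 0 < X) (hu : X ≤ u) (hD : u ≤ D * X) (a : ℤ) :
    u ^ a ≤ D ^ a.natAbs * X ^ a := by
  have hu0 : 0 < u := hX.trans_le hu
  have hD1 : 1 ≤ D := by
    by_contra h
    nlinarith
  obtain ⟨m, rfl | rfl⟩ := a.eq_nat_or_neg
  · rw [zpow_natCast, zpow_natCast, Int.natAbs_natCast, ← mul_pow]
    gcongr
  · rw [zpow_neg, zpow_neg, zpow_natCast, zpow_natCast, Int.natAbs_neg, Int.natAbs_natCast]
    have h1 : (u ^ m)⁻¹ ≤ (X ^ m)⁻¹ := by gcongr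
    refine h1.trans (le_mul_of_one_le_left (by positivity) (one_le_pow₀ hD1))

/-- For bounded `Y` both `r` and `r + X` are comparable with `X`, and the exponential has modulus
one, so the size is `X^{-(n + 1/2) + a + e}`. -/
theorem norm_hankelTerm_le {k : ℝ} (hk : 0 < k) {X₀ : ℝ} (hX₀ : 1 ≤ X₀) (n : ℕ) (a e : ℤ)
    (c J : ℕ) (h : (J : ℤ) ≤ 2 * (n - a - e) - c) :
    SymbolBound (1 / 2) X₀ J fun _ : Unit => hankelTerm k n a e c := by
  intro B
  refine ⟨Real.Gamma (n + 1 / 2) * k ^ (-((n : ℝ) + 1 / 2)) * (1 + |B|) ^ a.natAbs *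
    (2 + |B|) ^ e.natAbs * |B| ^ c, ?_, fun _ Y X hY hX => ?_⟩
  · have : 0 < Real.Gamma ((n : ℝ) + 1 / 2) := Real.Gamma_pos_of_pos (by positivity)
    positivity
  have hX1 : 1 ≤ X := hX₀.trans hX
  have hX0 : 0 < X := by linarith
  set r := Real.sqrt (X ^ 2 + Y ^ 2) with hr
  have hYB : |Y| ≤ |B| := hY.trans (le_abs_self B)
  have hrX : X ≤ r := Real.le_sqrt_of_sq_le (by nlinarith [sq_nonneg Y])
  have hrD : r ≤ (1 + |B|) * X := by
    rw [hr, Real.sqrt_le_left (by positivity)]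
    have : Y ^ 2 ≤ |B| ^ 2 := by
      rw [← sq_abs Y]
      gcongr
    have h1 : |B| ^ 2 ≤ |B| ^ 2 * X ^ 2 := le_mul_of_one_le_right (by positivity) (by nlinarith)
    nlinarith [mul_nonneg (abs_nonneg B) (sq_nonneg X)]
  have hr0 : 0 < r := by linarith
  have hM : ‖hankelMoment n (k * r)‖ ≤
      Real.Gamma (n + 1 / 2) * k ^ (-((n : ℝ) + 1 / 2)) * X ^ (-((n : ℝ) + 1 / 2)) := by
    refine (norm_hankelMoment_le n (mul_pos hk hr0)).trans ?_
    have : 0 < Real.Gamma ((n : ℝ) + 1 / 2) := Real.Gamma_pos_of_pos (by positivity)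
    rw [Real.mul_rpow hk.le hr0.le, mul_assoc]
    have h2 : r ^ (-((n : ℝ) + 1 / 2)) ≤ X ^ (-((n : ℝ) + 1 / 2)) :=
      Real.rpow_le_rpow_of_nonpos hX0 hrX (neg_nonpos.2 (by positivity))
    gcongr
  have hA := zpow_le_of_comparable hX0 hrX hrD a
  have hE := zpow_le_of_comparable (u := r + X) (D := 2 + |B|) hX0 (by linarith) (by linarith) e
  have hexp : ‖Complex.exp (Complex.I * (k * (r - X) : ℝ))‖ = 1 := by
    rw [mul_comm, Complex.norm_exp_ofReal_mul_I]
  simp only [hankelTerm, ← hr]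
  rw [norm_mul, norm_mul, hexp, one_mul, Complex.norm_real, norm_mul, norm_mul,
    norm_pow, norm_zpow, norm_zpow, Real.norm_of_nonneg hr0.le,
    Real.norm_of_nonneg (by positivity : 0 ≤ r + X), Real.norm_eq_abs]
  have hG : 0 < Real.Gamma ((n : ℝ) + 1 / 2) := Real.Gamma_pos_of_pos (by positivity)
  calc ‖hankelMoment n (k * r)‖ * (r ^ a * (r + X) ^ e * |Y| ^ c)
      ≤ (Real.Gamma (n + 1 / 2) * k ^ (-((n : ℝ) + 1 / 2)) * X ^ (-((n : ℝ) + 1 / 2))) *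
        (((1 + |B|) ^ a.natAbs * X ^ a) * ((2 + |B|) ^ e.natAbs * X ^ e) * |B| ^ c) := by
        gcongr
    _ = Real.Gamma (n + 1 / 2) * k ^ (-((n : ℝ) + 1 / 2)) * (1 + |B|) ^ a.natAbs *
        (2 + |B|) ^ e.natAbs * |B| ^ c * X ^ (-((n : ℝ) + 1 / 2) + a + e) := by
        rw [Real.rpow_add hX0, Real.rpow_add hX0, Real.rpow_intCast, Real.rpow_intCast]
        ring
    _ ≤ _ := by
        refine mul_le_mul_of_nonneg_left (Real.rpow_le_rpow_of_exponent_le hX1 ?_) (by positivity)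
        -- Here `2(n - a - e) ≥ J + c ≥ J`, and `n - a - e` is an integer: this is where the weight
        -- is rounded up.
        have h1 : (((J + 1) / 2 : ℕ) : ℤ) ≤ n - a - e := by omega
        have h2 : (((J + 1) / 2 : ℕ) : ℝ) ≤ n - a - e := by
          have h3 := (Int.cast_le (R := ℝ)).2 h1
          push_cast at h3 ⊢
          exact h3
        linarith

theorem HankelSymbol.bound {k : ℝ} (hk : 0 < k) {X₀ : ℝ} (hX₀ : 1 ≤ X₀) {J : ℤ}
    {Φ : ℝ → ℝ → ℂ} (h : HankelSymbol k J Φ) (J' : ℕ) (hJ : J = J') :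
    SymbolBound (1 / 2) X₀ J' fun _ : Unit => Φ := by
  induction h with
  | term n a e c J h => exact norm_hankelTerm_le hk hX₀ n a e c J' (hJ ▸ h)
  | zero J => exact (symbolFamily_zero 0 J' : SymbolFamily _ _ 0 _ _)
  | add J Φ Ψ hΦ hΨ ih ih' => exact (ih hJ).add (ih' hJ)
  | smul J z Φ hΦ ih => exact SymbolFamily.const_mul (n := 0) z (ih hJ)

/-- The chain rule for functions of `(Y, X)` with given partial derivatives, on `X > 0`. -/
def HasPartialsPos (Φ ΦY ΦX : ℝ → ℝ → ℂ) : Prop :=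
  ∀ (Y X : ℝ → ℝ) (Y' X' t : ℝ), HasDerivAt Y Y' t → HasDerivAt X X' t → 0 < X t →
    HasDerivAt (fun s => Φ (Y s) (X s))
      ((Y' : ℂ) * ΦY (Y t) (X t) + (X' : ℂ) * ΦX (Y t) (X t)) t

/-- With `v = r + X`, the relations `∂_X r = (v - r)/r`, `∂_X v = v/r`, `∂_Y r = ∂_Y v = Y/r` and
`∂_X (r - X) = -Y²/(r v)` keep the class closed. The last one exhibits the cancellation in the
phase; without it an `X`-derivative would gain nothing. -/
theorem hasPartialsPos_hankelTerm {k : ℝ} (hk : 0 < k) (n : ℕ) (a e : ℤ) (c : ℕ) :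
    HasPartialsPos (hankelTerm k n a e c)
      (fun Y X => Complex.I * k * hankelTerm k n (a - 1) e (c + 1) Y X
        + -k * hankelTerm k (n + 1) (a - 1) e (c + 1) Y X
        + a * hankelTerm k n (a - 2) e (c + 1) Y X
        + e * hankelTerm k n (a - 1) (e - 1) (c + 1) Y X
        + c * hankelTerm k n a e (c - 1) Y X)
      (fun Y X => -Complex.I * k * hankelTerm k n (a - 1) (e - 1) (c + 2) Y X
        + -k * hankelTerm k (n + 1) (a - 1) (e + 1) c Y X
        + k * hankelTerm k (n + 1) a e c Y X
        + a * hankelTerm k n (a - 2) (e + 1) c Y X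
        + -a * hankelTerm k n (a - 1) e c Y X
        + e * hankelTerm k n (a - 1) e c Y X) := by
  intro Y X Y' X' t hY hX hpos
  set r := Real.sqrt (X t ^ 2 + Y t ^ 2) with hr
  have hsq : 0 < X t ^ 2 + Y t ^ 2 := by positivity
  have hr0 : 0 < r := Real.sqrt_pos.2 hsq
  have hv0 : 0 < r + X t := by positivity
  have hr2 : r ^ 2 = X t ^ 2 + Y t ^ 2 := Real.sq_sqrt hsq.le
  have hdr : HasDerivAt (fun s => Real.sqrt (X s ^ 2 + Y s ^ 2))
      ((X t * X' + Y t * Y') / r) t := by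
    refine (((hX.pow 2).add (hY.pow 2)).sqrt hsq.ne').congr_deriv ?_
    simp only [Pi.add_apply, Pi.pow_apply, ← hr]
    push_cast
    field_simp
  have hdexp : HasDerivAt (fun s => Complex.exp (Complex.I *
      (k * (Real.sqrt (X s ^ 2 + Y s ^ 2) - X s) : ℝ)))
      ((k * ((X t * X' + Y t * Y') / r - X') : ℝ) •
        (Complex.I * Complex.exp (Complex.I * (k * (r - X t) : ℝ)))) t :=
    HasDerivAt.scomp (g₁ := fun u : ℝ => Complex.exp (Complex.I * u)) t
      (hasDerivAt_cexp_I_mul (k * (r - X t))) ((hdr.sub hX).const_mul k)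
  have hdM : HasDerivAt (fun s => hankelMoment n (k * Real.sqrt (X s ^ 2 + Y s ^ 2)))
      ((k * ((X t * X' + Y t * Y') / r) : ℝ) • (-hankelMoment (n + 1) (k * r))) t :=
    HasDerivAt.scomp (g₁ := hankelMoment n) t (hasDerivAt_hankelMoment n (mul_pos hk hr0)) (hdr.const_mul k)
  have hda : HasDerivAt (fun s => Real.sqrt (X s ^ 2 + Y s ^ 2) ^ a)
      (a * r ^ (a - 1) * ((X t * X' + Y t * Y') / r)) t :=
    HasDerivAt.comp (h₂ := fun u : ℝ => u ^ a) t (hasDerivAt_zpow a r (Or.inl hr0.ne')) hdr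
  have hde : HasDerivAt (fun s => (Real.sqrt (X s ^ 2 + Y s ^ 2) + X s) ^ e)
      (e * (r + X t) ^ (e - 1) * ((X t * X' + Y t * Y') / r + X')) t :=
    HasDerivAt.comp (h₂ := fun u : ℝ => u ^ e) t
      (hasDerivAt_zpow e (r + X t) (Or.inl hv0.ne')) (hdr.add hX)
  have hdp := ((hda.mul hde).mul (hY.pow c)).ofReal_comp
  refine ((hdexp.mul hdM).mul hdp).congr_deriv ?_
  simp only [hankelTerm, ← hr, Pi.mul_apply, Pi.pow_apply]
  have ha2 : r ^ (a - 2) = r ^ a * r⁻¹ * r⁻¹ := by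
    rw [show a - 2 = a - 1 - 1 by ring, zpow_sub_one₀ hr0.ne', zpow_sub_one₀ hr0.ne']
  simp only [ha2, zpow_sub_one₀ hr0.ne', zpow_sub_one₀ hv0.ne', zpow_add_one₀ hv0.ne']
  generalize hankelMoment n (k * r) = M0
  generalize hankelMoment (n + 1) (k * r) = M1
  generalize Complex.exp (Complex.I * (k * (r - X t) : ℝ)) = E0
  generalize r ^ a = ra
  generalize (r + X t) ^ e = ve
  simp only [Complex.real_smul]
  have hrC : (r : ℂ) ≠ 0 := by exact_mod_cast hr0.ne'
  have hvC : (r : ℂ) + X t ≠ 0 := by exact_mod_cast hv0.ne'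
  have hr2C : (r : ℂ) ^ 2 = (X t : ℂ) ^ 2 + (Y t : ℂ) ^ 2 := by exact_mod_cast hr2
  push_cast
  generalize (Y t : ℂ) ^ (c - 1) = yc
  rw [pow_add, pow_add, pow_one]
  generalize (Y t : ℂ) ^ c = Yc
  field_simp
  -- The relation `r² = X² + Y²` is needed only for the `X`-derivative of the phase.
  linear_combination (-(E0 * ra * ve * k * r * X' * Complex.I * M0 * Yc)) * hr2C

/-- The weight `2(n - a - e) - c` charges one unit for each factor `Y`, although `Y` is bounded, so
that differentiating `Y^c` pays the unit back. -/
theorem HankelSymbol.hasPartials {k : ℝ} (hk : 0 < k) {J : ℤ} {Φ : ℝ → ℝ → ℂ}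
    (h : HankelSymbol k J Φ) : ∃ ΦY ΦX, HankelSymbol k (J + 1) ΦY ∧ HankelSymbol k (J + 2) ΦX ∧
      HasPartialsPos Φ ΦY ΦX := by
  induction h with
  | term n a e c J h =>
    refine ⟨_, _, ?_, ?_, hasPartialsPos_hankelTerm hk n a e c⟩
    · refine ((((HankelSymbol.smul _ _ _ (.term _ _ _ _ _ ?_)).add _ _ _
        (.smul _ _ _ (.term _ _ _ _ _ ?_))).add _ _ _ (.smul _ _ _ (.term _ _ _ _ _ ?_))).add _ _ _
        (.smul _ _ _ (.term _ _ _ _ _ ?_))).add _ _ _ ?_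
      · push_cast; linarith
      · push_cast; linarith
      · push_cast; linarith
      · push_cast; linarith
      -- For `c = 0` the truncated exponent `c - 1` would not give the required weight, but the
      -- coefficient is zero.
      · rcases c with _ | c
        · simpa using HankelSymbol.zero (J + 1)
        · refine .smul _ _ _ (.term _ _ _ _ _ ?_)
          push_cast at h ⊢
          linarith
    · refine (((((HankelSymbol.smul _ _ _ (.term _ _ _ _ _ ?_)).add _ _ _
        (.smul _ _ _ (.term _ _ _ _ _ ?_))).add _ _ _ (.smul _ _ _ (.term _ _ _ _ _ ?_))).add _ _ _
        (.smul _ _ _ (.term _ _ _ _ _ ?_))).add _ _ _ (.smul _ _ _ (.term _ _ _ _ _ ?_))).add _ _ _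
        (.smul _ _ _ (.term _ _ _ _ _ ?_)) <;> push_cast <;> linarith
  | zero J =>
    refine ⟨_, _, .zero _, .zero _, fun Y X Y' X' t _ _ _ => ?_⟩
    simpa using hasDerivAt_const t (0 : ℂ)
  | add J Φ Ψ hΦ hΨ ih ih' =>
    obtain ⟨ΦY, ΦX, h1, h2, h3⟩ := ih
    obtain ⟨ΨY, ΨX, h1', h2', h3'⟩ := ih'
    refine ⟨_, _, h1.add _ _ _ h1', h2.add _ _ _ h2', fun Y X Y' X' t hY hX h0 => ?_⟩
    refine ((h3 Y X Y' X' t hY hX h0).add (h3' Y X Y' X' t hY hX h0)).congr_deriv ?_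
    ring
  | smul J z Φ hΦ ih =>
    obtain ⟨ΦY, ΦX, h1, h2, h3⟩ := ih
    refine ⟨_, _, h1.smul _ z _, h2.smul _ z _, fun Y X Y' X' t hY hX h0 => ?_⟩
    refine ((h3 Y X Y' X' t hY hX h0).const_mul z).congr_deriv ?_
    ring

theorem HankelSymbol.symbolFamily {k : ℝ} (hk : 0 < k) {X₀ : ℝ} (hX₀ : 1 ≤ X₀) (n : ℕ) {J : ℕ}
    {Φ : ℝ → ℝ → ℂ} (h : HankelSymbol k J Φ) :
    SymbolFamily (1 / 2) X₀ n J fun _ : Unit => Φ := by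
  induction n generalizing J Φ with
  | zero => exact h.bound hk hX₀ J rfl
  | succ n ih =>
    obtain ⟨ΦY, ΦX, h1, h2, h3⟩ := h.hasPartials hk
    exact ⟨h.bound hk hX₀ J rfl, _, _, fun _ Y X Y' X' t hY hX h0 =>
      h3 Y X Y' X' t hY hX (by linarith), ih (by exact_mod_cast h1), ih (by exact_mod_cast h2)⟩

/-! ### Symbols of the two partial derivatives -/

/-- The symbol of `∂_r G / r`: the factor `greenRadial` without the oscillation `e^{i k X}`. -/
def radialSymbol (k Y X : ℝ) : ℂ :=
  Complex.exp (-(Complex.I * (k * X : ℝ))) * greenRadial k X Y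

theorem greenRadial_eq_radialSymbol (k X Y : ℝ) :
    greenRadial k X Y = Complex.exp (Complex.I * (k * X : ℝ)) * radialSymbol k Y X := by
  rw [radialSymbol, ← mul_assoc, ← Complex.exp_add, add_neg_cancel, Complex.exp_zero, one_mul]

theorem radialSymbol_eq (k Y X : ℝ) :
    radialSymbol k Y X = Complex.I / 4 * k * hankelConst *
      (Complex.I * hankelTerm k 0 (-1) 0 0 Y X - hankelTerm k 1 (-1) 0 0 Y X) := by
  simp only [radialSymbol, greenRadial, hankelDeriv, hankelTerm, zpow_neg_one, zpow_zero, pow_zero,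
    mul_one]
  set r := Real.sqrt (X ^ 2 + Y ^ 2)
  have e : Complex.exp (Complex.I * (k * (r - X) : ℝ)) =
      Complex.exp (-(Complex.I * (k * X : ℝ))) * Complex.exp (Complex.I * (k * r : ℝ)) := by
    rw [← Complex.exp_add]
    congr 1
    push_cast
    ring
  rw [e]
  push_cast
  ring

theorem hankelTerm_mul_Y (k : ℝ) (n : ℕ) (a e : ℤ) (c : ℕ) (Y X : ℝ) :
    Y * hankelTerm k n a e c Y X = hankelTerm k n a e (c + 1) Y X := by
  simp only [hankelTerm]
  push_cast
  ring

/-- Writing `X = (r + X) - r` keeps factors of `X` inside the class. -/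
theorem hankelTerm_mul_X (k : ℝ) (n : ℕ) (a e : ℤ) (c : ℕ) (Y : ℝ) {X : ℝ} (hX : 0 < X) :
    X * hankelTerm k n a e c Y X =
      hankelTerm k n a (e + 1) c Y X + -1 * hankelTerm k n (a + 1) e c Y X := by
  have hr : 0 < Real.sqrt (X ^ 2 + Y ^ 2) := Real.sqrt_pos.2 (by positivity)
  simp only [hankelTerm]
  rw [zpow_add_one₀ hr.ne', zpow_add_one₀ (by positivity)]
  push_cast
  ring

/-- The symbols of the two partial derivatives of the Green function. -/
def partialSymbolX (k Y X : ℝ) : ℂ := Complex.I / 4 * k * hankelConst *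
  (Complex.I * (hankelTerm k 0 (-1) 1 0 Y X + -1 * hankelTerm k 0 0 0 0 Y X) +
    -1 * (hankelTerm k 1 (-1) 1 0 Y X + -1 * hankelTerm k 1 0 0 0 Y X))

def partialSymbolY (k Y X : ℝ) : ℂ := Complex.I / 4 * k * hankelConst *
  (Complex.I * hankelTerm k 0 (-1) 0 1 Y X + -1 * hankelTerm k 1 (-1) 0 1 Y X)

theorem mul_radialSymbol_eq_X (k Y : ℝ) {X : ℝ} (hX : 0 < X) :
    X * radialSymbol k Y X = partialSymbolX k Y X := by
  rw [radialSymbol_eq, partialSymbolX]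
  have h0 := hankelTerm_mul_X k 0 (-1) 0 0 Y hX
  have h1 := hankelTerm_mul_X k 1 (-1) 0 0 Y hX
  norm_num at h0 h1
  linear_combination (Complex.I / 4 * k * hankelConst * Complex.I) * h0 -
    (Complex.I / 4 * k * hankelConst) * h1

theorem mul_radialSymbol_eq_Y (k Y X : ℝ) : Y * radialSymbol k Y X = partialSymbolY k Y X := by
  rw [radialSymbol_eq, partialSymbolY]
  have h0 := hankelTerm_mul_Y k 0 (-1) 0 0 Y X
  have h1 := hankelTerm_mul_Y k 1 (-1) 0 0 Y X
  norm_num at h0 h1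
  linear_combination (Complex.I / 4 * k * hankelConst * Complex.I) * h0 -
    (Complex.I / 4 * k * hankelConst) * h1

theorem symbolFamily_partialSymbolX {k : ℝ} (hk : 0 < k) {X₀ : ℝ} (hX₀ : 1 ≤ X₀) (n : ℕ) :
    SymbolFamily (1 / 2) X₀ n 0 fun _ : Unit => partialSymbolX k := by
  refine HankelSymbol.symbolFamily hk hX₀ n ?_
  refine .smul _ _ _ (.add _ _ _ (.smul _ _ _ (.add _ _ _ (.term _ _ _ _ _ ?_)
    (.smul _ _ _ (.term _ _ _ _ _ ?_)))) (.smul _ _ _ (.add _ _ _ (.term _ _ _ _ _ ?_)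
    (.smul _ _ _ (.term _ _ _ _ _ ?_))))) <;> norm_num

theorem symbolFamily_partialSymbolY {k : ℝ} (hk : 0 < k) {X₀ : ℝ} (hX₀ : 1 ≤ X₀) (n : ℕ) :
    SymbolFamily (1 / 2) X₀ n 0 fun _ : Unit => partialSymbolY k := by
  refine HankelSymbol.symbolFamily hk hX₀ n ?_
  refine .smul _ _ _ (.add _ _ _ (.smul _ _ _ (.term _ _ _ _ _ ?_))
    (.smul _ _ _ (.term _ _ _ _ _ ?_))) <;> norm_num

/-! ### Smooth quasi-periodic functions -/

/-- Smooth functions with `p (t + d) = ζ p t`. -/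
def SmoothQuasiPeriodic (d : ℝ) (ζ : ℂ) (p : ℝ → ℂ) : Prop :=
  ContDiff ℝ ∞ p ∧ ∀ t, p (t + d) = ζ * p t

namespace SmoothQuasiPeriodic

variable {d : ℝ} {ζ ζ' : ℂ} {p q : ℝ → ℂ}

theorem bounded (h : SmoothQuasiPeriodic d ζ p) (hd : 0 < d) (hζ : ‖ζ‖ = 1) :
    ∃ C, 0 ≤ C ∧ ∀ t, ‖p t‖ ≤ C := by
  have hper : Function.Periodic (fun t => ‖p t‖) d := fun t => by
    simp only
    rw [h.2, norm_mul, hζ, one_mul]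
  obtain ⟨C, hC⟩ := (hper.isBounded_of_continuous hd.ne' h.1.continuous.norm).exists_norm_le
  refine ⟨C, (norm_nonneg _).trans (hC _ ⟨0, rfl⟩), fun t => ?_⟩
  simpa using hC _ ⟨t, rfl⟩

theorem deriv (h : SmoothQuasiPeriodic d ζ p) : SmoothQuasiPeriodic d ζ (deriv p) := by
  refine ⟨(contDiff_infty_iff_deriv.1 h.1).2, fun t => ?_⟩
  rw [← deriv_comp_add_const, funext h.2, deriv_const_mul_field]

theorem add (h : SmoothQuasiPeriodic d ζ p) (h' : SmoothQuasiPeriodic d ζ q) :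
    SmoothQuasiPeriodic d ζ fun t => p t + q t :=
  ⟨h.1.add h'.1, fun t => by simp only [h.2, h'.2, mul_add]⟩

theorem mul (h : SmoothQuasiPeriodic d ζ p) (h' : SmoothQuasiPeriodic d ζ' q) :
    SmoothQuasiPeriodic d (ζ * ζ') fun t => p t * q t :=
  ⟨h.1.mul h'.1, fun t => by simp only [h.2, h'.2]; ring⟩

theorem const_mul (c : ℂ) (h : SmoothQuasiPeriodic d ζ p) :
    SmoothQuasiPeriodic d ζ fun t => c * p t :=
  ⟨contDiff_const.mul h.1, fun t => by simp only [h.2]; ring⟩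

end SmoothQuasiPeriodic

/-! ### Oscillatory families -/

/-- The bound `|V x t| ≤ C X^{-w}` for `X = ε (t - x) > X₀`, together with the same bounds of `n`
derivatives in `t`. -/
def TameFamily (ε X₀ w : ℝ) : ℕ → (ℝ → ℝ → ℂ) → Prop
  | 0, V => ∃ C, ∀ x t, X₀ < ε * (t - x) → ‖V x t‖ ≤ C * (ε * (t - x)) ^ (-w)
  | n + 1, V => (∃ C, ∀ x t, X₀ < ε * (t - x) → ‖V x t‖ ≤ C * (ε * (t - x)) ^ (-w)) ∧
      ∃ V' : ℝ → ℝ → ℂ, (∀ x t, X₀ < ε * (t - x) → HasDerivAt (V x) (V' x t) t) ∧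
        TameFamily ε X₀ w n V'

theorem TameFamily.add {ε X₀ w : ℝ} {n : ℕ} {V W : ℝ → ℝ → ℂ} (h : TameFamily ε X₀ w n V)
    (h' : TameFamily ε X₀ w n W) : TameFamily ε X₀ w n fun x t => V x t + W x t := by
  have hb : ∀ {V W : ℝ → ℝ → ℂ},
      (∃ C, ∀ x t, X₀ < ε * (t - x) → ‖V x t‖ ≤ C * (ε * (t - x)) ^ (-w)) →
      (∃ C, ∀ x t, X₀ < ε * (t - x) → ‖W x t‖ ≤ C * (ε * (t - x)) ^ (-w)) →
      ∃ C, ∀ x t, X₀ < ε * (t - x) → ‖V x t + W x t‖ ≤ C * (ε * (t - x)) ^ (-w) := by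
    rintro V W ⟨C, hC⟩ ⟨C', hC'⟩
    refine ⟨C + C', fun x t hx => ?_⟩
    rw [add_mul]
    exact (norm_add_le _ _).trans (add_le_add (hC x t hx) (hC' x t hx))
  induction n generalizing V W with
  | zero => exact hb h h'
  | succ n ih =>
    obtain ⟨h1, V', h2, h3⟩ := h
    obtain ⟨h1', W', h2', h3'⟩ := h'
    exact ⟨hb h1 h1', _, fun x t hx => (h2 x t hx).add (h2' x t hx), ih h3 h3'⟩

theorem TameFamily.congr {ε X₀ w : ℝ} {n : ℕ} {V W : ℝ → ℝ → ℂ} (h : TameFamily ε X₀ w n V)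
    (e : ∀ x t, X₀ < ε * (t - x) → W x t = V x t) : TameFamily ε X₀ w n W := by
  cases n with
  | zero =>
    obtain ⟨C, hC⟩ := h
    exact ⟨C, fun x t hx => e x t hx ▸ hC x t hx⟩
  | succ n =>
    obtain ⟨⟨C, hC⟩, V', h2, h3⟩ := h
    refine ⟨⟨C, fun x t hx => e x t hx ▸ hC x t hx⟩, V', fun x t hx => ?_, h3⟩
    refine (h2 x t hx).congr_of_eventuallyEq ?_
    have ho : IsOpen {s : ℝ | X₀ < ε * (s - x)} := isOpen_lt continuous_const (by fun_prop)
    filter_upwards [ho.mem_nhds hx] with s hs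
    exact e x s hs

/-- Products of an oscillating exponential, a quasi-periodic function and a symbol. -/
def oscTerm {ι : Type} (ε k : ℝ) (f : ℝ → ℝ) (p : ℝ → ℂ) (Φ : ι → ℝ → ℝ → ℂ) (i : ι)
    (x t : ℝ) : ℂ :=
  Complex.exp (Complex.I * (k * (ε * (t - x)) : ℝ)) * (p t * Φ i (f x - f t) (ε * (t - x)))

theorem norm_oscTerm_le {ι : Type} {ε k d σ X₀ w : ℝ} {ζ : ℂ} {f : ℝ → ℝ} {p : ℝ → ℂ}
    (hd : 0 < d) (hζ : ‖ζ‖ = 1) (hp : SmoothQuasiPeriodic d ζ p) (hX₀ : 1 ≤ X₀) {B : ℝ}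
    (hB : ∀ x t, |f x - f t| ≤ B) {J : ℕ} {Φ : ι → ℝ → ℝ → ℂ} (hΦ : SymbolBound σ X₀ J Φ)
    (hw : w ≤ σ + ((J + 1) / 2 : ℕ)) :
    ∃ C, 0 ≤ C ∧ ∀ i x t, X₀ ≤ ε * (t - x) →
      ‖oscTerm ε k f p Φ i x t‖ ≤ C * (ε * (t - x)) ^ (-w) := by
  obtain ⟨P, hP, hPb⟩ := hp.bounded hd hζ
  obtain ⟨C, hC, hb⟩ := hΦ B
  refine ⟨P * C, by positivity, fun i x t hX => ?_⟩
  have h1 : ‖Complex.exp (Complex.I * (k * (ε * (t - x)) : ℝ))‖ = 1 := by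
    rw [mul_comm, Complex.norm_exp_ofReal_mul_I]
  rw [oscTerm, norm_mul, norm_mul, h1, one_mul, mul_assoc]
  refine mul_le_mul (hPb t) ((hb i _ _ (hB x t) hX).trans ?_) (norm_nonneg _) hP
  exact mul_le_mul_of_nonneg_left
    (Real.rpow_le_rpow_of_exponent_le (hX₀.trans hX) (by linarith)) hC

/-- A `t`-derivative falls on the oscillation and on `p`, which only changes `p`, or on `Φ`, which
only raises the weight. Hence all derivatives decay at the same rate `w`; no gain is sought. -/
theorem tameFamily_oscTerm {ε k d σ X₀ w : ℝ} {ζ : ℂ} {f : ℝ → ℝ} {p : ℝ → ℂ}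
    (hd : 0 < d) (hζ : ‖ζ‖ = 1) (hp : SmoothQuasiPeriodic d ζ p) (hX₀ : 1 ≤ X₀)
    (hf : ContDiff ℝ ∞ f) (hfper : ∀ x, f (x + d) = f x) {B : ℝ} (hB : ∀ x t, |f x - f t| ≤ B)
    {n J : ℕ} {Φ : Unit → ℝ → ℝ → ℂ} (hΦ : SymbolFamily σ X₀ n J Φ)
    (hw : w ≤ σ + ((J + 1) / 2 : ℕ)) :
    TameFamily ε X₀ w n (oscTerm ε k f p Φ ()) := by
  have hbd : ∀ {J : ℕ} {Φ : Unit → ℝ → ℝ → ℂ}, SymbolBound σ X₀ J Φ →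
      w ≤ σ + ((J + 1) / 2 : ℕ) → ∀ {p : ℝ → ℂ}, SmoothQuasiPeriodic d ζ p →
      ∃ C, ∀ x t, X₀ < ε * (t - x) →
        ‖oscTerm ε k f p Φ () x t‖ ≤ C * (ε * (t - x)) ^ (-w) := by
    intro J Φ h hw p hp
    obtain ⟨C, -, hC⟩ := norm_oscTerm_le (ε := ε) (k := k) hd hζ hp hX₀ hB h hw
    exact ⟨C, fun x t hX => hC () x t hX.le⟩
  have hf' : SmoothQuasiPeriodic d 1 (fun t => ((-deriv f t : ℝ) : ℂ)) := by
    refine ⟨Complex.ofRealCLM.contDiff.comp (contDiff_deriv_of_contDiff hf).neg, fun t => ?_⟩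
    beta_reduce
    rw [← deriv_comp_add_const, funext hfper, one_mul]
  induction n generalizing J Φ p with
  | zero => exact hbd hΦ hw hp
  | succ n ih =>
    have hΦ0 := hΦ.pred
    obtain ⟨hb, ΦY, ΦX, hpart, hY, hX⟩ := hΦ
    have t1 := ih (p := fun t => (Complex.I * k * ε) * p t + deriv p t)
      ((hp.const_mul _).add hp.deriv) hΦ0 hw
    have t2 := ih (p := fun t => p t * ((-deriv f t : ℝ) : ℂ)) (by simpa using hp.mul hf') hY
      (hw.trans (by gcongr; omega))
    have t3 := ih (p := fun t => (ε : ℂ) * p t) (hp.const_mul _) hX (hw.trans (by gcongr; omega))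
    refine ⟨hbd hb hw hp, _, fun x t hx => ?_, (t1.add t2).add t3⟩
    have hXd : HasDerivAt (fun s : ℝ => ε * (s - x)) ε t := by
      simpa using ((hasDerivAt_id t).sub_const x).const_mul ε
    have hYd : HasDerivAt (fun s => f x - f s) (-deriv f t) t :=
      ((hf.differentiable (by simp) t).hasDerivAt).const_sub (f x)
    have hpd : HasDerivAt p (deriv p t) t := (hp.1.differentiable (by simp) t).hasDerivAt
    have he : HasDerivAt (fun s : ℝ => Complex.exp (Complex.I * (k * (ε * (s - x)) : ℝ)))
        ((k * ε : ℝ) • (Complex.I * Complex.exp (Complex.I * (k * (ε * (t - x)) : ℝ)))) t :=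
      HasDerivAt.scomp (g₁ := fun u : ℝ => Complex.exp (Complex.I * u)) t
        (hasDerivAt_cexp_I_mul (k * (ε * (t - x)))) (hXd.const_mul k)
    refine (he.mul (hpd.mul (hpart () _ _ _ _ t hYd hXd hx.le))).congr_deriv ?_
    simp only [oscTerm, Complex.real_smul, Pi.mul_apply]
    push_cast
    ring

/-- Smooth families that are tame in both directions decay together with their derivatives. -/
theorem decayFamily_of_tame {I : Set ℝ} (hI : IsCompact I) {X₀ w : ℝ} (hX₀ : 1 ≤ X₀)
    (hw : 0 ≤ w) (n : ℕ) {H : ℝ → ℝ → ℂ} (hH : ContDiff ℝ ∞ fun q : ℝ × ℝ => H q.1 q.2)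
    (h1 : TameFamily 1 X₀ w n H) (h2 : TameFamily (-1) X₀ w n H) : DecayFamily I w n H := by
  have hbd : ∀ {H : ℝ → ℝ → ℂ}, (ContDiff ℝ ∞ fun q : ℝ × ℝ => H q.1 q.2) →
      (∃ C, ∀ x t, X₀ < 1 * (t - x) → ‖H x t‖ ≤ C * (1 * (t - x)) ^ (-w)) →
      (∃ C, ∀ x t, X₀ < -1 * (t - x) → ‖H x t‖ ≤ C * (-1 * (t - x)) ^ (-w)) →
      (∃ C, ∀ x ∈ I, ∀ t, ‖H x t‖ ≤ C * (1 + |t - x|) ^ (-w)) ∧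
        ∀ x ∈ I, Continuous (H x) := by
    rintro H hH ⟨C1, hC1⟩ ⟨C2, hC2⟩
    have hcont : ∀ x, Continuous (H x) := fun x =>
      hH.continuous.comp (Continuous.prodMk_right x)
    refine ⟨?_, fun x _ => hcont x⟩
    -- The strip `|t - x| ≤ X₀` over the compact `I`, where continuity alone gives a bound.
    have hK : IsCompact ((fun q : ℝ × ℝ => ((q.1, q.1 + q.2) : ℝ × ℝ)) ''
        (I ×ˢ Set.Icc (-X₀) X₀)) := (hI.prod isCompact_Icc).image (by fun_prop)
    obtain ⟨C0, hC0⟩ := hK.exists_bound_of_continuousOn hH.continuous.continuousOn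
    have hfar : ∀ s, X₀ < s → ∀ C, C * s ^ (-w) ≤ |C| * (2 : ℝ) ^ w * (1 + s) ^ (-w) := by
      intro s hs C
      have hs0 : 0 < s := by linarith
      have : s ^ (-w) ≤ (2 : ℝ) ^ w * (1 + s) ^ (-w) := by
        rw [Real.rpow_neg hs0.le, Real.rpow_neg (by positivity), ← div_eq_mul_inv, inv_eq_one_div,
          div_le_div_iff₀ (by positivity) (by positivity), one_mul,
          ← Real.mul_rpow (by positivity) (by positivity)]
        exact Real.rpow_le_rpow (by positivity) (by linarith) hw
      calc C * s ^ (-w) ≤ |C| * s ^ (-w) :=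
            mul_le_mul_of_nonneg_right (le_abs_self C) (by positivity)
        _ ≤ |C| * ((2 : ℝ) ^ w * (1 + s) ^ (-w)) :=
            mul_le_mul_of_nonneg_left this (abs_nonneg C)
        _ = _ := by ring
    refine ⟨|C0| * (1 + X₀) ^ w + |C1| * (2 : ℝ) ^ w + |C2| * (2 : ℝ) ^ w, fun x hx t => ?_⟩
    have hpos : 0 < (1 + |t - x|) ^ (-w) := by positivity
    rcases le_or_gt |t - x| X₀ with hle | hgt
    · have hn := hC0 (x, t) ⟨(x, t - x), ⟨hx, abs_le.1 hle⟩, by simp⟩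
      have h3 : 1 ≤ (1 + X₀) ^ w * (1 + |t - x|) ^ (-w) := by
        rw [Real.rpow_neg (by positivity), ← div_eq_mul_inv, one_le_div (by positivity)]
        exact Real.rpow_le_rpow (by positivity) (by linarith) hw
      calc ‖H x t‖ ≤ |C0| * 1 := by rw [mul_one]; exact hn.trans (le_abs_self _)
        _ ≤ |C0| * ((1 + X₀) ^ w * (1 + |t - x|) ^ (-w)) := by gcongr
        _ ≤ _ := by
            have : 0 ≤ (|C1| * (2 : ℝ) ^ w + |C2| * (2 : ℝ) ^ w) * (1 + |t - x|) ^ (-w) := by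
              positivity
            linarith
    · rcases le_total 0 (t - x) with hs | hs
      · rw [abs_of_nonneg hs] at hgt hpos ⊢
        have h3 := hC1 x t (by linarith)
        rw [one_mul] at h3
        refine (h3.trans (hfar _ hgt C1)).trans ?_
        gcongr
        have : 0 ≤ |C0| * (1 + X₀) ^ w + |C2| * (2 : ℝ) ^ w := by positivity
        linarith
      · rw [abs_of_nonpos hs] at hgt hpos ⊢
        have h3 := hC2 x t (by linarith)
        rw [neg_one_mul] at h3
        refine (h3.trans (hfar _ hgt C2)).trans ?_
        gcongr
        have : 0 ≤ |C0| * (1 + X₀) ^ w + |C1| * (2 : ℝ) ^ w := by positivity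
        linarith
  induction n generalizing H with
  | zero => exact hbd hH h1 h2
  | succ n ih =>
    obtain ⟨hb1, V1, hV1, ht1⟩ := h1
    obtain ⟨hb2, V2, hV2, ht2⟩ := h2
    -- Joint smoothness provides one derivative for all `t`, again jointly smooth; uniqueness
    -- identifies it with the tame derivatives far out on each side.
    have hd : ∀ x t, HasDerivAt (H x) (fderiv ℝ (fun q : ℝ × ℝ => H q.1 q.2) (x, t) (0, 1)) t := by
      intro x t
      have hF := (hH.differentiable (by simp) (x, t)).hasFDerivAt
      exact hF.comp_hasDerivAt t ((hasDerivAt_const t x).prodMk (hasDerivAt_id t))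
    refine ⟨hbd hH hb1 hb2, _, fun x _ t => hd x t, ih ?_ ?_ ?_⟩
    · exact (hH.fderiv_right (m := ∞) (by simp)).clm_apply contDiff_const
    · exact ht1.congr fun x t hx => (hd x t).unique (hV1 x t hx)
    · exact ht2.congr fun x t hx => (hd x t).unique (hV2 x t hx)

/-! ### Twisted differences -/

/-- The twisted difference `V(t) - z V(t - s)`. -/
def twist (z : ℂ) (s : ℝ) (V : ℝ → ℂ) (t : ℝ) : ℂ := V t - z * V (t - s)

/-- Moving `t` by `-εd` fixes `Y`, lowers `X` by `d`, and multiplies the oscillating factors by a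
phase that `z` undoes. Only the difference of the symbol in `X` remains. -/
theorem twist_oscTerm {ι : Type} {ε k d : ℝ} {z : ℂ} {f : ℝ → ℝ} {p : ℝ → ℂ}
    (hε : ε = 1 ∨ ε = -1) (hfper : ∀ x, f (x + d) = f x)
    (hz : ∀ t, p t = z * Complex.exp (-(Complex.I * (k * d : ℝ))) * p (t - ε * d))
    (Φ : ι → ℝ → ℝ → ℂ) (i : ι) (x t : ℝ) :
    twist z (ε * d) (oscTerm ε k f p Φ i x) t = oscTerm ε k f p (backDiff d Φ) i x t := by
  have hf : f (t - ε * d) = f t := by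
    rcases hε with rfl | rfl
    · rw [one_mul, ← hfper (t - d), sub_add_cancel]
    · rw [neg_one_mul, sub_neg_eq_add, hfper]
  have hX : ε * (t - ε * d - x) = ε * (t - x) - d := by
    rcases hε with rfl | rfl <;> ring
  have he : Complex.exp (Complex.I * (k * (ε * (t - x) - d) : ℝ)) =
      Complex.exp (Complex.I * (k * (ε * (t - x)) : ℝ)) *
        Complex.exp (-(Complex.I * (k * d : ℝ))) := by
    rw [← Complex.exp_add]
    congr 1
    push_cast
    ring
  simp only [twist, oscTerm, backDiff, hf, hX, he]
  linear_combination (Complex.exp (Complex.I * (k * (ε * (t - x)) : ℝ)) *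
    Φ i (f x - f t) (ε * (t - x) - d)) * hz t

theorem twist_iterate_eq_oscTerm {ι : Type} {ε k d X₀ : ℝ} {z : ℂ} {f : ℝ → ℝ} {p q : ℝ → ℂ}
    (hε : ε = 1 ∨ ε = -1) (hd : 0 < d) (hfper : ∀ x, f (x + d) = f x)
    (hzp : ∀ t, p t = z * Complex.exp (-(Complex.I * (k * d : ℝ))) * p (t - ε * d))
    (hzq : ∀ t, q t = z * Complex.exp (-(Complex.I * (k * d : ℝ))) * q (t - ε * d))
    {Φ Ψ : ι → ℝ → ℝ → ℂ} {i : ι} {x : ℝ} {V : ℝ → ℂ}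
    (hV : ∀ t, X₀ ≤ ε * (t - x) → V t = oscTerm ε k f p Φ i x t + oscTerm ε k f q Ψ i x t)
    (Q : ℕ) (t : ℝ) (ht : X₀ + Q * d ≤ ε * (t - x)) :
    (twist z (ε * d))^[Q] V t = oscTerm ε k f p ((backDiff d)^[Q] Φ) i x t +
      oscTerm ε k f q ((backDiff d)^[Q] Ψ) i x t := by
  induction Q generalizing t with
  | zero => exact hV t (by simpa using ht)
  | succ Q ih =>
    have hX : ε * (t - ε * d - x) = ε * (t - x) - d := by
      rcases hε with rfl | rfl <;> ring
    push_cast at ht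
    have h1 := ih t (by linarith)
    have h2 := ih (t - ε * d) (by rw [hX]; linarith)
    rw [Function.iterate_succ_apply', Function.iterate_succ_apply', Function.iterate_succ_apply',
      ← twist_oscTerm hε hfper hzp, ← twist_oscTerm hε hfper hzq]
    simp only [twist] at h1 h2 ⊢
    rw [h1, h2]
    ring

theorem twist_iterate_eq_zero {ε d X₁ : ℝ} {z : ℂ} (hε : ε = 1 ∨ ε = -1) (hd : 0 < d)
    {x : ℝ} {V : ℝ → ℂ} (hV : ∀ t, ε * (t - x) ≤ X₁ → V t = 0) (Q : ℕ) (t : ℝ)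
    (ht : ε * (t - x) ≤ X₁) : (twist z (ε * d))^[Q] V t = 0 := by
  induction Q generalizing t with
  | zero => exact hV t ht
  | succ Q ih =>
    have hX : ε * (t - ε * d - x) = ε * (t - x) - d := by
      rcases hε with rfl | rfl <;> ring
    rw [Function.iterate_succ_apply', twist, ih t ht, ih _ (by rw [hX]; linarith)]
    simp

theorem tendsto_twist {z : ℂ} {s : ℝ} {V : ℝ → ℂ} (ht : Tendsto V atTop (𝓝 0))
    (hb : Tendsto V atBot (𝓝 0)) :
    Tendsto (twist z s V) atTop (𝓝 0) ∧ Tendsto (twist z s V) atBot (𝓝 0) := by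
  constructor
  · change Tendsto (fun t => V t - z * V (t - s)) _ _
    have := ht.sub ((ht.comp (tendsto_atTop_add_const_right atTop (-s) tendsto_id)).const_mul z)
    simpa [Function.comp_def, sub_eq_add_neg] using this
  · change Tendsto (fun t => V t - z * V (t - s)) _ _
    have := hb.sub ((hb.comp (tendsto_atBot_add_const_right atBot (-s) tendsto_id)).const_mul z)
    simpa [Function.comp_def, sub_eq_add_neg] using this

/-- Summation by parts: a conditionally convergent sum is determined by the sum of the iterated
twisted differences. -/
theorem hasSum_of_hasSum_twist {ε d : ℝ} {z : ℂ} (hε : ε = 1 ∨ ε = -1) (hz : z ≠ 1) (N : ℕ+)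
    (Q : ℕ) {V : ℝ → ℂ} (ht : Tendsto V atTop (𝓝 0)) (hb : Tendsto V atBot (𝓝 0))
    (hd : 0 < d) {s : ℂ}
    (h : HasSum (fun l : ℤ => (meshSize d N : ℂ) * (twist z (ε * d))^[Q] V (l * meshSize d N)) s
      (SummationFilter.conditional ℤ)) :
    HasSum (fun l : ℤ => (meshSize d N : ℂ) * V (l * meshSize d N)) (((1 - z)⁻¹) ^ Q * s)
      (SummationFilter.conditional ℤ) := by
  have hN : (0 : ℝ) < (N : ℕ) := by exact_mod_cast N.pos
  have hδ : 0 < meshSize d N := div_pos hd hN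
  have hNδ : (N : ℕ) * meshSize d N = d := by
    rw [meshSize]
    field_simp
  have step : ∀ (V : ℝ → ℂ), Tendsto V atTop (𝓝 0) → Tendsto V atBot (𝓝 0) → ∀ s : ℂ,
      HasSum (fun l : ℤ => (meshSize d N : ℂ) * twist z (ε * d) V (l * meshSize d N)) s
        (SummationFilter.conditional ℤ) →
      HasSum (fun l : ℤ => (meshSize d N : ℂ) * V (l * meshSize d N)) ((1 - z)⁻¹ * s)
        (SummationFilter.conditional ℤ) := by
    intro V ht hb s h
    have hcast : Tendsto (fun l : ℤ => (l : ℝ) * meshSize d N) atTop atTop :=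
      tendsto_intCast_atTop_atTop.atTop_mul_const hδ
    have hcast' : Tendsto (fun l : ℤ => (l : ℝ) * meshSize d N) atBot atBot :=
      (tendsto_intCast_atBot_iff.2 tendsto_id).atBot_mul_const hδ
    have hU1 : Tendsto (fun l : ℤ => (meshSize d N : ℂ) * V (l * meshSize d N)) atTop (𝓝 0) := by
      simpa using (ht.comp hcast).const_mul (meshSize d N : ℂ)
    have hU2 : Tendsto (fun l : ℤ => (meshSize d N : ℂ) * V (l * meshSize d N)) atBot (𝓝 0) := by
      simpa using (hb.comp hcast').const_mul (meshSize d N : ℂ)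
    -- A period is `N` mesh steps, so the twist acts on the mesh as an index shift.
    obtain ⟨p, hp⟩ : ∃ p : ℤ, (p : ℝ) * meshSize d N = ε * d := by
      rcases hε with rfl | rfl
      · exact ⟨(N : ℕ), by rw [Int.cast_natCast, hNδ, one_mul]⟩
      · exact ⟨-(N : ℕ), by rw [Int.cast_neg, Int.cast_natCast, neg_mul, hNδ, neg_one_mul]⟩
    -- With `V'` the shifted `V`: `(1 - z) V = (V - z V') - z (V - V')`, and the last bracket sums
    -- to zero.
    have h2 := (h.sub ((hasSum_conditional_sub_shift hU1 hU2 p).mul_left z)).mul_left ((1 - z)⁻¹)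
    rw [mul_zero, sub_zero] at h2
    refine (congrArg (fun F => HasSum F _ (SummationFilter.conditional ℤ))
      (funext fun l => ?_)).mp h2
    have hz' : 1 - z ≠ 0 := sub_ne_zero.2 hz.symm
    rw [twist, Int.cast_sub, sub_mul, hp]
    field_simp
    ring
  induction Q generalizing V s with
  | zero => simpa using h
  | succ Q ih =>
    rw [Function.iterate_succ] at h
    obtain ⟨h1, h2⟩ := tendsto_twist (z := z) (s := ε * d) ht hb
    have := step V ht hb _ (ih h1 h2 h)
    rwa [← mul_assoc, ← pow_succ'] at this

/-! ### The integrand away from the diagonal -/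

/-- The symbols in the representation of the integrand. -/
def kernelSymbolX (k h : ℝ) (j : ℕ) : Unit → ℝ → ℝ → ℂ :=
  shiftSum h j fun _ => partialSymbolX k

def kernelSymbolY (k h : ℝ) (j : ℕ) : Unit → ℝ → ℝ → ℂ :=
  shiftSum h j fun _ => partialSymbolY k

/-- The quasi-periodic factors in the representation of the integrand. -/
def densityX (ε : ℝ) (f : ℝ → ℝ) (μ : ℝ → ℂ) (t : ℝ) : ℂ := ((-ε * deriv f t : ℝ) : ℂ) * μ t

def densityY (μ : ℝ → ℂ) (t : ℝ) : ℂ := -1 * μ t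

/-- For `X ≥ a` the distance along the curve window is at least `a`, so that window is zero; the
radial factor is even in its first argument, so both sides share one symbol and only the sign of `x
- t` differs. -/
theorem regIntegrand_eq_oscTerm {f : ℝ → ℝ} {k h γ a ε : ℝ} (hk : 0 < k) (hγ : 0 < γ)
    (hγa : γ < a) (hε : ε = 1 ∨ ε = -1) (j : ℕ) (μ : ℝ → ℂ) (x t : ℝ)
    (hX : max 1 a ≤ ε * (t - x)) :
    regIntegrand f k h j γ a μ x t =
      oscTerm ε k f (densityX ε f μ) (kernelSymbolX k h j) () x t +
        oscTerm ε k f (densityY μ) (kernelSymbolY k h j) () x t := by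
  set X := ε * (t - x) with hXdef
  have hX1 : 1 ≤ X := (le_max_left _ _).trans hX
  have hXa : a ≤ X := (le_max_right _ _).trans hX
  have hX0 : 0 < X := by linarith
  have hsq : (x - t) ^ 2 = X ^ 2 := by
    rw [hXdef]
    rcases hε with rfl | rfl <;> ring
  have hxt : ((x : ℂ) - t) = -ε * X := by
    rw [hXdef]
    rcases hε with rfl | rfl <;> push_cast <;> ring
  have hw : curveWindow f γ a x t = 0 := by
    have hr : a ≤ Real.sqrt ((x - t) ^ 2 + (f x - f t) ^ 2) := by
      rw [hsq]
      exact Real.le_sqrt_of_sq_le (by nlinarith [sq_nonneg (f x - f t)])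
    rw [curveWindow, smoothWindow_eq hγa, abs_of_nonneg (Real.sqrt_nonneg _),
      windowProfile_of_one_le]
    rw [le_div_iff₀ (by linarith)]
    linarith
  rw [regIntegrand_eq hk hγ, hw]
  simp only [oscTerm, ← hXdef, kernelSymbolX, kernelSymbolY, shiftSum, Finset.mul_sum,
    Finset.sum_mul]
  rw [← Finset.sum_add_distrib]
  refine Finset.sum_congr rfl fun m _ => ?_
  have hg : greenRadial k (x - t) (f x - f t + m * h) = greenRadial k X (f x - f t + m * h) := by
    simp only [greenRadial, hsq]
  have h1 := mul_radialSymbol_eq_X k (f x - f t + m * h) hX0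
  have h2 := mul_radialSymbol_eq_Y k (f x - f t + m * h) X
  rw [hg, greenRadial_eq_radialSymbol, ← h1, ← h2, hxt, densityX, densityY]
  push_cast
  ring

theorem symbolFamily_kernelSymbolX {k : ℝ} (hk : 0 < k) (h : ℝ) (j : ℕ) {X₀ : ℝ} (hX₀ : 1 ≤ X₀)
    (n : ℕ) : SymbolFamily (1 / 2) X₀ n j (kernelSymbolX k h j) :=
  (SymbolFamily.shiftSum_gain h j (symbolFamily_partialSymbolX hk hX₀) n).congr_fst (zero_add j)

theorem symbolFamily_kernelSymbolY {k : ℝ} (hk : 0 < k) (h : ℝ) (j : ℕ) {X₀ : ℝ} (hX₀ : 1 ≤ X₀)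
    (n : ℕ) : SymbolFamily (1 / 2) X₀ n j (kernelSymbolY k h j) :=
  (SymbolFamily.shiftSum_gain h j (symbolFamily_partialSymbolY hk hX₀) n).congr_fst (zero_add j)

/-! ### Quasi-periodicity and the standing assumptions -/

/-- The phase factor of a quasi-periodic function. -/
def phase (α d : ℝ) : ℂ := Complex.exp (Complex.I * α * d)

theorem norm_phase (α d : ℝ) : ‖phase α d‖ = 1 := by
  rw [phase, show Complex.I * α * d = ((α * d : ℝ) : ℂ) * Complex.I by push_cast; ring,
    Complex.norm_exp_ofReal_mul_I]

/-- The standing assumptions on the curve and on the density. -/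
structure Admissible (d k α γ a : ℝ) (f : ℝ → ℝ) (μ : ℝ → ℂ) : Prop where
  d_pos : 0 < d
  k_pos : 0 < k
  γ_pos : 0 < γ
  γ_lt : γ < a
  smooth_f : ContDiff ℝ ∞ f
  periodic_f : ∀ x, f (x + d) = f x
  quasi : SmoothQuasiPeriodic d (phase α d) μ

namespace Admissible

variable {d k α γ a : ℝ} {f : ℝ → ℝ} {μ : ℝ → ℂ}

theorem exists_bound (S : Admissible d k α γ a f μ) : ∃ B, ∀ x t, |f x - f t| ≤ B := by
  have hper : Function.Periodic f d := S.periodic_f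
  obtain ⟨C, hC⟩ := (hper.isBounded_of_continuous S.d_pos.ne'
    S.smooth_f.continuous).exists_norm_le
  refine ⟨C + C, fun x t => (abs_sub _ _).trans (add_le_add ?_ ?_)⟩
  · simpa using hC _ ⟨x, rfl⟩
  · simpa using hC _ ⟨t, rfl⟩

theorem quasi_densityX (S : Admissible d k α γ a f μ) (ε : ℝ) :
    SmoothQuasiPeriodic d (phase α d) (densityX ε f μ) := by
  have h : SmoothQuasiPeriodic d 1 (fun t => ((-ε * deriv f t : ℝ) : ℂ)) := by
    refine ⟨Complex.ofRealCLM.contDiff.comp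
      (contDiff_const.mul (contDiff_deriv_of_contDiff S.smooth_f)), fun t => ?_⟩
    beta_reduce
    rw [← deriv_comp_add_const, funext S.periodic_f, one_mul]
  have h2 := h.mul S.quasi
  rwa [one_mul] at h2

theorem quasi_densityY (S : Admissible d k α γ a f μ) :
    SmoothQuasiPeriodic d (phase α d) (densityY μ) :=
  S.quasi.const_mul (-1)

theorem contDiff (S : Admissible d k α γ a f μ) (h : ℝ) (j : ℕ) :
    ContDiff ℝ ∞ (fun q : ℝ × ℝ => regIntegrand f k h j γ a μ q.1 q.2) :=
  contDiff_regIntegrand S.k_pos S.γ_pos S.γ_lt j S.smooth_f S.quasi.1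

end Admissible

/-! ### The twist factor and Wood frequencies -/

/-- The factor of the twisted difference that is adapted to the oscillation of the integrand. -/
def twistFactor (d k α ε : ℝ) : ℂ :=
  Complex.exp (Complex.I * (k * d : ℝ)) * Complex.exp (Complex.I * (ε * α * d : ℝ))

theorem twistFactor_spec {d k α ε : ℝ} (hε : ε = 1 ∨ ε = -1) {p : ℝ → ℂ}
    (hp : SmoothQuasiPeriodic d (phase α d) p) (t : ℝ) :
    p t = twistFactor d k α ε * Complex.exp (-(Complex.I * (k * d : ℝ))) * p (t - ε * d) := by
  have h1 : twistFactor d k α ε * Complex.exp (-(Complex.I * (k * d : ℝ))) =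
      Complex.exp (Complex.I * (ε * α * d : ℝ)) := by
    rw [twistFactor, mul_right_comm, ← Complex.exp_add, add_neg_cancel, Complex.exp_zero, one_mul]
  rw [h1]
  rcases hε with rfl | rfl
  · have h2 := hp.2 (t - 1 * d)
    rw [one_mul, sub_add_cancel, phase] at h2
    simp only [h2, one_mul, Complex.ofReal_mul, mul_assoc]
  · rw [show t - -1 * d = t + d by ring, hp.2, phase, ← mul_assoc, ← Complex.exp_add]
    rw [show Complex.I * ((-1 * α * d : ℝ) : ℂ) + Complex.I * α * d = 0 by push_cast; ring,
      Complex.exp_zero, one_mul]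

/-- A factor equal to `1` means `(k + εα) d ∈ 2πℤ`, hence `k = ±α_n` for some `n`. This is the only
use of the exclusion of Wood frequencies. -/
theorem twistFactor_ne_one {d k α ε : ℝ} (hd : 0 < d) (hε : ε = 1 ∨ ε = -1)
    (hW : ¬ IsWoodFrequency d α k) : twistFactor d k α ε ≠ 1 := by
  intro h
  rw [twistFactor, ← Complex.exp_add, Complex.exp_eq_one_iff] at h
  obtain ⟨n, hn⟩ := h
  have h1 : k * d + ε * α * d = n * (2 * Real.pi) := by
    have h2 : Complex.I * ((k * d + ε * α * d : ℝ) : ℂ) = Complex.I * ((n * (2 * Real.pi) : ℝ) : ℂ) := by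
      push_cast at hn ⊢
      linear_combination hn
    exact_mod_cast mul_left_cancel₀ Complex.I_ne_zero h2
  have h3 : k + ε * α = n * (2 * Real.pi / d) := by
    field_simp
    linarith
  apply hW
  rcases hε with rfl | rfl
  · refine ⟨-n, ?_⟩
    have : k = -(α + ((-n : ℤ) : ℝ) * (2 * Real.pi / d)) := by
      push_cast
      linarith
    rw [this]
    ring
  · refine ⟨n, ?_⟩
    have : k = α + n * (2 * Real.pi / d) := by linarith
    rw [this]

namespace Admissible

variable {d k α γ a : ℝ} {f : ℝ → ℝ} {μ : ℝ → ℂ}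

theorem one_le_max (a : ℝ) : 1 ≤ max 1 a := le_max_left _ _

/-- The decay of the integrand which is due to the shifts of the Green function. -/
theorem decayFamily_regIntegrand (S : Admissible d k α γ a f μ) (h : ℝ) (j n : ℕ) :
    DecayFamily (Set.Icc 0 d) (1 / 2 + ((j + 1) / 2 : ℕ)) n (regIntegrand f k h j γ a μ) := by
  obtain ⟨B, hB⟩ := S.exists_bound
  have h1 := one_le_max a
  have tame : ∀ ε : ℝ, ε = 1 ∨ ε = -1 → TameFamily ε (max 1 a) (1 / 2 + ((j + 1) / 2 : ℕ)) n
      (regIntegrand f k h j γ a μ) := by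
    intro ε hε
    have hX := tameFamily_oscTerm (ε := ε) (k := k) S.d_pos (norm_phase α d)
      (S.quasi_densityX ε) h1 S.smooth_f S.periodic_f hB
      (symbolFamily_kernelSymbolX S.k_pos h j h1 n) le_rfl
    have hY := tameFamily_oscTerm (ε := ε) (k := k) S.d_pos (norm_phase α d)
      S.quasi_densityY h1 S.smooth_f S.periodic_f hB
      (symbolFamily_kernelSymbolY S.k_pos h j h1 n) le_rfl
    exact (hX.add hY).congr fun x t hxt =>
      regIntegrand_eq_oscTerm S.k_pos S.γ_pos S.γ_lt hε j μ x t hxt.le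
  exact decayFamily_of_tame isCompact_Icc h1 (by positivity) n (S.contDiff h j)
    (tame 1 (Or.inl rfl)) (tame (-1) (Or.inr rfl))

end Admissible

/-! ### The integrand outside the window -/

/-- The part of a kernel on the side `ε (t - x) > 0` outside of the window of size `A`. -/
def outerPart (c A ε : ℝ) (F : ℝ → ℝ → ℂ) (x t : ℝ) : ℂ := F x t * (outerCutoff c A (ε * (t - x)) : ℂ)

theorem mul_one_sub_smoothWindow {c A : ℝ} (hc0 : 0 < c) (hc : c < 1) (hA : 0 < A)
    (F : ℝ → ℝ → ℂ) (x t : ℝ) :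
    F x t * ((1 - smoothWindow (c * A) A (x - t) : ℝ) : ℂ) =
      outerPart c A 1 F x t + outerPart c A (-1) F x t := by
  rw [one_sub_smoothWindow hc0 hc hA, outerPart, outerPart]
  rw [show -(x - t) = 1 * (t - x) by ring, show x - t = -1 * (t - x) by ring]
  push_cast
  ring

theorem outerPart_eq_zero {c A ε : ℝ} (hc : c < 1) (hA : 0 < A) (F : ℝ → ℝ → ℂ) (x t : ℝ)
    (h : ε * (t - x) ≤ c * A) : outerPart c A ε F x t = 0 := by
  rw [outerPart, outerCutoff_of_le hc hA h, Complex.ofReal_zero, mul_zero]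

theorem contDiff_outerPart (c A ε : ℝ) {F : ℝ → ℝ → ℂ}
    (hF : ContDiff ℝ ∞ fun q : ℝ × ℝ => F q.1 q.2) :
    ContDiff ℝ ∞ fun q : ℝ × ℝ => outerPart c A ε F q.1 q.2 :=
  hF.mul (Complex.ofRealCLM.contDiff.comp ((contDiff_outerCutoff c A).comp
    (contDiff_const.mul (contDiff_snd.sub contDiff_fst))))

namespace Admissible

variable {d k α γ a : ℝ} {f : ℝ → ℝ} {μ : ℝ → ℂ}

/-- The bound `X^{-1/2}`, available for every `j`, suffices at one end; at the other the cutoff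
vanishes. It disposes of the boundary terms in summation by parts. -/
theorem tendsto_outerPart (S : Admissible d k α γ a f μ) (h : ℝ) (j : ℕ) {c A ε : ℝ}
    (hc : c < 1) (hA : 0 < A) (hε : ε = 1 ∨ ε = -1) (x : ℝ) :
    Tendsto (outerPart c A ε (regIntegrand f k h j γ a μ) x) atTop (𝓝 0) ∧
      Tendsto (outerPart c A ε (regIntegrand f k h j γ a μ) x) atBot (𝓝 0) := by
  set V := outerPart c A ε (regIntegrand f k h j γ a μ) x with hV
  obtain ⟨B, hB⟩ := S.exists_bound
  have h1 := one_le_max a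
  obtain ⟨C1, hC1, hb1⟩ := norm_oscTerm_le (ε := ε) (k := k) S.d_pos (norm_phase α d)
    (S.quasi_densityX ε) h1 hB (symbolFamily_kernelSymbolX S.k_pos h j h1 0).bound
    (w := 1 / 2) (by simp)
  obtain ⟨C2, hC2, hb2⟩ := norm_oscTerm_le (ε := ε) (k := k) S.d_pos (norm_phase α d)
    S.quasi_densityY h1 hB (symbolFamily_kernelSymbolY S.k_pos h j h1 0).bound
    (w := 1 / 2) (by simp)
  have hlim : ∀ l : Filter ℝ, Tendsto (fun t => ε * (t - x)) l atTop → Tendsto V l (𝓝 0) := by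
    intro l hl
    have hg : Tendsto (fun t => (C1 + C2) * (ε * (t - x)) ^ (-(1 / 2) : ℝ) * 2) l (𝓝 0) := by
      have := (((tendsto_rpow_neg_atTop (y := 1 / 2) (by norm_num)).comp hl).const_mul
        (C1 + C2)).mul_const 2
      simpa [Function.comp_def] using this
    refine squeeze_zero_norm' ?_ hg
    filter_upwards [hl.eventually_ge_atTop (max 1 a)] with t ht
    rw [hV, outerPart, norm_mul, Complex.norm_real, Real.norm_eq_abs]
    refine mul_le_mul ?_ (abs_outerCutoff_le _ _ _) (abs_nonneg _)
      (by have := h1.trans ht; positivity)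
    rw [regIntegrand_eq_oscTerm S.k_pos S.γ_pos S.γ_lt hε j μ x t ht, add_mul]
    exact (norm_add_le _ _).trans (add_le_add (hb1 () x t ht) (hb2 () x t ht))
  have hzero : ∀ l : Filter ℝ, Tendsto (fun t => ε * (t - x)) l atBot → Tendsto V l (𝓝 0) := by
    intro l hl
    refine tendsto_const_nhds.congr' ?_
    filter_upwards [hl.eventually_le_atBot (c * A)] with t ht
    exact (outerPart_eq_zero hc hA _ x t ht).symm
  have ht : Tendsto (fun t : ℝ => t - x) atTop atTop :=
    tendsto_atTop_add_const_right atTop (-x) tendsto_id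
  have hb : Tendsto (fun t : ℝ => t - x) atBot atBot :=
    tendsto_atBot_add_const_right atBot (-x) tendsto_id
  rcases hε with rfl | rfl
  · exact ⟨hlim _ (by simpa using ht), hzero _ (by simpa using hb)⟩
  · simp only [neg_one_mul] at hlim hzero
    exact ⟨hzero _ (tendsto_neg_atTop_atBot.comp ht), hlim _ (tendsto_neg_atBot_atTop.comp hb)⟩

/-- The twisted differences of the part of the integrand outside of a large window. -/
theorem norm_twist_outerPart_le (S : Admissible d k α γ a f μ) (h : ℝ) (j : ℕ) {c ε : ℝ}
    (hc : c < 1) (hε : ε = 1 ∨ ε = -1) (Q : ℕ) :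
    ∃ C, 0 ≤ C ∧ ∀ A, 0 < A → max 1 a + Q * d ≤ c * A → ∀ x t,
      ‖(twist (twistFactor d k α ε) (ε * d))^[Q]
        (outerPart c A ε (regIntegrand f k h j γ a μ) x) t‖ ≤
        C * tailWeight (1 / 2 + Q) (c * A) (t - x) := by
  obtain ⟨B, hB⟩ := S.exists_bound
  have h1 := one_le_max a
  have h0 : (0 : ℝ) < max 1 a := by linarith
  have hQd : max 1 a ≤ max 1 a + Q * d := by
    have := S.d_pos
    have : 0 ≤ Q * d := by positivity
    linarith
  -- The cutoff is multiplied into the symbol before differencing, with `A` as index, so the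
  -- constant is uniform in `A`. The `Q` differences gain `Q` powers of `X`.
  have hsymb : ∀ Φ : Unit → ℝ → ℝ → ℂ, (∀ n, SymbolFamily (1 / 2) (max 1 a) n j Φ) →
      SymbolBound (1 / 2 + 0) (max 1 a + Q * d) (j + 0 + 2 * Q) ((backDiff d)^[Q]
        fun (A : Set.Ioi (0 : ℝ)) Y X => Φ () Y X * (outerCutoff c A X : ℂ)) := by
    intro Φ hΦ
    have hm : ∀ n, SymbolFamily (1 / 2 + 0) (max 1 a) n (j + 0)
        fun (A : Set.Ioi (0 : ℝ)) Y X => Φ () Y X * (outerCutoff c A X : ℂ) := fun n =>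
      ((hΦ n).comap fun _ : Set.Ioi (0 : ℝ) => ()).mul h1 (symbolFamily_outerCutoff h0 hc n)
    exact (SymbolFamily.backDiff_iterate (by norm_num) h0 S.d_pos hm Q 0).bound
  have hw : (1 / 2 + Q : ℝ) ≤ 1 / 2 + 0 + ((j + 0 + 2 * Q + 1) / 2 : ℕ) := by
    have : (Q : ℝ) ≤ ((j + 0 + 2 * Q + 1) / 2 : ℕ) := by
      exact_mod_cast (by omega : Q ≤ (j + 0 + 2 * Q + 1) / 2)
    linarith
  obtain ⟨C1, hC1, hb1⟩ := norm_oscTerm_le (ε := ε) (k := k) S.d_pos (norm_phase α d)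
    (S.quasi_densityX ε) (h1.trans hQd) hB
    (hsymb _ (symbolFamily_kernelSymbolX S.k_pos h j h1)) hw
  obtain ⟨C2, hC2, hb2⟩ := norm_oscTerm_le (ε := ε) (k := k) S.d_pos (norm_phase α d)
    S.quasi_densityY (h1.trans hQd) hB
    (hsymb _ (symbolFamily_kernelSymbolY S.k_pos h j h1)) hw
  -- The power of `2` turns `X^{-w}` into `(1 + X)^{-w}` for `X ≥ 1`.
  refine ⟨(C1 + C2) * 2 ^ (1 / 2 + Q : ℝ), by positivity, fun A hA hcA x t => ?_⟩
  set V := outerPart c A ε (regIntegrand f k h j γ a μ) x with hV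
  rcases le_or_gt (ε * (t - x)) (c * A) with hle | hgt
  · rw [twist_iterate_eq_zero hε S.d_pos (fun s hs => outerPart_eq_zero hc hA _ x s hs) Q t hle,
      norm_zero]
    exact mul_nonneg (by positivity) (tailWeight_nonneg _ _ _)
  · have hX : max 1 a + Q * d ≤ ε * (t - x) := by linarith
    have hX1 : 1 ≤ ε * (t - x) := h1.trans (hQd.trans hX)
    have habs : |t - x| = ε * (t - x) := by
      rcases hε with rfl | rfl
      · rw [one_mul] at hX1 ⊢
        exact abs_of_nonneg (by linarith)
      · rw [neg_one_mul] at hX1 ⊢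
        exact abs_of_nonpos (by linarith)
    have hrep : ∀ s, max 1 a ≤ ε * (s - x) → V s =
        oscTerm ε k f (densityX ε f μ) (fun (A : Set.Ioi (0 : ℝ)) Y X =>
          kernelSymbolX k h j () Y X * (outerCutoff c A X : ℂ)) ⟨A, hA⟩ x s +
        oscTerm ε k f (densityY μ) (fun (A : Set.Ioi (0 : ℝ)) Y X =>
          kernelSymbolY k h j () Y X * (outerCutoff c A X : ℂ)) ⟨A, hA⟩ x s := by
      intro s hs
      rw [hV, outerPart, regIntegrand_eq_oscTerm S.k_pos S.γ_pos S.γ_lt hε j μ x s hs]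
      simp only [oscTerm]
      ring
    rw [twist_iterate_eq_oscTerm hε S.d_pos S.periodic_f
      (twistFactor_spec hε (S.quasi_densityX ε)) (twistFactor_spec hε S.quasi_densityY) hrep Q t hX]
    refine (norm_add_le _ _).trans ((add_le_add (hb1 _ x t hX) (hb2 _ x t hX)).trans ?_)
    rw [← add_mul, tailWeight, habs, if_pos hgt.le, mul_assoc]
    refine mul_le_mul_of_nonneg_left ?_ (by positivity)
    have hs0 : 0 < ε * (t - x) := by linarith
    rw [Real.rpow_neg hs0.le, Real.rpow_neg (by positivity), ← div_eq_mul_inv, inv_eq_one_div,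
      div_le_div_iff₀ (by positivity) (by positivity), one_mul,
      ← Real.mul_rpow (by positivity) (by positivity)]
    exact Real.rpow_le_rpow (by positivity) (by linarith) (by positivity)

end Admissible

/-! ### Splitting off an absolutely convergent part -/

/-- `F` is the sum of a rapidly convergent family with smooth bounds and of a difference
`U(t) - U(t - d)` with `U → 0` at infinity. -/
def HasRegularPart (d w : ℝ) (F H : ℝ → ℝ → ℂ) : Prop :=
  (∀ n, DecayFamily (Set.Icc 0 d) w n H) ∧ ∀ x ∈ Set.Icc 0 d, ∃ U : ℝ → ℂ, Continuous U ∧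
    Tendsto U atTop (𝓝 0) ∧ Tendsto U atBot (𝓝 0) ∧ ∀ t, F x t = H x t + (U t - U (t - d))

theorem hasRegularPart_self {d w : ℝ} {F : ℝ → ℝ → ℂ}
    (h : ∀ n, DecayFamily (Set.Icc 0 d) w n F) : HasRegularPart d w F F :=
  ⟨h, fun _ _ => ⟨fun _ => 0, continuous_const, tendsto_const_nhds, tendsto_const_nhds,
    fun t => by simp⟩⟩

namespace HasRegularPart

variable {d w : ℝ} {F H : ℝ → ℝ → ℂ}

theorem integrable {x : ℝ} (h : HasRegularPart d w F H) (hw : 1 < w) (hx : x ∈ Set.Icc 0 d) :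
    Integrable (H x) := by
  obtain ⟨⟨C, hC⟩, hc⟩ := h.1 0
  exact integrable_of_decay hw (hc x hx) (hC x hx)

theorem tendsto_integral {x : ℝ} (h : HasRegularPart d w F H) (hw : 1 < w)
    (hx : x ∈ Set.Icc 0 d) :
    Tendsto (fun P : ℝ × ℝ => ∫ t in P.1..P.2, F x t) (atBot ×ˢ atTop) (𝓝 (∫ t, H x t)) := by
  obtain ⟨U, hUc, hUt, hUb, hF⟩ := h.2 x hx
  have hI := h.integrable hw hx
  have h1 := intervalIntegral_tendsto_integral hI (l := atBot ×ˢ atTop)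
    (a := fun P : ℝ × ℝ => P.1) (b := fun P : ℝ × ℝ => P.2) tendsto_fst tendsto_snd
  have h2 := h1.add (tendsto_integral_sub_shift hUc hUt hUb d)
  rw [add_zero] at h2
  refine h2.congr fun P => ?_
  rw [← intervalIntegral.integral_add hI.intervalIntegrable
    (Continuous.intervalIntegrable (by fun_prop) _ _)]
  exact intervalIntegral.integral_congr fun t _ => (hF t).symm

theorem exists_norm_tsum_le (h : HasRegularPart d w F H) (hw : 1 < w) (hd : 0 < d) :
    ∃ C, ∀ N : ℕ+, ∀ x ∈ Set.Icc 0 d,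
      Summable (fun l : ℤ => (meshSize d N : ℂ) * H x (l * meshSize d N)) ∧
        ‖∑' l : ℤ, (meshSize d N : ℂ) * H x (l * meshSize d N)‖ ≤ C := by
  obtain ⟨⟨C, hC⟩, -⟩ := h.1 0
  obtain ⟨K, hK, hs⟩ := norm_tsum_le_of_tailWeight hw hd
  refine ⟨K * |C| * (1 + 0) ^ (1 - w), fun N x hx => ?_⟩
  have hN : (1 : ℝ) ≤ (N : ℕ) := by exact_mod_cast N.pos
  have := hs |C| (meshSize d N) 0 x 0 (abs_nonneg C) (div_pos hd (by linarith))
    (div_le_self hd.le hN) le_rfl (H x) fun t => by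
      rw [tailWeight_zero]
      exact (hC x hx t).trans (mul_le_mul_of_nonneg_right (le_abs_self C) (by positivity))
  simpa only [zero_add] using this

/-- On the mesh the shift by `d` is a shift by `N` indices, so the difference part telescopes away
for every `N`, just as it does in the integral. -/
theorem hasSum_conditional {x : ℝ} (h : HasRegularPart d w F H) (hw : 1 < w) (hd : 0 < d)
    (hx : x ∈ Set.Icc 0 d) (N : ℕ+) :
    HasSum (fun l : ℤ => (meshSize d N : ℂ) * F x (l * meshSize d N))
      (∑' l : ℤ, (meshSize d N : ℂ) * H x (l * meshSize d N))
      (SummationFilter.conditional ℤ) := by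
  obtain ⟨U, hUc, hUt, hUb, hF⟩ := h.2 x hx
  obtain ⟨C, hC⟩ := h.exists_norm_tsum_le hw hd
  have h1 : HasSum (fun l : ℤ => (meshSize d N : ℂ) * H x (l * meshSize d N))
      (∑' l : ℤ, (meshSize d N : ℂ) * H x (l * meshSize d N))
      (SummationFilter.conditional ℤ) :=
    Tendsto.mono_left (hC N x hx).1.hasSum SummationFilter.le_atTop
  have hN : (0 : ℝ) < (N : ℕ) := by exact_mod_cast N.pos
  have hδ : 0 < meshSize d N := div_pos hd hN
  have hNδ : (((N : ℕ) : ℤ) : ℝ) * meshSize d N = d := by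
    rw [meshSize, Int.cast_natCast]
    field_simp
  have hcast : Tendsto (fun l : ℤ => (l : ℝ) * meshSize d N) atTop atTop :=
    tendsto_intCast_atTop_atTop.atTop_mul_const hδ
  have hcast' : Tendsto (fun l : ℤ => (l : ℝ) * meshSize d N) atBot atBot :=
    (tendsto_intCast_atBot_iff.2 tendsto_id).atBot_mul_const hδ
  have h2 := (hasSum_conditional_sub_shift (hUt.comp hcast) (hUb.comp hcast')
    ((N : ℕ) : ℤ)).mul_left (meshSize d N : ℂ)
  have h3 := h1.add h2
  rw [mul_zero, add_zero] at h3
  refine (congrArg (fun F => HasSum F _ (SummationFilter.conditional ℤ))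
    (funext fun l => ?_)).mp h3
  simp only [Function.comp_apply]
  rw [hF, Int.cast_sub, sub_mul, hNδ]
  ring

theorem trapezoid {w : ℝ} (h : HasRegularPart d w F H) (hw : 1 < w) (hd : 0 < d) (p : ℕ) :
    ∃ E, 0 ≤ E ∧ ∀ N : ℕ+, ∀ x ∈ Set.Icc 0 d,
      ‖(∫ t, H x t) - ∑' l : ℤ, (meshSize d N : ℂ) * H x (l * meshSize d N)‖ ≤
        E * meshSize d N ^ p := by
  obtain ⟨E, hE, hb⟩ := trapezoid_error hw hd p (h.1 p)
  refine ⟨E, hE, fun N x hx => ?_⟩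
  have hN : (1 : ℝ) ≤ (N : ℕ) := by exact_mod_cast N.pos
  have := hb (meshSize d N) (div_pos hd (by linarith)) (div_le_self hd.le hN) x hx 0
  rw [norm_sub_rev]
  simpa only [zero_add] using this

end HasRegularPart

/-! ### The regular part away from Wood frequencies -/

theorem smoothWindow_of_one_le {s : ℝ} (hs : 1 ≤ |s|) : smoothWindow (1 / 2 * 1) 1 s = 0 := by
  rw [smoothWindow_eq (by norm_num), windowProfile_of_one_le]
  rw [le_div_iff₀ (by norm_num)]
  linarith

/-- The absolutely convergent part of a kernel that oscillates on both sides. -/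
def regularPart (d : ℝ) (z₁ z₂ : ℂ) (F : ℝ → ℝ → ℂ) (x t : ℝ) : ℂ :=
  F x t * ((smoothWindow (1 / 2 * 1) 1 (x - t) : ℝ) : ℂ) +
    ((1 - z₁)⁻¹ * twist z₁ (1 * d) (outerPart (1 / 2) 1 1 F x) t +
      (1 - z₂)⁻¹ * twist z₂ (-1 * d) (outerPart (1 / 2) 1 (-1) F x) t)

theorem contDiff_twist (z : ℂ) (s : ℝ) {V : ℝ → ℝ → ℂ}
    (hV : ContDiff ℝ ∞ fun q : ℝ × ℝ => V q.1 q.2) :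
    ContDiff ℝ ∞ fun q : ℝ × ℝ => twist z s (V q.1) q.2 := by
  have hs : ContDiff ℝ ∞ fun q : ℝ × ℝ => ((q.1, q.2 - s) : ℝ × ℝ) :=
    contDiff_fst.prodMk (contDiff_snd.sub contDiff_const)
  have h2 : ContDiff ℝ ∞ fun q : ℝ × ℝ => V q.1 (q.2 - s) := hV.comp hs
  exact hV.sub (contDiff_const.mul h2)

theorem contDiff_regularPart (d : ℝ) (z₁ z₂ : ℂ) {F : ℝ → ℝ → ℂ}
    (hF : ContDiff ℝ ∞ fun q : ℝ × ℝ => F q.1 q.2) :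
    ContDiff ℝ ∞ fun q : ℝ × ℝ => regularPart d z₁ z₂ F q.1 q.2 := by
  have h1 := contDiff_twist z₁ (1 * d) (contDiff_outerPart (1 / 2) 1 1 hF)
  have h2 := contDiff_twist z₂ (-1 * d) (contDiff_outerPart (1 / 2) 1 (-1) hF)
  have hS : ContDiff ℝ ∞ fun q : ℝ × ℝ => ((smoothWindow (1 / 2 * 1) 1 (q.1 - q.2) : ℝ) : ℂ) :=
    Complex.ofRealCLM.contDiff.comp ((contDiff_smoothWindow (by norm_num) (by norm_num)
      one_pos).comp (contDiff_fst.sub contDiff_snd))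
  exact (hF.mul hS).add ((contDiff_const.mul h1).add (contDiff_const.mul h2))

theorem continuous_outerPart (c A ε : ℝ) {F : ℝ → ℝ → ℂ}
    (hF : ContDiff ℝ ∞ fun q : ℝ × ℝ => F q.1 q.2) (x : ℝ) :
    Continuous (outerPart c A ε F x) :=
  (contDiff_outerPart c A ε hF).continuous.comp (Continuous.prodMk_right x)

/-- On each side `V = (1 - z)⁻¹ (V - z V') - (1 - z)⁻¹ z (V - V')` with `V'` the shifted `V`. On the
left side the shift is by `+d`, so `V(t + d)` enters `U` with the opposite sign. -/
theorem exists_eq_regularPart_add {d : ℝ} {z₁ z₂ : ℂ} (h₁ : z₁ ≠ 1) (h₂ : z₂ ≠ 1)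
    {F : ℝ → ℝ → ℂ} (x : ℝ) (hc : ∀ ε, Continuous (outerPart (1 / 2) 1 ε F x))
    (ht : ∀ ε : ℝ, ε = 1 ∨ ε = -1 → Tendsto (outerPart (1 / 2) 1 ε F x) atTop (𝓝 0) ∧
      Tendsto (outerPart (1 / 2) 1 ε F x) atBot (𝓝 0)) :
    ∃ U : ℝ → ℂ, Continuous U ∧ Tendsto U atTop (𝓝 0) ∧ Tendsto U atBot (𝓝 0) ∧
      ∀ t, F x t = regularPart d z₁ z₂ F x t + (U t - U (t - d)) := by
  have hn₁ : 1 - z₁ ≠ 0 := sub_ne_zero.2 h₁.symm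
  have hn₂ : 1 - z₂ ≠ 0 := sub_ne_zero.2 h₂.symm
  obtain ⟨h1t, h1b⟩ := ht 1 (Or.inl rfl)
  obtain ⟨h2t, h2b⟩ := ht (-1) (Or.inr rfl)
  have hc1 := hc 1
  have hc2 := hc (-1)
  refine ⟨fun t => -((1 - z₁)⁻¹ * z₁) * outerPart (1 / 2) 1 1 F x t +
    (1 - z₂)⁻¹ * z₂ * outerPart (1 / 2) 1 (-1) F x (t + d), by fun_prop, ?_, ?_, fun t => ?_⟩
  · have := (h1t.const_mul (-((1 - z₁)⁻¹ * z₁))).add ((h2t.comp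
      (tendsto_atTop_add_const_right atTop d tendsto_id)).const_mul ((1 - z₂)⁻¹ * z₂))
    simpa [Function.comp_def] using this
  · have := (h1b.const_mul (-((1 - z₁)⁻¹ * z₁))).add ((h2b.comp
      (tendsto_atBot_add_const_right atBot d tendsto_id)).const_mul ((1 - z₂)⁻¹ * z₂))
    simpa [Function.comp_def] using this
  · have hsplit := mul_one_sub_smoothWindow (c := 1 / 2) (A := 1) (by norm_num) (by norm_num)
      one_pos F x t
    simp only [regularPart, twist]
    rw [show t - -1 * d = t + d by ring, one_mul d, sub_add_cancel]
    push_cast at hsplit ⊢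
    generalize outerPart (1 / 2) 1 1 F x t = V1 at hsplit ⊢
    generalize outerPart (1 / 2) 1 1 F x (t - d) = V1'
    generalize outerPart (1 / 2) 1 (-1) F x t = V2 at hsplit ⊢
    generalize outerPart (1 / 2) 1 (-1) F x (t + d) = V2'
    have e1 : V1 = (1 - z₁)⁻¹ * (V1 - z₁ * V1') + -((1 - z₁)⁻¹ * z₁) * (V1 - V1') := by
      field_simp
      ring
    have e2 : V2 = (1 - z₂)⁻¹ * (V2 - z₂ * V2') + (1 - z₂)⁻¹ * z₂ * (V2' - V2) := by
      field_simp
      ring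
    linear_combination hsplit + e1 + e2

theorem twist_outerPart_eq_zero {d : ℝ} (hd : 0 < d) {z : ℂ} {ε x t : ℝ}
    (hε : ε = 1 ∨ ε = -1) (F : ℝ → ℝ → ℂ) (h : ε * (t - x) ≤ 0) :
    twist z (ε * d) (outerPart (1 / 2) 1 ε F x) t = 0 :=
  twist_iterate_eq_zero hε hd
    (fun s hs => outerPart_eq_zero (by norm_num) one_pos F x s (by linarith)) 1 t h

theorem regularPart_eq_left {d : ℝ} (hd : 0 < d) {z₁ z₂ : ℂ} (F : ℝ → ℝ → ℂ) {x t : ℝ}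
    (h : 1 ≤ t - x) : regularPart d z₁ z₂ F x t =
      (1 - z₁)⁻¹ * twist z₁ (1 * d) (outerPart (1 / 2) 1 1 F x) t := by
  rw [regularPart, smoothWindow_of_one_le (by rw [abs_sub_comm]; exact le_abs.2 (Or.inl h)),
    twist_outerPart_eq_zero hd (Or.inr rfl) _ (by linarith)]
  simp

theorem regularPart_eq_right {d : ℝ} (hd : 0 < d) {z₁ z₂ : ℂ} (F : ℝ → ℝ → ℂ) {x t : ℝ}
    (h : 1 ≤ x - t) : regularPart d z₁ z₂ F x t =
      (1 - z₂)⁻¹ * twist z₂ (-1 * d) (outerPart (1 / 2) 1 (-1) F x) t := by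
  rw [regularPart, smoothWindow_of_one_le (le_abs.2 (Or.inl h)),
    twist_outerPart_eq_zero hd (Or.inl rfl) _ (by linarith)]
  simp

theorem decayFamily_regularPart_of_tame {d X : ℝ} (hd : 0 < d) (hX : 1 ≤ X) {z₁ z₂ : ℂ}
    {F : ℝ → ℝ → ℂ} (hF : ContDiff ℝ ∞ fun q : ℝ × ℝ => F q.1 q.2) {n : ℕ}
    (h₁ : TameFamily 1 (X + d) (3 / 2) n fun x t => (1 - z₁)⁻¹ *
      twist z₁ (1 * d) (outerPart (1 / 2) 1 1 F x) t)
    (h₂ : TameFamily (-1) (X + d) (3 / 2) n fun x t => (1 - z₂)⁻¹ *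
      twist z₂ (-1 * d) (outerPart (1 / 2) 1 (-1) F x) t) :
    DecayFamily (Set.Icc 0 d) (3 / 2) n (regularPart d z₁ z₂ F) := by
  have hX' : 1 ≤ X + d := by linarith
  have k₁ : TameFamily 1 (X + d) (3 / 2) n (regularPart d z₁ z₂ F) :=
    h₁.congr fun x t hxt => regularPart_eq_left hd F (by linarith)
  have k₂ : TameFamily (-1) (X + d) (3 / 2) n (regularPart d z₁ z₂ F) :=
    h₂.congr fun x t hxt => regularPart_eq_right hd F (by linarith)
  exact decayFamily_of_tame isCompact_Icc hX' (by norm_num) n (contDiff_regularPart d z₁ z₂ hF)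
    k₁ k₂

namespace Admissible

variable {d k α γ a : ℝ} {f : ℝ → ℝ} {μ : ℝ → ℂ}

/-- A single twist lifts the decay from `1/2` to `3/2`, past the threshold `1` for absolute
convergence; here the cutoff has `A = 1` and is already `1`. -/
theorem tameFamily_twist (S : Admissible d k α γ a f μ) (h : ℝ) (j n : ℕ) {ε : ℝ}
    (hε : ε = 1 ∨ ε = -1) :
    TameFamily ε (max 1 a + d) (3 / 2) n fun x t => (1 - twistFactor d k α ε)⁻¹ *
      twist (twistFactor d k α ε) (ε * d)
        (outerPart (1 / 2) 1 ε (regIntegrand f k h j γ a μ) x) t := by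
  obtain ⟨B, hB⟩ := S.exists_bound
  have h1 := one_le_max a
  have h0 : (0 : ℝ) < max 1 a := by linarith
  have h2 : 1 ≤ max 1 a + d := by linarith [S.d_pos]
  set cst := (1 - twistFactor d k α ε)⁻¹
  have hw : (3 / 2 : ℝ) ≤ 1 / 2 + ((j + 2 + 1) / 2 : ℕ) := by
    have : (1 : ℝ) ≤ ((j + 2 + 1) / 2 : ℕ) := by
      exact_mod_cast (by omega : 1 ≤ (j + 2 + 1) / 2)
    linarith
  have hX := tameFamily_oscTerm (ε := ε) (k := k) S.d_pos (norm_phase α d)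
    ((S.quasi_densityX ε).const_mul cst) h2 S.smooth_f S.periodic_f hB
    ((symbolFamily_kernelSymbolX S.k_pos h j h1 (n + 1)).backDiff (by norm_num) h0 S.d_pos) hw
  have hY := tameFamily_oscTerm (ε := ε) (k := k) S.d_pos (norm_phase α d)
    (S.quasi_densityY.const_mul cst) h2 S.smooth_f S.periodic_f hB
    ((symbolFamily_kernelSymbolY S.k_pos h j h1 (n + 1)).backDiff (by norm_num) h0 S.d_pos) hw
  refine (hX.add hY).congr fun x t hxt => ?_
  have hrep : ∀ s, max 1 a ≤ ε * (s - x) →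
      outerPart (1 / 2) 1 ε (regIntegrand f k h j γ a μ) x s =
        oscTerm ε k f (densityX ε f μ) (kernelSymbolX k h j) () x s +
        oscTerm ε k f (densityY μ) (kernelSymbolY k h j) () x s := by
    intro s hs
    rw [outerPart, outerCutoff_of_ge (by norm_num) one_pos (h1.trans hs), Complex.ofReal_one,
      mul_one, regIntegrand_eq_oscTerm S.k_pos S.γ_pos S.γ_lt hε j μ x s hs]
  have := twist_iterate_eq_oscTerm hε S.d_pos S.periodic_f
    (twistFactor_spec hε (S.quasi_densityX ε)) (twistFactor_spec hε S.quasi_densityY) hrep 1 t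
    (by push_cast; linarith)
  simp only [Function.iterate_one] at this
  rw [this]
  simp only [oscTerm]
  ring

theorem decayFamily_regularPart (S : Admissible d k α γ a f μ) (h : ℝ) (j n : ℕ) :
    DecayFamily (Set.Icc 0 d) (3 / 2) n (regularPart d (twistFactor d k α 1)
      (twistFactor d k α (-1)) (regIntegrand f k h j γ a μ)) := by
  have h1 := one_le_max a
  exact decayFamily_regularPart_of_tame (F := regIntegrand f k h j γ a μ)
    (z₁ := twistFactor d k α 1) (z₂ := twistFactor d k α (-1)) S.d_pos h1 (S.contDiff h j)
    (S.tameFamily_twist h j n (Or.inl rfl)) (S.tameFamily_twist h j n (Or.inr rfl))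

theorem hasRegularPart (S : Admissible d k α γ a f μ) (hW : ¬ IsWoodFrequency d α k) (h : ℝ)
    (j : ℕ) : HasRegularPart d (3 / 2) (regIntegrand f k h j γ a μ)
      (regularPart d (twistFactor d k α 1) (twistFactor d k α (-1))
        (regIntegrand f k h j γ a μ)) := by
  exact ⟨S.decayFamily_regularPart h j, fun x _ =>
    exists_eq_regularPart_add (twistFactor_ne_one S.d_pos (Or.inl rfl) hW)
      (twistFactor_ne_one S.d_pos (Or.inr rfl) hW) x
      (fun ε => continuous_outerPart (1 / 2) 1 ε (S.contDiff h j) x)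
      fun ε hε => S.tendsto_outerPart h j (by norm_num) one_pos hε x⟩

end Admissible

/-! ### The discrete operators as sums over the mesh -/

theorem meshSize_pos {d : ℝ} (hd : 0 < d) (N : ℕ+) : 0 < meshSize d N :=
  div_pos hd (by exact_mod_cast N.pos)

theorem meshSize_le {d : ℝ} (hd : 0 < d) (N : ℕ+) : meshSize d N ≤ d :=
  div_le_self hd.le (by exact_mod_cast N.pos)

theorem apply_add_intCast_mul {α d : ℝ} {μ : ℝ → ℂ} (h : ∀ t, μ (t + d) = phase α d * μ t)
    (p : ℤ) (t : ℝ) :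
    μ (t + p * d) = μ t * Complex.exp (Complex.I * α * (p : ℂ) * d) := by
  induction p with
  | zero => simp
  | succ n ih =>
    have := h (t + (n : ℤ) * d)
    rw [ih, phase] at this
    rw [show t + (((n : ℤ) + 1 : ℤ) : ℝ) * d = t + (n : ℤ) * d + d by push_cast; ring, this,
      mul_comm, mul_assoc, ← Complex.exp_add]
    push_cast
    ring_nf
  | pred n ih =>
    have := h (t + ((-(n : ℤ) - 1 : ℤ) : ℝ) * d)
    rw [show t + ((-(n : ℤ) - 1 : ℤ) : ℝ) * d + d = t + ((-(n : ℤ) : ℤ) : ℝ) * d by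
      push_cast; ring, ih, phase] at this
    have e : Complex.exp (Complex.I * α * ((-(n : ℤ) : ℤ) : ℂ) * d) =
        Complex.exp (Complex.I * α * d) *
          Complex.exp (Complex.I * α * ((-(n : ℤ) - 1 : ℤ) : ℂ) * d) := by
      rw [← Complex.exp_add]
      push_cast
      ring_nf
    rw [e] at this
    refine mul_left_cancel₀ (Complex.exp_ne_zero (Complex.I * α * d)) ?_
    rw [← this]
    ring

/-- Division of `l - 1`, not `l`, by `N` matches entries numbered from `1` to `N`; the quotient
counts periods and quasi-periodicity of `μ` restores them. -/
theorem quasiExtend_sampleVec {α d : ℝ} {μ : ℝ → ℂ} (h : ∀ t, μ (t + d) = phase α d * μ t)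
    (N : ℕ+) (l : ℤ) : quasiExtend d α N (sampleVec d N μ) l = μ (l * meshSize d N) := by
  have hN : (0 : ℤ) < (N : ℕ) := by exact_mod_cast N.pos
  have hN' : (((N : ℕ) : ℤ) : ℝ) ≠ 0 := by exact_mod_cast hN.ne'
  rw [quasiExtend, sampleVec, ← apply_add_intCast_mul h]
  congr 1
  have h1 : ((((l - 1) % ((N : ℕ) : ℤ)).toNat : ℤ)) = (l - 1) % ((N : ℕ) : ℤ) :=
    Int.toNat_of_nonneg (Int.emod_nonneg _ hN.ne')
  have h2 := Int.emod_add_mul_ediv (l - 1) ((N : ℕ) : ℤ)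
  rw [meshPoint]
  simp only [h1]
  have h3 : (((l - 1) % ((N : ℕ) : ℤ) : ℤ) : ℝ) + ((N : ℕ) : ℤ) * (((l - 1) / ((N : ℕ) : ℤ) : ℤ) : ℝ)
      = l - 1 := by exact_mod_cast h2
  have h4 : d = (((N : ℕ) : ℤ) : ℝ) * meshSize d N := by
    rw [meshSize]
    push_cast
    field_simp
  generalize meshSize d N = δ at h4
  rw [h4]
  push_cast at h3 ⊢
  linear_combination δ * h3

theorem regTerm_sampleVec {α d : ℝ} {μ : ℝ → ℂ} (h : ∀ t, μ (t + d) = phase α d * μ t)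
    (f : ℝ → ℝ) (k s : ℝ) (j : ℕ) (γ a : ℝ) (N : ℕ+) (x : ℝ) :
    regTerm d α f k s j γ a N (sampleVec d N μ) x = fun l : ℤ =>
      (meshSize d N : ℂ) * regIntegrand f k s j γ a μ x (l * meshSize d N) := by
  funext l
  rw [regTerm, quasiExtend_sampleVec h, regIntegrand, meshPoint]
  push_cast
  ring

theorem dregWindowed_sampleVec {α d : ℝ} {μ : ℝ → ℂ} (h : ∀ t, μ (t + d) = phase α d * μ t)
    (f : ℝ → ℝ) (k s : ℝ) (j : ℕ) (γ a c A : ℝ) (N : ℕ+) (x : ℝ) :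
    DregWindowed d α f k s j γ a c A N (sampleVec d N μ) x = ∑' l : ℤ, (meshSize d N : ℂ) *
      (regIntegrand f k s j γ a μ x (l * meshSize d N) *
        ((smoothWindow (c * A) A (x - l * meshSize d N) : ℝ) : ℂ)) := by
  refine tsum_congr fun l => ?_
  rw [quasiExtend_sampleVec h, regIntegrand, meshPoint]
  push_cast
  ring

/-! ### The effect of the window -/

theorem abs_smoothWindow_le {γ a : ℝ} (h : γ < a) (s : ℝ) : |smoothWindow γ a s| ≤ 1 := by
  rw [smoothWindow_eq h]
  exact norm_windowProfile_le _

theorem smoothWindow_of_le {γ a s : ℝ} (hs : |s| ≤ γ) : smoothWindow γ a s = 1 := if_pos hs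

theorem smoothWindow_of_ge {γ a s : ℝ} (h : γ < a) (hs : a ≤ |s|) : smoothWindow γ a s = 0 := by
  rw [smoothWindow, if_neg (by linarith), if_neg (by linarith)]

/-- For `A ≤ A₀` the support lies in a fixed strip, where `F` is bounded. The rate `2` is an
arbitrary exponent above `1`, chosen to fit the summation lemma. -/
theorem exists_norm_mul_smoothWindow_le {d c : ℝ} (hc : c < 1) {F : ℝ → ℝ → ℂ}
    (hF : Continuous fun q : ℝ × ℝ => F q.1 q.2) (A₀ : ℝ) :
    ∃ M, 0 ≤ M ∧ ∀ A, 0 < A → A ≤ A₀ → ∀ x ∈ Set.Icc 0 d, ∀ t,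
      ‖F x t * ((smoothWindow (c * A) A (x - t) : ℝ) : ℂ)‖ ≤ M * tailWeight 2 0 (t - x) := by
  have hK : IsCompact ((fun q : ℝ × ℝ => ((q.1, q.1 + q.2) : ℝ × ℝ)) ''
      (Set.Icc 0 d ×ˢ Set.Icc (-A₀) A₀)) :=
    (isCompact_Icc.prod isCompact_Icc).image (by fun_prop)
  obtain ⟨M, hM⟩ := hK.exists_bound_of_continuousOn hF.continuousOn
  refine ⟨|M| * (1 + |A₀|) ^ (2 : ℝ), by positivity, fun A hA hAA x hx t => ?_⟩
  have hcA : c * A < A := by nlinarith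
  rw [tailWeight_zero]
  rcases le_or_gt A |x - t| with ht | ht
  · rw [smoothWindow_of_ge hcA ht]
    simp only [Complex.ofReal_zero, mul_zero, norm_zero]
    positivity
  · have ht' : |t - x| ≤ A₀ := by rw [abs_sub_comm]; linarith
    have h1 : ‖F x t‖ ≤ M := hM (x, t) ⟨(x, t - x), ⟨hx, abs_le.1 ht'⟩, by simp⟩
    have h2 := abs_smoothWindow_le hcA (x - t)
    rw [norm_mul, Complex.norm_real, Real.norm_eq_abs]
    have h3 : (1 + |t - x|) ^ (2 : ℝ) ≤ (1 + |A₀|) ^ (2 : ℝ) :=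
      Real.rpow_le_rpow (by positivity) (by linarith [le_abs_self A₀]) (by norm_num)
    have h4 : (1 + |t - x|) ^ (2 : ℝ) * (1 + |t - x|) ^ (-2 : ℝ) = 1 := by
      rw [← Real.rpow_add (by positivity)]
      norm_num
    calc ‖F x t‖ * |smoothWindow (c * A) A (x - t)| ≤ |M| * 1 := by
          gcongr
          exact h1.trans (le_abs_self M)
      _ = |M| * ((1 + |t - x|) ^ (2 : ℝ) * (1 + |t - x|) ^ (-2 : ℝ)) := by rw [h4]
      _ ≤ |M| * (1 + |A₀|) ^ (2 : ℝ) * (1 + |t - x|) ^ (-2 : ℝ) := by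
          rw [mul_assoc]
          gcongr

theorem exists_norm_windowedSum_le {d c : ℝ} (hd : 0 < d) (hc : c < 1) {F : ℝ → ℝ → ℂ}
    (hF : Continuous fun q : ℝ × ℝ => F q.1 q.2) (A₀ : ℝ) :
    ∃ M, 0 ≤ M ∧ ∀ A, 0 < A → A ≤ A₀ → ∀ N : ℕ+, ∀ x ∈ Set.Icc 0 d,
      Summable (fun l : ℤ => (meshSize d N : ℂ) * (F x (l * meshSize d N) *
        ((smoothWindow (c * A) A (x - l * meshSize d N) : ℝ) : ℂ))) ∧
      ‖∑' l : ℤ, (meshSize d N : ℂ) * (F x (l * meshSize d N) *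
        ((smoothWindow (c * A) A (x - l * meshSize d N) : ℝ) : ℂ))‖ ≤ M := by
  obtain ⟨M, hM, hb⟩ := exists_norm_mul_smoothWindow_le (d := d) hc hF A₀
  obtain ⟨K, hK, hs⟩ := norm_tsum_le_of_tailWeight (w := 2) (by norm_num) hd
  refine ⟨K * M * (1 + 0) ^ (1 - 2 : ℝ), by positivity, fun A hA hAA N x hx => ?_⟩
  have := hs M (meshSize d N) 0 x 0 hM (meshSize_pos hd N) (meshSize_le hd N) le_rfl
    (fun t => F x t * ((smoothWindow (c * A) A (x - t) : ℝ) : ℂ)) (hb A hA hAA x hx)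
  simpa only [zero_add] using this

theorem sub_windowedSum_eq {δ x c A : ℝ} {F : ℝ → ℝ → ℂ} {D e : ℂ}
    (hW : Summable (fun l : ℤ => (δ : ℂ) * (F x (l * δ) *
      ((smoothWindow (c * A) A (x - l * δ) : ℝ) : ℂ))))
    (hD : HasSum (fun l : ℤ => (δ : ℂ) * F x (l * δ)) D (SummationFilter.conditional ℤ))
    (he : HasSum (fun l : ℤ => (δ : ℂ) * (F x (l * δ) *
      ((1 - smoothWindow (c * A) A (x - l * δ) : ℝ) : ℂ))) e (SummationFilter.conditional ℤ)) :
    D - ∑' l : ℤ, (δ : ℂ) * (F x (l * δ) *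
      ((smoothWindow (c * A) A (x - l * δ) : ℝ) : ℂ)) = e := by
  have h1 : HasSum _ _ (SummationFilter.conditional ℤ) :=
    Tendsto.mono_left hW.hasSum SummationFilter.le_atTop
  have h2 := h1.add he
  have h3 : D = _ := hD.unique ((congrArg (fun G => HasSum G _ (SummationFilter.conditional ℤ))
    (funext fun l => ?_)).mp h2)
  · rw [h3]
    ring
  · push_cast
    ring

theorem one_add_rpow_le {c A s : ℝ} (hc : 0 < c) (hA : 0 < A) (hs : s ≤ 0) :
    (1 + c * A) ^ s ≤ c ^ s * A ^ s := by
  rw [← Real.mul_rpow hc.le hA.le]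
  exact Real.rpow_le_rpow_of_nonpos (by positivity) (by linarith) hs

/-- The error is the sum of `F` against `1 - S`, which is supported in `|t - x| ≥ cA`; an absolutely
convergent tail of rate `w` has size `A^{1 - w}`. -/
theorem norm_sub_windowedSum_le_of_decay {d w c : ℝ} (hw : 1 < w) (hd : 0 < d) (hc0 : 0 < c)
    (hc : c < 1) {F : ℝ → ℝ → ℂ} (hF : Continuous fun q : ℝ × ℝ => F q.1 q.2)
    (hdec : DecayFamily (Set.Icc 0 d) w 0 F) :
    ∃ C, ∀ A, 0 < A → ∀ N : ℕ+, ∀ x ∈ Set.Icc 0 d, ∀ D : ℂ,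
      HasSum (fun l : ℤ => (meshSize d N : ℂ) * F x (l * meshSize d N)) D
        (SummationFilter.conditional ℤ) →
      ‖D - ∑' l : ℤ, (meshSize d N : ℂ) * (F x (l * meshSize d N) *
        ((smoothWindow (c * A) A (x - l * meshSize d N) : ℝ) : ℂ))‖ ≤ C * A ^ (1 - w) := by
  obtain ⟨⟨B, hB⟩, -⟩ := hdec
  obtain ⟨K, hK, hs⟩ := norm_tsum_le_of_tailWeight hw hd
  refine ⟨K * (|B| * 2) * c ^ (1 - w), fun A hA N x hx D hD => ?_⟩
  have hcA : c * A < A := by nlinarith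
  obtain ⟨M, -, hM⟩ := exists_norm_windowedSum_le hd hc hF A
  obtain ⟨h1, h2⟩ := hs (|B| * 2) (meshSize d N) (c * A) x 0 (by positivity) (meshSize_pos hd N)
    (meshSize_le hd N) (by positivity)
    (fun t => F x t * ((1 - smoothWindow (c * A) A (x - t) : ℝ) : ℂ)) fun t => by
      rw [tailWeight]
      split_ifs with ht
      · have h3 : |1 - smoothWindow (c * A) A (x - t)| ≤ 2 := by
          have := abs_le.1 (abs_smoothWindow_le hcA (x - t))
          exact abs_le.2 ⟨by linarith, by linarith⟩
        rw [norm_mul, Complex.norm_real, Real.norm_eq_abs]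
        calc ‖F x t‖ * |1 - smoothWindow (c * A) A (x - t)|
            ≤ (|B| * (1 + |t - x|) ^ (-w)) * 2 := by
              gcongr
              exact (hB x hx t).trans (mul_le_mul_of_nonneg_right (le_abs_self B) (by positivity))
          _ = |B| * 2 * (1 + |t - x|) ^ (-w) := by ring
      · rw [smoothWindow_of_le (by rw [abs_sub_comm]; linarith)]
        simp
  simp only [zero_add] at h1 h2
  rw [sub_windowedSum_eq (hM A hA le_rfl N x hx).1 hD
    (Tendsto.mono_left h1.hasSum SummationFilter.le_atTop)]
  refine h2.trans ?_
  rw [mul_assoc _ (c ^ (1 - w))]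
  gcongr
  exact one_add_rpow_le hc0 hA (by linarith)

/-- If the outer parts of `F` become small under the differences `twist z`, then so does the
error of the window. -/
theorem norm_sub_windowedSum_le_of_twist {d c X : ℝ} (hd : 0 < d) (hc0 : 0 < c) (hc : c < 1)
    (hX : 0 < X) {F : ℝ → ℝ → ℂ} (hF : Continuous fun q : ℝ × ℝ => F q.1 q.2) {z : ℝ → ℂ}
    (hz : ∀ ε : ℝ, ε = 1 ∨ ε = -1 → z ε ≠ 1) (q : ℕ)
    (htend : ∀ A, 0 < A → ∀ ε : ℝ, ε = 1 ∨ ε = -1 → ∀ x,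
      Tendsto (outerPart c A ε F x) atTop (𝓝 0) ∧ Tendsto (outerPart c A ε F x) atBot (𝓝 0))
    (htwist : ∀ ε : ℝ, ε = 1 ∨ ε = -1 → ∃ C, 0 ≤ C ∧ ∀ A, 0 < A → X ≤ c * A → ∀ x t,
      ‖(twist (z ε) (ε * d))^[q + 1] (outerPart c A ε F x) t‖ ≤
        C * tailWeight (1 / 2 + (q + 1 : ℕ)) (c * A) (t - x))
    {B : ℝ} {D : ℕ+ → ℝ → ℂ} (hB : ∀ N, ∀ x ∈ Set.Icc 0 d, ‖D N x‖ ≤ B)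
    (hD : ∀ N : ℕ+, ∀ x ∈ Set.Icc 0 d,
      HasSum (fun l : ℤ => (meshSize d N : ℂ) * F x (l * meshSize d N)) (D N x)
        (SummationFilter.conditional ℤ)) :
    ∃ C, ∀ A, 0 < A → ∀ N : ℕ+, ∀ x ∈ Set.Icc 0 d,
      ‖D N x - ∑' l : ℤ, (meshSize d N : ℂ) * (F x (l * meshSize d N) *
        ((smoothWindow (c * A) A (x - l * meshSize d N) : ℝ) : ℂ))‖ ≤
        C * A ^ (-(q : ℝ)) := by
  have hw : (1 : ℝ) < 1 / 2 + (q + 1 : ℕ) := by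
    push_cast
    linarith [q.cast_nonneg (α := ℝ)]
  set r : ℝ := -(q : ℝ) with hr
  have hr0 : r ≤ 0 := neg_nonpos.2 q.cast_nonneg
  obtain ⟨K, hK, hs⟩ := norm_tsum_le_of_tailWeight hw hd
  have hside : ∀ ε : ℝ, ε = 1 ∨ ε = -1 → ∃ C, ∀ A, 0 < A → X ≤ c * A → ∀ N : ℕ+, ∀ x, ∃ e,
      HasSum (fun l : ℤ => (meshSize d N : ℂ) * outerPart c A ε F x (l * meshSize d N)) e
        (SummationFilter.conditional ℤ) ∧ ‖e‖ ≤ C * A ^ r := by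
    intro ε hε
    obtain ⟨C, hC, hb⟩ := htwist ε hε
    refine ⟨‖(1 - z ε)⁻¹ ^ (q + 1)‖ * (K * C * c ^ r), fun A hA hXA N x => ?_⟩
    obtain ⟨h1, h2⟩ := hs C (meshSize d N) (c * A) x 0 hC (meshSize_pos hd N) (meshSize_le hd N)
      (by positivity) _ (hb A hA hXA x)
    simp only [zero_add] at h1 h2
    refine ⟨_, hasSum_of_hasSum_twist hε (hz ε hε) N (q + 1) (htend A hA ε hε x).1
      (htend A hA ε hε x).2 hd (Tendsto.mono_left h1.hasSum SummationFilter.le_atTop), ?_⟩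
    rw [norm_mul, mul_assoc]
    refine mul_le_mul_of_nonneg_left (h2.trans ?_) (norm_nonneg _)
    rw [mul_assoc _ (c ^ r)]
    refine mul_le_mul_of_nonneg_left (le_trans ?_ (one_add_rpow_le hc0 hA hr0)) (by positivity)
    have hcA : 0 < c * A := mul_pos hc0 hA
    -- The `q + 1` twists give the exponent `-(q + 1/2)`; the spare half power is discarded.
    refine Real.rpow_le_rpow_of_exponent_le (by linarith) ?_
    rw [hr]
    push_cast
    linarith
  obtain ⟨C₁, h₁⟩ := hside 1 (Or.inl rfl)
  obtain ⟨C₂, h₂⟩ := hside (-1) (Or.inr rfl)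
  -- Below this window size the twisted estimate is unavailable; there both sums are bounded and
  -- `A^{-q}` is bounded below, so enlarging the constant suffices.
  set A₀ := X / c with hA₀
  have hA₀0 : 0 < A₀ := by positivity
  obtain ⟨M, hM, hMb⟩ := exists_norm_windowedSum_le hd hc hF A₀
  set T := (|B| + M) * A₀ ^ (-r) with hT
  refine ⟨max (C₁ + C₂) T, fun A hA N x hx => ?_⟩
  have hAr : 0 < A ^ r := Real.rpow_pos_of_pos hA r
  rcases le_or_gt A₀ A with hAA | hAA
  · have hXA : X ≤ c * A := by
      rw [hA₀, div_le_iff₀ hc0] at hAA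
      linarith
    obtain ⟨e₁, hs₁, hn₁⟩ := h₁ A hA hXA N x
    obtain ⟨e₂, hs₂, hn₂⟩ := h₂ A hA hXA N x
    obtain ⟨_, -, hsum⟩ := exists_norm_windowedSum_le hd hc hF A
    rw [sub_windowedSum_eq (e := e₁ + e₂) (hsum A hA le_rfl N x hx).1 (hD N x hx)
      ((congrArg (fun G => HasSum G _ (SummationFilter.conditional ℤ))
        (funext fun l => ?_)).mp (hs₁.add hs₂))]
    · calc ‖e₁ + e₂‖ ≤ C₁ * A ^ r + C₂ * A ^ r := (norm_add_le _ _).trans (add_le_add hn₁ hn₂)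
        _ = (C₁ + C₂) * A ^ r := by ring
        _ ≤ _ := by gcongr; exact le_max_left _ _
    · rw [mul_one_sub_smoothWindow hc0 hc hA, mul_add]
  · have h3 : 1 ≤ A₀ ^ (-r) * A ^ r := by
      rw [Real.rpow_neg hA₀0.le, inv_mul_eq_div, one_le_div (Real.rpow_pos_of_pos hA₀0 r)]
      exact Real.rpow_le_rpow_of_nonpos hA hAA.le hr0
    have hBM : 0 ≤ |B| + M := by positivity
    calc _ ≤ ‖D N x‖ + _ := norm_sub_le _ _
      _ ≤ |B| + M := add_le_add ((hB N x hx).trans (le_abs_self B)) (hMb A hA hAA.le N x hx).2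
      _ ≤ (|B| + M) * (A₀ ^ (-r) * A ^ r) := le_mul_of_one_le_right hBM h3
      _ = T * A ^ r := by rw [hT]; ring
      _ ≤ _ := by gcongr; exact le_max_right _ _

theorem tendsto_meshSize (d : ℝ) : Tendsto (meshSize d) atTop (𝓝 0) :=
  tendsto_const_nhds.div_atTop
    (tendsto_natCast_atTop_atTop.comp tendsto_PNat_val_atTop_atTop)

theorem tendstoUniformlyOn_of_norm_sub_le {d : ℝ} {s : Set ℝ} {g : ℝ → ℂ}
    {W : ℝ × ℕ+ → ℝ → ℂ} {E C r : ℝ} (hr : 0 < r)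
    (h : ∀ A : ℝ, 0 < A → ∀ N : ℕ+, ∀ x ∈ s, ‖g x - W (A, N) x‖ ≤
      E * meshSize d N ^ 1 + C * A ^ (-r)) :
    TendstoUniformlyOn W g (atTop ×ˢ atTop) s := by
  have hlim : Tendsto (fun P : ℝ × ℕ+ => E * meshSize d P.2 ^ 1 + C * P.1 ^ (-r))
      (atTop ×ˢ atTop) (𝓝 0) := by
    have h1 : Tendsto (fun P : ℝ × ℕ+ => meshSize d P.2 ^ 1) (atTop ×ˢ atTop) (𝓝 (0 ^ 1)) :=
      ((tendsto_meshSize d).comp tendsto_snd).pow 1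
    have h2 : Tendsto (fun P : ℝ × ℕ+ => P.1 ^ (-r)) (atTop ×ˢ atTop) (𝓝 0) :=
      (tendsto_rpow_neg_atTop hr).comp tendsto_fst
    simpa using (h1.const_mul E).add (h2.const_mul C)
  rw [Metric.tendstoUniformlyOn_iff]
  intro ε hε
  have hpos : ∀ᶠ P : ℝ × ℕ+ in atTop ×ˢ atTop, 0 < P.1 :=
    tendsto_fst.eventually (eventually_gt_atTop 0)
  filter_upwards [hlim.eventually (gt_mem_nhds hε), hpos] with P hP hA x hx
  rw [dist_eq_norm]
  exact (h P.1 hA P.2 x hx).trans_lt hP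

namespace Admissible

variable {d k α γ a : ℝ} {f : ℝ → ℝ} {μ : ℝ → ℂ}

/-- If `j ≥ 1` the integrand is its own regular part, since `1/2 + ⌈j/2⌉ ≥ 3/2`; otherwise one twist
is used. Convergence and the mesh error then need no further case distinction. -/
theorem exists_hasRegularPart (S : Admissible d k α γ a f μ) (h : ℝ) {j : ℕ}
    (hreg : 1 ≤ j ∨ ¬ IsWoodFrequency d α k) :
    ∃ w H, 1 < w ∧ HasRegularPart d w (regIntegrand f k h j γ a μ) H := by
  rcases hreg with hj | hW
  · have : (1 : ℝ) ≤ ((j + 1) / 2 : ℕ) := by exact_mod_cast (by omega : 1 ≤ (j + 1) / 2)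
    exact ⟨_, _, by linarith, hasRegularPart_self (S.decayFamily_regIntegrand h j)⟩
  · exact ⟨_, _, by norm_num, S.hasRegularPart hW h j⟩

/-- The bound for the window away from Wood frequencies. -/
theorem norm_sub_windowedSum_le (S : Admissible d k α γ a f μ) (h : ℝ) (j : ℕ) {c : ℝ}
    (hc0 : 0 < c) (hc : c < 1) (hW : ¬ IsWoodFrequency d α k) {B : ℝ} {D : ℕ+ → ℝ → ℂ}
    (hB : ∀ N, ∀ x ∈ Set.Icc 0 d, ‖D N x‖ ≤ B)
    (hD : ∀ N : ℕ+, ∀ x ∈ Set.Icc 0 d,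
      HasSum (fun l : ℤ => (meshSize d N : ℂ) *
        regIntegrand f k h j γ a μ x (l * meshSize d N)) (D N x)
        (SummationFilter.conditional ℤ)) (q : ℕ) :
    ∃ C, ∀ A, 0 < A → ∀ N : ℕ+, ∀ x ∈ Set.Icc 0 d,
      ‖D N x - ∑' l : ℤ, (meshSize d N : ℂ) *
        (regIntegrand f k h j γ a μ x (l * meshSize d N) *
        ((smoothWindow (c * A) A (x - l * meshSize d N) : ℝ) : ℂ))‖ ≤
        C * A ^ (-(q : ℝ)) := by
  have h1 := one_le_max a
  have hX : 0 < max 1 a + ((q + 1 : ℕ) : ℝ) * d := by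
    have := S.d_pos
    positivity
  exact norm_sub_windowedSum_le_of_twist S.d_pos hc0 hc hX (S.contDiff h j).continuous
    (z := twistFactor d k α) (fun ε hε => twistFactor_ne_one S.d_pos hε hW) q
    (fun A hA ε hε x => S.tendsto_outerPart h j hc hA hε x)
    (fun ε hε => S.norm_twist_outerPart_le h j hc hε (q + 1)) hB hD

end Admissible

end WoodNystrom

end

/-! ### The main theorem -/

theorem lemmaA1
    -- period, wavenumber, shift, quasi-periodicity parameter, window parameters, order of the shift
    (d k h α γ a c : ℝ) (j : ℕ) (f : ℝ → ℝ) (μ : ℝ → ℂ)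
    (hd : 0 < d) (hk : 0 < k) (hh : 0 < h) (hα : 0 ≤ α)
    (hγ : 0 < γ) (hγa : γ < a) (had : a < d) (hc0 : 0 < c) (hc1 : c < 1)
    (hf : ContDiff ℝ ∞ f) (hfper : ∀ x, f (x + d) = f x)
    (hμ : ContDiff ℝ ∞ μ)
    (hμper : ∀ x, μ (x + d) = μ x * Complex.exp (Complex.I * α * d))
    -- either the Green function is really shifted, or the frequency is not a Wood frequency
    (hreg : 1 ≤ j ∨ ¬ WoodNystrom.IsWoodFrequency d α k) :
    -- the integral and the series that define the operators converge
    (∀ x ∈ Set.Icc 0 d, WoodNystrom.HasImproperIntegral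
      (WoodNystrom.regIntegrand f k h j γ a μ x) (WoodNystrom.Dreg f k h j γ a μ x)) ∧
    (∀ N : ℕ+, ∀ x ∈ Set.Icc 0 d, Summable
      (WoodNystrom.regTerm d α f k h j γ a N (WoodNystrom.sampleVec d N μ) x)
      (SummationFilter.conditional ℤ)) ∧
    -- uniform convergence as `A → ∞` and `Δx = d / N → 0`
    TendstoUniformlyOn
      (fun (P : ℝ × ℕ+) (x : ℝ) => WoodNystrom.DregWindowed d α f k h j γ a c P.1 P.2
        (WoodNystrom.sampleVec d P.2 μ) x)
      (WoodNystrom.Dreg f k h j γ a μ) (atTop ×ˢ atTop) (Set.Icc 0 d) ∧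
    ∃ E : ℕ → ℝ,
      -- all frequencies, in particular near and at Wood frequencies
      (1 ≤ j → ∃ C : ℝ, ∀ p : ℕ, 1 ≤ p → ∀ A : ℝ, 0 < A → ∀ N : ℕ+, ∀ x ∈ Set.Icc 0 d,
        ‖WoodNystrom.Dreg f k h j γ a μ x -
            WoodNystrom.DregWindowed d α f k h j γ a c A N (WoodNystrom.sampleVec d N μ) x‖ ≤
          E p * WoodNystrom.meshSize d N ^ p +
            C * A ^ (-((((j + 1) / 2 : ℕ) : ℝ) - 1 / 2))) ∧
      -- away from Wood frequencies
      (¬ WoodNystrom.IsWoodFrequency d α k →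
        ∃ C : ℕ → ℝ, ∀ p : ℕ, 1 ≤ p → ∀ q : ℕ, 1 ≤ q → ∀ A : ℝ, 0 < A → ∀ N : ℕ+,
          ∀ x ∈ Set.Icc 0 d,
          ‖WoodNystrom.Dreg f k h j γ a μ x -
              WoodNystrom.DregWindowed d α f k h j γ a c A N (WoodNystrom.sampleVec d N μ) x‖ ≤
            E p * WoodNystrom.meshSize d N ^ p + C q * A ^ (-(q : ℝ))) ∧
      -- the limiting discrete operator
      (∀ p : ℕ, ∀ N : ℕ+, ∀ x ∈ Set.Icc 0 d,
        ‖WoodNystrom.Dreg f k h j γ a μ x -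
            WoodNystrom.DregDiscrete d α f k h j γ a N (WoodNystrom.sampleVec d N μ) x‖ ≤
          E p * WoodNystrom.meshSize d N ^ p) := by
  have S : WoodNystrom.Admissible d k α γ a f μ :=
    ⟨hd, hk, hγ, hγa, hf, hfper, hμ, fun t => (hμper t).trans (mul_comm _ _)⟩
  obtain ⟨w, H, hw, hH⟩ := S.exists_hasRegularPart h hreg
  have hcont := (S.contDiff h j).continuous
  have hper := S.quasi.2
  have hterm := WoodNystrom.regTerm_sampleVec hper f k h j γ a
  have hwin := WoodNystrom.dregWindowed_sampleVec hper f k h j γ a c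
  have hsum : ∀ N : ℕ+, ∀ x ∈ Set.Icc 0 d, HasSum
      (WoodNystrom.regTerm d α f k h j γ a N (WoodNystrom.sampleVec d N μ) x)
      (WoodNystrom.DregDiscrete d α f k h j γ a N (WoodNystrom.sampleVec d N μ) x)
      (SummationFilter.conditional ℤ) := fun N x hx => by
    have := hH.hasSum_conditional hw hd hx N
    rw [← hterm] at this
    exact this.summable.hasSum
  have hdisc : ∀ N : ℕ+, ∀ x ∈ Set.Icc 0 d,
      WoodNystrom.DregDiscrete d α f k h j γ a N (WoodNystrom.sampleVec d N μ) x =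
        ∑' l : ℤ, (WoodNystrom.meshSize d N : ℂ) * H x (l * WoodNystrom.meshSize d N) :=
    fun N x hx => by
      have h1 := hsum N x hx
      rw [hterm] at h1
      exact h1.unique (hH.hasSum_conditional hw hd hx N)
  have hexact : ∀ x ∈ Set.Icc 0 d, WoodNystrom.Dreg f k h j γ a μ x = ∫ t, H x t :=
    fun x hx => (hH.tendsto_integral hw hx).limUnder_eq
  -- The constants `E p` come from the unwindowed comparison alone, hence are independent of `A` and
  -- `q` and serve all three estimates.
  choose E hE0 hE using fun p => hH.trapezoid hw hd p
  have htrap : ∀ p : ℕ, ∀ N : ℕ+, ∀ x ∈ Set.Icc 0 d, ‖WoodNystrom.Dreg f k h j γ a μ x -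
      WoodNystrom.DregDiscrete d α f k h j γ a N (WoodNystrom.sampleVec d N μ) x‖ ≤
        E p * WoodNystrom.meshSize d N ^ p := fun p N x hx => by
    rw [hexact x hx, hdisc N x hx]
    exact hE p N x hx
  have hadd : ∀ (p : ℕ) (A : ℝ) (N : ℕ+) (r : ℝ), ∀ x ∈ Set.Icc 0 d,
      ‖WoodNystrom.DregDiscrete d α f k h j γ a N (WoodNystrom.sampleVec d N μ) x -
        WoodNystrom.DregWindowed d α f k h j γ a c A N (WoodNystrom.sampleVec d N μ) x‖ ≤ r →
      ‖WoodNystrom.Dreg f k h j γ a μ x -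
        WoodNystrom.DregWindowed d α f k h j γ a c A N (WoodNystrom.sampleVec d N μ) x‖ ≤
        E p * WoodNystrom.meshSize d N ^ p + r := fun p A N r x hx hr =>
    (norm_sub_le_norm_sub_add_norm_sub _ _ _).trans (add_le_add (htrap p N x hx) hr)
  have hone : 1 ≤ j → ∃ C : ℝ, ∀ p : ℕ, 1 ≤ p → ∀ A : ℝ, 0 < A → ∀ N : ℕ+, ∀ x ∈ Set.Icc 0 d,
      ‖WoodNystrom.Dreg f k h j γ a μ x -
        WoodNystrom.DregWindowed d α f k h j γ a c A N (WoodNystrom.sampleVec d N μ) x‖ ≤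
        E p * WoodNystrom.meshSize d N ^ p +
          C * A ^ (-((((j + 1) / 2 : ℕ) : ℝ) - 1 / 2)) := by
    intro hj
    have hj' : (1 : ℝ) ≤ ((j + 1) / 2 : ℕ) := by exact_mod_cast (by omega : 1 ≤ (j + 1) / 2)
    obtain ⟨C, hC⟩ := WoodNystrom.norm_sub_windowedSum_le_of_decay (by linarith) hd hc0 hc1 hcont
      (S.decayFamily_regIntegrand h j 0)
    refine ⟨C, fun p _ A hA N x hx => hadd p A N _ x hx ?_⟩
    have h1 := hsum N x hx
    rw [hterm] at h1
    have h2 := hC A hA N x hx _ h1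
    rw [show (1 : ℝ) - (1 / 2 + ((j + 1) / 2 : ℕ)) = -((((j + 1) / 2 : ℕ) : ℝ) - 1 / 2) by
      ring] at h2
    rw [hwin]
    exact h2
  have hnonWood : ¬ WoodNystrom.IsWoodFrequency d α k →
      ∃ C : ℕ → ℝ, ∀ p : ℕ, 1 ≤ p → ∀ q : ℕ, 1 ≤ q → ∀ A : ℝ, 0 < A → ∀ N : ℕ+,
        ∀ x ∈ Set.Icc 0 d, ‖WoodNystrom.Dreg f k h j γ a μ x -
          WoodNystrom.DregWindowed d α f k h j γ a c A N (WoodNystrom.sampleVec d N μ) x‖ ≤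
          E p * WoodNystrom.meshSize d N ^ p + C q * A ^ (-(q : ℝ)) := by
    intro hW
    -- A bound on the unwindowed sums, uniform in `N` and `x`, which covers small `A`.
    obtain ⟨B, hB⟩ := hH.exists_norm_tsum_le hw hd
    have hq := fun q : ℕ => S.norm_sub_windowedSum_le h j hc0 hc1 hW (B := B)
      (D := fun N x => WoodNystrom.DregDiscrete d α f k h j γ a N (WoodNystrom.sampleVec d N μ) x)
      (fun N x hx => by rw [hdisc N x hx]; exact (hB N x hx).2)
      (fun N x hx => by
        have h1 := hsum N x hx
        rwa [hterm] at h1) q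
    choose C hC using hq
    refine ⟨C, fun p _ q _ A hA N x hx => hadd p A N _ x hx ?_⟩
    rw [hwin]
    exact hC q A hA N x hx
  refine ⟨fun x hx => ⟨?_, ?_⟩, fun N x hx => (hsum N x hx).summable, ?_, E, hone, hnonWood,
    htrap⟩
  · exact (hcont.comp (Continuous.prodMk_right x)).locallyIntegrable
  · rw [hexact x hx]
    exact hH.tendsto_integral hw hx
  · rcases hreg with hj | hW
    · have hj' : (1 : ℝ) ≤ ((j + 1) / 2 : ℕ) := by
        exact_mod_cast (by omega : 1 ≤ (j + 1) / 2)
      obtain ⟨C, hC⟩ := hone hj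
      exact WoodNystrom.tendstoUniformlyOn_of_norm_sub_le (by linarith) (hC 1 le_rfl)
    · obtain ⟨C, hC⟩ := hnonWood hW
      exact WoodNystrom.tendstoUniformlyOn_of_norm_sub_le (by norm_num) (hC 1 le_rfl 1 le_rfl)
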